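/- All hypergraphs are finite. A hypergraph has a nonempty vertex set, and its edge set is a set of nonempty subsets of the vertex set; it is $k$-uniform if every edge has exactly $k$ vertices, its size is its number of edges, and the degree of a vertex is the number of edges containing it. A walk of length $p$ is a sequence $(v_0,e_1,v_1,\dots,e_p,v_p)$ of vertices and edges with $v_{i-1},v_i\in e_i$ and $v_{i-1}\ne v_i$. It is a path if all its vertices and all its edges are distinct, and a cycle if $p\ge 2$ and all its vertices and edges are distinct except that $v_0=v_p$. A hypertree is a hypergraph without cycles in which any two vertices are joined by a path. The distance of two vertices is the length of a shortest path between them, and the distance spectral radius $\rho(G)$ of a connected hypergraph $G$ is the largest eigenvalue of its distance matrix. For $k\ge 2$ let $\mathbb{T}_k(m,\Delta,n)$ be the set of $k$-uniform hypertrees with $m$ edges and maximum degree $\Delta$ in which exactly $n$ vertices have degree $\Delta$. The $k$-uniform loose path with $\ell\ge1$ edges is the hypertree $(u_0,e_1,u_1,\dots,u_{\ell-1},e_\ell,u_\ell)$ in which $u_1,\dots,u_{\ell-1}$ have degree $2$ and all other vertices have degree $1$. The $k$-uniform hyperstar with $c\ge 0$ edges is the hypertree consisting of $c$ edges of size $k$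 that share exactly one common vertex, its center, and are otherwise disjoint (for $c=0$ it is a single vertex). A $k$-uniform caterpillar is a hypergraph obtained from a $k$-uniform loose path with at least one edge by attaching to each of its vertices $x$ (not only to the $u_i$) a $k$-uniform hyperstar with some number $c_x\ge0$ of edges, its center being identified with $x$. The caterpillar $C_k(\ell,\Delta,a,b)$ is obtained from the $k$-uniform loose path with $\ell$ edges by attaching in this way a hyperstar with $\Delta-2$ edges at each $u_i$ with $1\le i\le \ell-1$ and ($i\le a$ or $i\ge \ell-b$), and nothing at the other vertices. **Theorem.** Let $k\ge2$, $\Delta\ge3$, $n\ge2$ and $m$ be integers, and let $T$ be a caterpillar in $\mathbb{T}_k(m,\Delta,n)$. Put $m^*=m-n(\Delta-2)$. Then $$\rho(T)\le\rho\bigl(C_k(m^*,\Delta,\lfloor n/2\rfloor,\lceil n/2\rceil)\bigr),$$ and equality holds if and only if $T$ is isomorphic to $C_k(m^*,\Delta,\lfloor n/2\rfloor,\lceil n/2\rceil)$. -/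

import Mathlib

/-! Finite hypergraphs in the sense of Mathlib's `Hypergraph α`: a vertex set `V(H) : Set α`, and a
set `E(H)` of edges, which are subsets of `V(H)`. -/

namespace Hypergraph

universe u v

variable {α : Type u} {β : Type v}

/-- Two hypergraphs are isomorphic if some map that is injective on the vertices of the first
carries its vertex set and its edge set exactly to those of the second. -/
def IsIsomorphic (H : Hypergraph α) (K : Hypergraph β) : Prop :=
  ∃ f : α → β, Set.InjOn f V(H) ∧ H.image f = K

/-- Every edge has exactly `k` vertices. -/
def IsUniform (H : Hypergraph α) (k : ℕ) : Prop :=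
  ∀ e ∈ E(H), e.Finite ∧ e.ncard = k

/-- The degree of a vertex: the number of edges that contain it. -/
noncomputable def degree (H : Hypergraph α) (x : α) : ℕ :=
  {e ∈ E(H) | x ∈ e}.ncard

/-- The sequence `(w 0, e 0, w 1, e 1, …, e (p-1), w p)` is a walk of length `p` in `H`. -/
structure IsWalk (H : Hypergraph α) (p : ℕ) (w : Fin (p + 1) → α) (e : Fin p → Set α) : Prop where
  vertex_mem : ∀ i, w i ∈ V(H)
  edge_mem : ∀ i, e i ∈ E(H)
  left_mem : ∀ i : Fin p, w i.castSucc ∈ e i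
  right_mem : ∀ i : Fin p, w i.succ ∈ e i
  ne : ∀ i : Fin p, w i.castSucc ≠ w i.succ

/-- A path is a walk with distinct vertices and distinct edges. -/
structure IsPath (H : Hypergraph α) (p : ℕ) (w : Fin (p + 1) → α) (e : Fin p → Set α) : Prop
    extends IsWalk H p w e where
  vertex_injective : Function.Injective w
  edge_injective : Function.Injective e

/-- A cycle is a walk with at least two edges, all of whose vertices and edges are distinct, except
that the first and the last vertex agree. -/
structure IsCycle (H : Hypergraph α) (p : ℕ) (w : Fin (p + 1) → α) (e : Fin p → Set α) : Prop
    extends IsWalk H p w e where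
  two_le : 2 ≤ p
  closed : w 0 = w (Fin.last p)
  vertex_injective : Function.Injective fun i : Fin p => w i.castSucc
  edge_injective : Function.Injective e

/-- `H` contains a path of length `p` from `x` to `y`. -/
def HasPath (H : Hypergraph α) (x y : α) (p : ℕ) : Prop :=
  ∃ (w : Fin (p + 1) → α) (e : Fin p → Set α),
    H.IsPath p w e ∧ w 0 = x ∧ w (Fin.last p) = y

/-- Any two vertices are joined by a path. -/
def IsConnected (H : Hypergraph α) : Prop :=
  ∀ x ∈ V(H), ∀ y ∈ V(H), ∃ p, H.HasPath x y p

/-- A hypertree is a connected hypergraph with at least one vertex and with no cycles. -/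
structure IsHypertree (H : Hypergraph α) : Prop where
  nonempty : V(H).Nonempty
  connected : H.IsConnected
  acyclic : ∀ p w e, ¬ H.IsCycle p w e

/-- The distance between two vertices: the length of a shortest path. -/
noncomputable def pathDist (H : Hypergraph α) (x y : α) : ℕ :=
  sInf {p | H.HasPath x y p}

/-- The distance matrix, with rows and columns indexed by the vertices. -/
noncomputable def distanceMatrix (H : Hypergraph α) : Matrix V(H) V(H) ℝ :=
  Matrix.of fun x y => (H.pathDist x y : ℝ)

open Classical in
/-- The distance spectral radius: the largest eigenvalue of the distance matrix. -/
noncomputable def distanceSpectralRadius (H : Hypergraph α) [Finite V(H)] : ℝ :=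
  letI : Fintype V(H) := Fintype.ofFinite V(H)
  sSup {μ : ℝ | Module.End.HasEigenvalue (Matrix.toLin' H.distanceMatrix) μ}

/-- The class `𝕋_k(m, Δ, n)`: the `k`-uniform hypertrees with `m` edges, with maximum degree `Δ`,
and with exactly `n` vertices of degree `Δ`. -/
structure IsInHypertreeClass (H : Hypergraph α) (k m Δ n : ℕ) : Prop where
  isHypertree : H.IsHypertree
  isUniform : H.IsUniform k
  size : E(H).ncard = m
  maxDegree : IsGreatest (H.degree '' V(H)) Δ
  count : {x ∈ V(H) | H.degree x = Δ}.ncard = n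

/-- A hypergraph with a distinguished vertex. -/
structure Rooted (β : Type v) where
  graph : Hypergraph β
  root : β
  root_mem : root ∈ V(graph)

/-- The rooted product of `H` with the family `G`: a copy of `G x` is attached to every vertex `x`
of `H` by identifying its root with `x`; the vertex `x` of `H` becomes `(x, (G x).root)`. Attaching
nothing at `x` is the same as attaching a one-vertex graph. -/
def rootedProduct (H : Hypergraph α) (G : α → Rooted β) : Hypergraph (α × β) where
  vertexSet := {z | z.1 ∈ V(H) ∧ z.2 ∈ V((G z.1).graph)}
  edgeSet := {s | ∃ e ∈ E(H), s = (fun x => (x, (G x).root)) '' e} ∪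
    {s | ∃ x ∈ V(H), ∃ f ∈ E((G x).graph), s = Prod.mk x '' f}
  subset_vertexSet_of_mem_edgeSet' := by
    rintro s (⟨e, he, rfl⟩ | ⟨x, hx, f, hf, rfl⟩)
    · rintro _ ⟨x, hx, rfl⟩
      exact ⟨mem_vertexSet_of_mem_edgeSet he hx, (G x).root_mem⟩
    · rintro _ ⟨y, hy, rfl⟩
      exact ⟨hx, mem_vertexSet_of_mem_edgeSet hf hy⟩

/-- The `k`-uniform loose path with `ℓ` edges. Its vertices are `0, 1, …, ℓ(k-1)`, and its edges are
the intervals `[i(k-1), (i+1)(k-1)]` with `i < ℓ`. -/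
def loosePath (k ℓ : ℕ) : Hypergraph ℕ where
  vertexSet := Set.Iic (ℓ * (k - 1))
  edgeSet := {s | ∃ i < ℓ, s = Set.Icc (i * (k - 1)) ((i + 1) * (k - 1))}
  subset_vertexSet_of_mem_edgeSet' := by
    rintro s ⟨i, hi, rfl⟩ x hx
    exact hx.2.trans (Nat.mul_le_mul_right _ hi)

/-- The path vertex `u_i` of the `k`-uniform loose path `(u_0, e_1, u_1, …, e_ℓ, u_ℓ)`, where
`e_i` is the interval from `u_{i-1}` to `u_i`. -/
def loosePathVertex (k i : ℕ) : ℕ := i * (k - 1)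

/-- The `k`-uniform hyperstar with `c` edges, rooted at its center `none`. Its edges are
`{none, (j, 0), …, (j, k-2)}` with `j < c`. For `c = 0` it is the one-vertex graph. -/
def hyperstar (k c : ℕ) : Rooted (Option (ℕ × ℕ)) where
  graph :=
    { vertexSet := {none} ∪ some '' (Set.Iio c ×ˢ Set.Iio (k - 1))
      edgeSet := {s | ∃ j < c, s = {none} ∪ some '' ({j} ×ˢ Set.Iio (k - 1))}
      subset_vertexSet_of_mem_edgeSet' := by
        rintro s ⟨j, hj, rfl⟩
        refine Set.union_subset_union_right _ (Set.image_mono (Set.prod_mono ?_ le_rfl))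
        simpa using hj }
  root := none
  root_mem := Or.inl rfl

/-- The `k`-uniform caterpillar obtained from the loose path with `ℓ` edges by attaching, at each
of its vertices `x`, a hyperstar with `c x` edges by its center. -/
def starredPath (k ℓ : ℕ) (c : ℕ → ℕ) : Hypergraph (ℕ × Option (ℕ × ℕ)) :=
  (loosePath k ℓ).rootedProduct fun x => hyperstar k (c x)

/-- A `k`-uniform hypergraph is a caterpillar if it arises from a loose path with at least one edge
by attaching hyperstars, by their centers, to arbitrary vertices of the path. -/
def IsCaterpillar (H : Hypergraph α) (k : ℕ) : Prop :=
  ∃ ℓ ≥ 1, ∃ c : ℕ → ℕ, H.IsIsomorphic (starredPath k ℓ c)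

open Classical in
/-- The caterpillar `C_k(m, Δ, a, b)`: the loose path with `m` edges, with a hyperstar with `Δ - 2`
edges attached by its center at `u_1, …, u_a` and at `u_{m-b}, …, u_{m-1}`. -/
noncomputable def extremalCaterpillar (k m Δ a b : ℕ) : Hypergraph (ℕ × Option (ℕ × ℕ)) :=
  starredPath k m fun x =>
    if ∃ i, 0 < i ∧ i < m ∧ (i ≤ a ∨ m ≤ i + b) ∧ x = loosePathVertex k i then Δ - 2 else 0

instance finite_vertexSet_starredPath (k ℓ : ℕ) (c : ℕ → ℕ) : Finite V(starredPath k ℓ c) := by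
  have hfin : ∀ x, (V((hyperstar k (c x)).graph)).Finite := fun x =>
    (Set.finite_singleton _).union
      (((Set.finite_Iio _).prod (Set.finite_Iio _)).image _)
  refine Set.Finite.subset ((Set.finite_Iic (ℓ * (k - 1))).biUnion
    fun x _ => (hfin x).image (Prod.mk x)) ?_
  rintro ⟨x, y⟩ ⟨hx, hy⟩
  exact Set.mem_biUnion hx ⟨y, hy, rfl⟩

instance finite_vertexSet_extremalCaterpillar (k m Δ a b : ℕ) :
    Finite V(extremalCaterpillar k m Δ a b) :=
  finite_vertexSet_starredPath _ _ _

end Hypergraph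

/-!
Write `K = k - 1`, so that the loose path has the vertices `0, …, ℓK` and the edges
`[tK, (t+1)K]`. A caterpillar is given by the length `ℓ` of the path and the number `c x` of pendant
edges at each path vertex `x`; it belongs to the class if and only if the pair `(ℓ, c)` satisfies
some conditions on its degrees (`hasDegreeData_starredPath_iff`). Only finitely many values of the
spectral radius occur, so a maximum exists. Whenever `(ℓ, c)` does not have the extremal shape, a
local modification is found that stays in the class and increases the spectral radius strictly.

Let `φ`, `s` be the values of the Perron vector on the path vertices and on the leaves attached to
them (`IsPerron`), let `mass` be the total weight sitting over a path vertex, and let `potential` be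
the sum of the distances along the path weighted by `mass`. The modified caterpillar is compared by
the Rayleigh quotient (`energy_le`) of a test vector made from the Perron vector. There are three
kinds of modification.

* `distanceSpectralRadius_lt_transfer`: move pendant edges of total weight `P` from `p` to `q`. This
  increases the radius if the potential difference is at least `P d(p, q)`.
* `distanceSpectralRadius_lt_insertEdge`: a pendant edge at a vertex `x` in the interior of an inner
  edge of the path is made an edge of the path, one of its leaves taking over the place of `x`.
* `distanceSpectralRadius_lt_transfer_reflect`: if an initial segment of the path is symmetric except
  for a star at `p`, whose mirror image `q` carries none and lies nearer to the free end, then move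
  the star from `p` to `q`. The test vector is the Perron vector reflected on the segment, corrected
  by a multiple of an antisymmetric vector `ζ` which solves a linear equation and so cancels the
  terms caused by the reflection; what remains is a positive multiple of `ζ q`. The solvability of
  the equation and the sign of `ζ q` come from the distance form being negative semidefinite on
  vectors of total zero (`distForm_nonpos`) and from a discrete maximum principle (`propagate`).

Now take a maximal caterpillar, presented with the longest possible path. There are no pendant edges
at the vertices of degree one of the end edges of the path, because they could serve to prolong the
path, and none in the interior of the other edges, by the second modification. The potential is
convex along `0, K, 2K, …` (`slope_add_le`). Therefore a star that is neither empty nor full could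
send an edge to one of the ends (`IsMaximal.eq_zero_or_eq`), and among full stars with a gap on
either side, one could move into the adjacent gap (`IsMaximal.not_gap_gap`). Hence the full stars
fill the first `a` and the last `b` inner vertices `tK`, and the third modification shows
`|a - b| ≤ 1` unless there is no gap at all (`IsMaximal.le_add_one`). Since `a + b = n`, this is the
extremal caterpillar up to a reflection.
-/

/-! ### The largest eigenvalue of a real symmetric matrix -/

namespace Matrix

variable {ι : Type*} [Fintype ι] [DecidableEq ι] {A : Matrix ι ι ℝ}

/-- The largest real eigenvalue of a real square matrix. -/
noncomputable def maxEigenvalue (A : Matrix ι ι ℝ) : ℝ :=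
  sSup {μ : ℝ | Module.End.HasEigenvalue (Matrix.toLin' A) μ}

theorem hasEigenvalue_toLin'_iff (μ : ℝ) :
    Module.End.HasEigenvalue (Matrix.toLin' A) μ ↔ ∃ v : ι → ℝ, v ≠ 0 ∧ A *ᵥ v = μ • v := by
  constructor
  · intro h
    obtain ⟨v, hv⟩ := h.exists_hasEigenvector
    exact ⟨v, hv.2, by simpa using hv.apply_eq_smul⟩
  · rintro ⟨v, hv, h⟩
    exact Module.End.hasEigenvalue_of_hasEigenvector
      (x := v) ⟨Module.End.mem_eigenspace_iff.2 (by simpa using h), hv⟩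

theorem IsHermitian.hasEigenvalue_maxEigenvalue [Nonempty ι] (hA : A.IsHermitian) :
    Module.End.HasEigenvalue (Matrix.toLin' A) A.maxEigenvalue := by
  have hfin := Module.End.finite_hasEigenvalue (Matrix.toLin' A)
  have hne : {μ : ℝ | Module.End.HasEigenvalue (Matrix.toLin' A) μ}.Nonempty := by
    obtain ⟨i⟩ := ‹Nonempty ι›
    refine ⟨hA.eigenvalues i, (hasEigenvalue_toLin'_iff _).2 ⟨_, ?_, hA.mulVec_eigenvectorBasis i⟩⟩
    intro h
    exact hA.eigenvectorBasis.orthonormal.ne_zero i (by ext j; exact congrFun h j)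
  exact hne.csSup_mem hfin

theorem IsHermitian.posSemidef_maxEigenvalue_sub (hA : A.IsHermitian) :
    (A.maxEigenvalue • (1 : Matrix ι ι ℝ) - A).PosSemidef := by
  have hB : (A.maxEigenvalue • (1 : Matrix ι ι ℝ) - A).IsHermitian := by
    refine IsHermitian.sub ?_ hA
    ext i j
    simp [Matrix.conjTranspose_apply, Matrix.one_apply, eq_comm]
  rw [hB.posSemidef_iff_eigenvalues_nonneg]
  intro i
  have h := hB.mulVec_eigenvectorBasis i
  set v : ι → ℝ := (hB.eigenvectorBasis i).ofLp with hv
  have hv0 : v ≠ 0 := by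
    intro h
    exact hB.eigenvectorBasis.orthonormal.ne_zero i (by ext j; exact congrFun h j)
  have hev : Module.End.HasEigenvalue (Matrix.toLin' A) (A.maxEigenvalue - hB.eigenvalues i) := by
    refine (hasEigenvalue_toLin'_iff _).2 ⟨v, hv0, ?_⟩
    rw [Matrix.sub_mulVec, Matrix.smul_mulVec, Matrix.one_mulVec] at h
    rw [sub_smul, ← h]
    simp
  have := le_csSup (Module.End.finite_hasEigenvalue (Matrix.toLin' A)).bddAbove hev
  simp only [Pi.zero_apply]
  change _ ≤ A.maxEigenvalue at this
  linarith

theorem dotProduct_maxEigenvalue_sub_mulVec (x : ι → ℝ) :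
    x ⬝ᵥ ((A.maxEigenvalue • (1 : Matrix ι ι ℝ) - A) *ᵥ x) =
      A.maxEigenvalue * (x ⬝ᵥ x) - x ⬝ᵥ (A *ᵥ x) := by
  rw [Matrix.sub_mulVec, Matrix.smul_mulVec, Matrix.one_mulVec, dotProduct_sub, dotProduct_smul,
    smul_eq_mul]

theorem IsHermitian.dotProduct_mulVec_le (hA : A.IsHermitian) (x : ι → ℝ) :
    x ⬝ᵥ (A *ᵥ x) ≤ A.maxEigenvalue * (x ⬝ᵥ x) := by
  have h := hA.posSemidef_maxEigenvalue_sub.dotProduct_mulVec_nonneg x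
  rw [star_trivial, dotProduct_maxEigenvalue_sub_mulVec] at h
  linarith

theorem IsHermitian.mulVec_eq_of_dotProduct_mulVec_eq (hA : A.IsHermitian) {x : ι → ℝ}
    (h : x ⬝ᵥ (A *ᵥ x) = A.maxEigenvalue * (x ⬝ᵥ x)) : A *ᵥ x = A.maxEigenvalue • x := by
  have h0 := (hA.posSemidef_maxEigenvalue_sub.dotProduct_mulVec_zero_iff x).1 (by
    rw [star_trivial, dotProduct_maxEigenvalue_sub_mulVec]
    linarith)
  rw [Matrix.sub_mulVec, Matrix.smul_mulVec, Matrix.one_mulVec] at h0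
  exact (sub_eq_zero.1 h0).symm

/-- The Perron vector: the entrywise absolute value of a top eigenvector has at least the same
Rayleigh quotient, so it is again a top eigenvector, and it has no zero entry because all
off-diagonal entries of the matrix are positive. -/
theorem IsHermitian.exists_pos_eigenvector [Nontrivial ι] (hA : A.IsHermitian)
    (h0 : ∀ i j, 0 ≤ A i j) (hpos : ∀ i j, i ≠ j → 0 < A i j) :
    0 < A.maxEigenvalue ∧ ∃ v : ι → ℝ, (∀ i, 0 < v i) ∧ A *ᵥ v = A.maxEigenvalue • v := by
  obtain ⟨v, hv0, hv⟩ := (hasEigenvalue_toLin'_iff _).1 hA.hasEigenvalue_maxEigenvalue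
  set w : ι → ℝ := fun i => |v i| with hw
  have hnorm : w ⬝ᵥ w = v ⬝ᵥ v := by simp [dotProduct, hw]
  have hle : v ⬝ᵥ (A *ᵥ v) ≤ w ⬝ᵥ (A *ᵥ w) := by
    simp only [dotProduct, mulVec, Finset.mul_sum]
    refine Finset.sum_le_sum fun i _ => Finset.sum_le_sum fun j _ => ?_
    calc v i * (A i j * v j) ≤ |v i * (A i j * v j)| := le_abs_self _
      _ = w i * (A i j * w j) := by rw [abs_mul, abs_mul, abs_of_nonneg (h0 i j)]
  have hww : A *ᵥ w = A.maxEigenvalue • w := by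
    apply hA.mulVec_eq_of_dotProduct_mulVec_eq
    refine le_antisymm (hA.dotProduct_mulVec_le w) ?_
    rw [hnorm]
    refine le_trans (le_of_eq ?_) hle
    rw [hv, dotProduct_smul, smul_eq_mul]
  have hw0 : ∀ i, 0 ≤ w i := fun i => abs_nonneg _
  obtain ⟨j, hj⟩ := Function.ne_iff.1 hv0
  have hwj : 0 < w j := abs_pos.2 hj
  have key : ∀ i j, i ≠ j → 0 < w j → 0 < A.maxEigenvalue * w i := by
    intro i j hij hj
    have h := congrFun hww i
    simp only [mulVec, dotProduct, Pi.smul_apply, smul_eq_mul] at h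
    rw [← h]
    exact Finset.sum_pos' (fun l _ => mul_nonneg (h0 i l) (hw0 l))
      ⟨j, Finset.mem_univ _, mul_pos (hpos i j hij) hj⟩
  obtain ⟨i, hi⟩ := exists_ne j
  have hρ : 0 < A.maxEigenvalue := pos_of_mul_pos_left (key i j hi hwj) (hw0 i)
  refine ⟨hρ, w, fun l => ?_, hww⟩
  by_cases hl : l = j
  · rwa [hl]
  · exact pos_of_mul_pos_right (key l j hl hwj) hρ.le

theorem maxEigenvalue_submatrix_equiv {κ : Type*} [Fintype κ] [DecidableEq κ] (e : κ ≃ ι)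
    (A : Matrix ι ι ℝ) : (A.submatrix e e).maxEigenvalue = A.maxEigenvalue := by
  unfold maxEigenvalue
  congr 1
  ext μ
  simp only [Set.mem_ofPred_eq, hasEigenvalue_toLin'_iff]
  constructor
  · rintro ⟨v, hv, h⟩
    refine ⟨v ∘ e.symm, ?_, ?_⟩
    · intro h0
      apply hv
      ext i
      simpa using congrFun h0 (e i)
    · have := Matrix.submatrix_mulVec_equiv A v e e
      rw [this] at h
      ext i
      simpa using congrFun h (e.symm i)
  · rintro ⟨v, hv, h⟩
    refine ⟨v ∘ e, ?_, ?_⟩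
    · intro h0
      apply hv
      ext i
      simpa using congrFun h0 (e.symm i)
    · rw [Matrix.submatrix_mulVec_equiv]
      ext i
      simpa [Function.comp_def] using congrFun h (e i)

end Matrix

/-! ### Isomorphism invariance -/

namespace Hypergraph

universe u v w

variable {α : Type u} {β : Type v} {γ : Type w} {H : Hypergraph α} {K : Hypergraph β}

theorem distanceSpectralRadius_eq_maxEigenvalue [Fintype V(H)] [DecidableEq V(H)] :
    H.distanceSpectralRadius = H.distanceMatrix.maxEigenvalue := by
  unfold distanceSpectralRadius Matrix.maxEigenvalue
  congr!

theorem IsIsomorphic.trans {L : Hypergraph γ} (h : H.IsIsomorphic K) (h' : K.IsIsomorphic L) :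
    H.IsIsomorphic L := by
  obtain ⟨f, hf, rfl⟩ := h
  obtain ⟨g, hg, rfl⟩ := h'
  exact ⟨g ∘ f, hg.comp hf (Set.mapsTo_image f _), (image_image H).symm⟩

theorem HasPath.map {f : α → β} (hf : Set.InjOn f V(H)) {x y : α} {p : ℕ} (h : H.HasPath x y p) :
    (H.image f).HasPath (f x) (f y) p := by
  obtain ⟨w, e, hp, rfl, rfl⟩ := h
  refine ⟨fun i => f (w i), fun i => f '' e i, ?_, rfl, rfl⟩
  exact
    { vertex_mem := fun i => ⟨_, hp.vertex_mem i, rfl⟩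
      edge_mem := fun i => ⟨_, hp.edge_mem i, rfl⟩
      left_mem := fun i => ⟨_, hp.left_mem i, rfl⟩
      right_mem := fun i => ⟨_, hp.right_mem i, rfl⟩
      ne := fun i h => hp.ne i (hf (hp.vertex_mem _) (hp.vertex_mem _) h)
      vertex_injective := fun i j h =>
        hp.vertex_injective (hf (hp.vertex_mem _) (hp.vertex_mem _) h)
      edge_injective := fun i j h => hp.edge_injective
        ((hf.image_eq_image_iff (hp.edge_mem i).subset_vertexSet
          (hp.edge_mem j).subset_vertexSet).1 h) }

theorem hasPath_image_iff {f : α → β} (hf : Set.InjOn f V(H)) {x y : α} (hx : x ∈ V(H))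
    (hy : y ∈ V(H)) {p : ℕ} : (H.image f).HasPath (f x) (f y) p ↔ H.HasPath x y p := by
  refine ⟨?_, HasPath.map hf⟩
  rintro ⟨w, e, hp, h0, hl⟩
  choose w' hw' hww using fun i => hp.vertex_mem i
  choose e' he' hee using fun i => hp.edge_mem i
  have hmem : ∀ i j, w i ∈ e j → w' i ∈ e' j := by
    intro i j h
    rw [← hee j] at h
    obtain ⟨z, hz, hzi⟩ := h
    rw [← hww i] at hzi
    rwa [← hf ((he' j).subset_vertexSet hz) (hw' i) hzi]
  refine ⟨w', e', ?_, hf (hw' _) hx (by rw [hww, h0]), hf (hw' _) hy (by rw [hww, hl])⟩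
  exact
    { vertex_mem := hw'
      edge_mem := he'
      left_mem := fun i => hmem _ _ (hp.left_mem i)
      right_mem := fun i => hmem _ _ (hp.right_mem i)
      ne := fun i h => hp.ne i (by rw [← hww, ← hww, h])
      vertex_injective := fun i j h => hp.vertex_injective (by rw [← hww, ← hww, h])
      edge_injective := fun i j h => hp.edge_injective (by rw [← hee, ← hee, h]) }

theorem pathDist_image {f : α → β} (hf : Set.InjOn f V(H)) {x y : α} (hx : x ∈ V(H))
    (hy : y ∈ V(H)) : (H.image f).pathDist (f x) (f y) = H.pathDist x y := by
  simp only [pathDist, hasPath_image_iff hf hx hy]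

theorem IsIsomorphic.distanceSpectralRadius_eq [Finite V(H)] [Finite V(K)]
    (h : H.IsIsomorphic K) : H.distanceSpectralRadius = K.distanceSpectralRadius := by
  classical
  obtain ⟨f, hf, rfl⟩ := h
  let _ : Fintype V(H) := Fintype.ofFinite _
  let _ : Fintype V(H.image f) := Fintype.ofFinite _
  rw [distanceSpectralRadius_eq_maxEigenvalue, distanceSpectralRadius_eq_maxEigenvalue]
  let e : V(H) ≃ V(H.image f) := Equiv.Set.imageOfInjOn f V(H) hf
  rw [← Matrix.maxEigenvalue_submatrix_equiv e]
  congr 1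
  ext x y
  simp only [distanceMatrix, Matrix.submatrix_apply, Matrix.of_apply]
  rw [← pathDist_image hf x.2 y.2]
  rfl

theorem degree_image {f : α → β} (hf : Set.InjOn f V(H)) {x : α} (hx : x ∈ V(H)) :
    (H.image f).degree (f x) = H.degree x := by
  unfold degree
  rw [← Set.InjOn.ncard_image (s := {e ∈ E(H) | x ∈ e}) (f := Set.image f)]
  · congr 1
    ext s
    constructor
    · rintro ⟨⟨e, he, rfl⟩, z, hz, hzx⟩
      exact ⟨e, ⟨he, by rwa [← hf (he.subset_vertexSet hz) hx hzx]⟩, rfl⟩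
    · rintro ⟨e, ⟨he, hxe⟩, rfl⟩
      exact ⟨⟨e, he, rfl⟩, x, hxe, rfl⟩
  · intro e he e' he' h
    exact (hf.image_eq_image_iff he.1.subset_vertexSet he'.1.subset_vertexSet).1 h

/-- The numerical data of the class `𝕋_k(m, Δ, n)`: `m` edges, all degrees at most `Δ`, and exactly
`n` vertices of degree `Δ`. -/
structure HasDegreeData (H : Hypergraph α) (m Δ n : ℕ) : Prop where
  size : E(H).ncard = m
  degree_le : ∀ x ∈ V(H), H.degree x ≤ Δ
  count : {x ∈ V(H) | H.degree x = Δ}.ncard = n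

theorem HasDegreeData.of_isIsomorphic {m Δ n : ℕ} (hH : H.HasDegreeData m Δ n)
    (h : H.IsIsomorphic K) : K.HasDegreeData m Δ n := by
  obtain ⟨f, hf, rfl⟩ := h
  refine ⟨?_, ?_, ?_⟩
  · rw [← hH.size]
    refine Set.InjOn.ncard_image fun e he e' he' h => ?_
    exact (hf.image_eq_image_iff he.subset_vertexSet he'.subset_vertexSet).1 h
  · rintro _ ⟨x, hx, rfl⟩
    rw [degree_image hf hx]
    exact hH.degree_le x hx
  · rw [← hH.count, ← Set.InjOn.ncard_image
      (hf.mono (s₁ := {x ∈ V(H) | H.degree x = Δ}) fun x hx => hx.1)]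
    congr 1
    ext y
    constructor
    · rintro ⟨⟨x, hx, rfl⟩, hd⟩
      exact ⟨x, ⟨hx, by rwa [degree_image hf hx] at hd⟩, rfl⟩
    · rintro ⟨x, ⟨hx, hd⟩, rfl⟩
      exact ⟨⟨x, hx, rfl⟩, by rwa [degree_image hf hx]⟩

end Hypergraph

/-! ### Distances in a caterpillar -/

namespace Hypergraph

universe u

/-- A criterion for computing the distance: `d` equals the distance function if it separates
points, changes by at most one along an edge, and can always be lowered along some edge. -/
theorem pathDist_eq_of_step {α : Type u} {H : Hypergraph α} (d : α → α → ℕ)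
    (hself : ∀ x, d x x = 0)
    (hstep : ∀ e ∈ E(H), ∀ x ∈ e, ∀ y ∈ e, ∀ z, d x z ≤ d y z + 1)
    (hprog : ∀ x ∈ V(H), ∀ y ∈ V(H), x ≠ y → ∃ e ∈ E(H), ∃ z ∈ e, x ∈ e ∧ d z y + 1 = d x y)
    {x y : α} (hx : x ∈ V(H)) (hy : y ∈ V(H)) : H.pathDist x y = d x y := by
  have lower : ∀ p, H.HasPath x y p → d x y ≤ p := by
    rintro p ⟨w, e, hp, rfl, rfl⟩
    have : ∀ i : Fin (p + 1), d (w 0) (w (Fin.last p)) ≤ d (w i) (w (Fin.last p)) + i := by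
      intro i
      induction i using Fin.induction with
      | zero => simp
      | succ i ih =>
        have := hstep _ (hp.edge_mem i) _ (hp.left_mem i) _ (hp.right_mem i) (w (Fin.last p))
        simp only [Fin.val_succ, Fin.val_castSucc] at ih ⊢
        omega
    simpa [hself] using this (Fin.last p)
  have build : ∀ p, ∀ x ∈ V(H), d x y = p → ∃ (w : ℕ → α) (e : ℕ → Set α), w 0 = x ∧ w p = y ∧
      (∀ i < p, e i ∈ E(H) ∧ w i ∈ e i ∧ w (i + 1) ∈ e i) ∧ ∀ i ≤ p, d (w i) y + i = p := by
    intro p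
    induction p with
    | zero =>
      intro x hx h
      have hxy : x = y := by
        by_contra hne
        obtain ⟨e, -, z, -, -, hz⟩ := hprog x hx y hy hne
        omega
      exact ⟨fun _ => x, fun _ => ∅, rfl, hxy, fun i hi => absurd hi (by omega), by
        intro i hi
        simp [h]
        omega⟩
    | succ p ih =>
      intro x hx h
      have hne : x ≠ y := by
        rintro rfl
        simp [hself] at h
      obtain ⟨e, he, z, hze, hxe, hz⟩ := hprog x hx y hy hne
      obtain ⟨w, e', h0, hp, h1, h2⟩ := ih z (he.subset_vertexSet hze) (by omega)
      refine ⟨fun i => if i = 0 then x else w (i - 1), fun i => if i = 0 then e else e' (i - 1),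
        by simp, by simpa using hp, ?_, ?_⟩
      · intro i hi
        rcases i with _ | i
        · simpa [h0] using ⟨he, hxe, hze⟩
        · simpa using h1 i (by omega)
      · intro i hi
        rcases i with _ | i
        · simpa using h
        · have := h2 i (by omega)
          simp
          omega
  have upper : H.HasPath x y (d x y) := by
    obtain ⟨w, e, h0, hp, h1, h2⟩ := build _ x hx rfl
    refine ⟨fun i => w i, fun i => e i, ?_, h0, hp⟩
    have hinj : ∀ i ≤ d x y, ∀ j ≤ d x y, w i = w j → i = j := by
      intro i hi j hj h
      have h3 := h2 i hi
      have h4 := h2 j hj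
      rw [h] at h3
      omega
    have hedge : ∀ i j, i < j → j < d x y → e i ≠ e j := by
      intro i j hij hj h
      have h3 := (h1 i (by omega)).2.1
      rw [h] at h3
      have h4 := hstep _ (h1 j hj).1 _ h3 _ (h1 j hj).2.2 y
      have h5 := h2 i (by omega)
      have h6 := h2 (j + 1) (by omega)
      omega
    exact
      { vertex_mem := fun i => by
          rcases Nat.lt_or_ge i.1 (d x y) with hi | hi
          · exact (h1 i hi).1.subset_vertexSet (h1 i hi).2.1
          · have : i.1 = d x y := by omega
            rw [this, hp]
            exact hy
        edge_mem := fun i => (h1 i i.2).1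
        left_mem := fun i => (h1 i i.2).2.1
        right_mem := fun i => (h1 i i.2).2.2
        ne := fun i h => by
          have := hinj i (by omega) (i + 1) (by omega) h
          omega
        vertex_injective := fun i j h => Fin.ext (hinj i (by omega) j (by omega) h)
        edge_injective := fun i j h => by
          rcases lt_trichotomy i.1 j.1 with hij | hij | hij
          · exact absurd h (hedge i j hij j.2)
          · exact Fin.ext hij
          · exact absurd h.symm (hedge j i hij i.2) }
  exact le_antisymm (Nat.sInf_le upper) (lower _ (Nat.sInf_mem (s := {p | H.HasPath x y p}) ⟨_, upper⟩))

/-- The vertex of the path edge `[tK, (t+1)K]` that is nearest to `x`. -/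
def edgeProj (K t x : ℕ) : ℕ := max (t * K) (min x ((t + 1) * K))

/-- The distance of two vertices of the loose path with edges `[tK, (t+1)K]`: the number of edges
that separate them. Edges beyond both vertices do not matter, so the path can be taken to have
`x + y` edges. -/
def baseDist (K x y : ℕ) : ℕ :=
  ∑ t ∈ Finset.range (x + y), if edgeProj K t x = edgeProj K t y then 0 else 1

section

variable {K t x y z L : ℕ}

theorem edgeProj_of_le (h : x ≤ t * K) : edgeProj K t x = t * K := by
  unfold edgeProj
  omega

theorem edgeProj_of_ge (h : (t + 1) * K ≤ x) : edgeProj K t x = (t + 1) * K := by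
  have : t * K ≤ (t + 1) * K := Nat.mul_le_mul_right _ (by omega)
  unfold edgeProj
  omega

theorem edgeProj_of_mem (h : t * K ≤ x) (h' : x ≤ (t + 1) * K) : edgeProj K t x = x := by
  unfold edgeProj
  omega

theorem le_edgeProj : t * K ≤ edgeProj K t x := le_max_left _ _

theorem edgeProj_le : edgeProj K t x ≤ (t + 1) * K :=
  max_le (Nat.mul_le_mul_right _ (by omega)) (min_le_right _ _)

theorem edgeProj_congr {s : ℕ} (hx : t * K ≤ x) (hx' : x ≤ (t + 1) * K) (hy : t * K ≤ y)
    (hy' : y ≤ (t + 1) * K) (hst : s ≠ t) : edgeProj K s x = edgeProj K s y := by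
  rcases Nat.lt_or_gt_of_ne hst with h | h
  · have : (s + 1) * K ≤ t * K := Nat.mul_le_mul_right _ h
    rw [edgeProj_of_ge (by omega), edgeProj_of_ge (by omega)]
  · have : (t + 1) * K ≤ s * K := Nat.mul_le_mul_right _ h
    rw [edgeProj_of_le (by omega), edgeProj_of_le (by omega)]

theorem baseDist_eq_sum (hK : 1 ≤ K) (hx : x ≤ L * K) (hy : y ≤ L * K) :
    baseDist K x y = ∑ t ∈ Finset.range L, if edgeProj K t x = edgeProj K t y then 0 else 1 := by
  have key : ∀ M, x ≤ M * K → y ≤ M * K →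
      ∑ t ∈ Finset.range M, (if edgeProj K t x = edgeProj K t y then 0 else 1) =
      ∑ t ∈ Finset.range (max L (x + y)),
        (if edgeProj K t x = edgeProj K t y then 0 else 1) ∨ max L (x + y) < M := by
    intro M h1 h2
    rcases Nat.lt_or_ge (max L (x + y)) M with h | h
    · exact Or.inr h
    · refine Or.inl (Finset.sum_subset (Finset.range_mono h) fun t _ ht => ?_)
      have : M * K ≤ t * K := Nat.mul_le_mul_right _ (by simpa using ht)
      rw [edgeProj_of_le (by omega), edgeProj_of_le (by omega), if_pos rfl]
  have h1 := (key (x + y) (by nlinarith) (by nlinarith)).resolve_right (by omega)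
  have h2 := (key L hx hy).resolve_right (by omega)
  rw [baseDist, h1, h2]

theorem baseDist_self : baseDist K x x = 0 := by simp [baseDist]

theorem baseDist_comm : baseDist K x y = baseDist K y x := by
  simp only [baseDist, Nat.add_comm x y, eq_comm]

/-- Moving one of the two vertices inside the edge `t` affects only the contribution of that
edge. -/
theorem baseDist_add_of_mem (hK : 1 ≤ K) (hx : t * K ≤ x) (hx' : x ≤ (t + 1) * K) (hy : t * K ≤ y)
    (hy' : y ≤ (t + 1) * K) :
    baseDist K x z + (if y = edgeProj K t z then 0 else 1) =
      baseDist K y z + (if x = edgeProj K t z then 0 else 1) := by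
  set L := x + y + z + t + 1 with hL
  have hLK : L ≤ L * K := Nat.le_mul_of_pos_right _ hK
  rw [baseDist_eq_sum (L := L) hK (by omega) (by omega),
    baseDist_eq_sum (L := L) hK (by omega) (by omega),
    ← Finset.add_sum_erase _ _ (Finset.mem_range.2 (show t < L by omega)),
    ← Finset.add_sum_erase _ _ (Finset.mem_range.2 (show t < L by omega)),
    edgeProj_of_mem hx hx', edgeProj_of_mem hy hy',
    Finset.sum_congr rfl fun s hs => by
      rw [edgeProj_congr hx hx' hy hy' (Finset.ne_of_mem_erase hs)]]
  omega

theorem baseDist_le_of_mem (hK : 1 ≤ K) (hx : t * K ≤ x) (hx' : x ≤ (t + 1) * K) (hy : t * K ≤ y)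
    (hy' : y ≤ (t + 1) * K) : baseDist K x z ≤ baseDist K y z + 1 := by
  have := baseDist_add_of_mem (z := z) hK hx hx' hy hy'
  split_ifs at this <;> omega

theorem exists_edgeProj_ne (hK : 1 ≤ K) (hxy : x ≠ y) (hx : x ≤ L * K) (hy : y ≤ L * K) :
    ∃ t < L, t * K ≤ x ∧ x ≤ (t + 1) * K ∧ edgeProj K t y ≠ x := by
  have hlt : ∀ a, a < L * K → a / K < L := fun a h => (Nat.div_lt_iff_lt_mul hK).2 h
  rcases Nat.lt_or_gt_of_ne hxy with h | h
  · have h1 := Nat.div_mul_le_self x K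
    have h2 := Nat.lt_div_mul_add (a := x) hK
    refine ⟨x / K, hlt x (by omega), h1, ?_, ?_⟩
    · rw [Nat.add_mul]
      omega
    · unfold edgeProj
      rw [Nat.add_mul]
      omega
  · have h1 := Nat.div_mul_le_self (x - 1) K
    have h2 := Nat.lt_div_mul_add (a := x - 1) hK
    refine ⟨(x - 1) / K, hlt (x - 1) (by omega), by omega, ?_, ?_⟩
    · rw [Nat.add_mul]
      omega
    · unfold edgeProj
      rw [Nat.add_mul]
      omega

theorem exists_baseDist_step (hK : 1 ≤ K) (hxy : x ≠ y) (hx : x ≤ L * K) (hy : y ≤ L * K) :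
    ∃ t < L, t * K ≤ x ∧ x ≤ (t + 1) * K ∧ ∃ z, t * K ≤ z ∧ z ≤ (t + 1) * K ∧
      baseDist K z y + 1 = baseDist K x y := by
  obtain ⟨t, ht, h1, h2, h3⟩ := exists_edgeProj_ne hK hxy hx hy
  refine ⟨t, ht, h1, h2, edgeProj K t y, le_edgeProj, edgeProj_le, ?_⟩
  have := baseDist_add_of_mem (z := y) hK h1 h2 (le_edgeProj (x := y)) edgeProj_le
  rw [if_pos rfl, if_neg h3.symm] at this
  omega

theorem baseDist_pos (hK : 1 ≤ K) (hxy : x ≠ y) : 0 < baseDist K x y := by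
  have hLK : x + y ≤ (x + y) * K := Nat.le_mul_of_pos_right _ hK
  obtain ⟨t, -, -, -, z, -, -, h⟩ :=
    exists_baseDist_step (L := x + y) hK hxy (by omega) (by omega)
  omega

end

/-- The distance of a vertex of a star from the center. -/
def leafHeight : Option (ℕ × ℕ) → ℕ
  | none => 0
  | some _ => 1

/-- The amount by which the sum of the heights exceeds the distance inside a star: two leaves of
the same edge are at distance `1`. -/
def leafOverlap : Option (ℕ × ℕ) → Option (ℕ × ℕ) → ℕ
  | some a, some b => if a.1 = b.1 then (if a.2 = b.2 then 2 else 1) else 0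
  | _, _ => 0

/-- The distance in a caterpillar: the distance along the path plus the heights over the path,
corrected if both vertices are leaves of the same edge. -/
def starDist (K : ℕ) (u v : ℕ × Option (ℕ × ℕ)) : ℕ :=
  baseDist K u.1 v.1 + leafHeight u.2 + leafHeight v.2 -
    if u.1 = v.1 then leafOverlap u.2 v.2 else 0

theorem leafOverlap_le (s s' : Option (ℕ × ℕ)) :
    leafOverlap s s' ≤ leafHeight s + leafHeight s' := by
  rcases s with _ | a <;> rcases s' with _ | b <;> simp only [leafOverlap, leafHeight] <;>
    (try split_ifs) <;> omega

theorem starDist_add (K : ℕ) (u v : ℕ × Option (ℕ × ℕ)) :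
    starDist K u v + (if u.1 = v.1 then leafOverlap u.2 v.2 else 0) =
      baseDist K u.1 v.1 + leafHeight u.2 + leafHeight v.2 := by
  have := leafOverlap_le u.2 v.2
  unfold starDist
  split_ifs <;> omega

variable {k ℓ : ℕ} {c : ℕ → ℕ}

theorem mem_vertexSet_starredPath {u : ℕ × Option (ℕ × ℕ)} :
    u ∈ V(starredPath k ℓ c) ↔ u.1 ≤ ℓ * (k - 1) ∧
      ∀ a, u.2 = some a → a.1 < c u.1 ∧ a.2 < k - 1 := by
  obtain ⟨x, s⟩ := u
  rcases s with _ | ⟨j, i⟩ <;> simp [starredPath, rootedProduct, loosePath, hyperstar]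

/-- The path edge `[tK, (t+1)K]` of a caterpillar. -/
def pathEdge (K t : ℕ) : Set (ℕ × Option (ℕ × ℕ)) :=
  {u | t * K ≤ u.1 ∧ u.1 ≤ (t + 1) * K ∧ u.2 = none}

/-- The pendant edge number `j` at the path vertex `x`. -/
def starEdge (K x j : ℕ) : Set (ℕ × Option (ℕ × ℕ)) :=
  {u | u.1 = x ∧ ∀ a, u.2 = some a → a.1 = j ∧ a.2 < K}

theorem mem_edgeSet_starredPath {s : Set (ℕ × Option (ℕ × ℕ))} :
    s ∈ E(starredPath k ℓ c) ↔ (∃ t < ℓ, s = pathEdge (k - 1) t) ∨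
      ∃ x ≤ ℓ * (k - 1), ∃ j < c x, s = starEdge (k - 1) x j := by
  have h1 : ∀ t, (fun x => (x, (hyperstar k (c x)).root)) ''
      Set.Icc (t * (k - 1)) ((t + 1) * (k - 1)) = pathEdge (k - 1) t := by
    intro t
    ext ⟨x, s⟩
    simp only [hyperstar, pathEdge, Set.mem_image, Set.mem_Icc, Prod.mk.injEq]
    constructor
    · rintro ⟨x, h, rfl, rfl⟩
      exact ⟨h.1, h.2, rfl⟩
    · rintro ⟨h, h', rfl⟩
      exact ⟨x, ⟨h, h'⟩, rfl, rfl⟩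
  have h2 : ∀ x j, Prod.mk x '' ({none} ∪ some '' ({j} ×ˢ Set.Iio (k - 1))) =
      starEdge (k - 1) x j := by
    intro x j
    ext ⟨y, s⟩
    rcases s with _ | ⟨j', i⟩
    · simp [starEdge, eq_comm]
    · simp [starEdge, eq_comm, and_assoc, and_comm]
  constructor
  · rintro (⟨e, ⟨t, ht, rfl⟩, rfl⟩ | ⟨x, hx, f, ⟨j, hj, rfl⟩, rfl⟩)
    · exact Or.inl ⟨t, ht, h1 t⟩
    · exact Or.inr ⟨x, hx, j, hj, h2 x j⟩
  · rintro (⟨t, ht, rfl⟩ | ⟨x, hx, j, hj, rfl⟩)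
    · exact Or.inl ⟨_, ⟨t, ht, rfl⟩, (h1 t).symm⟩
    · exact Or.inr ⟨x, hx, _, ⟨j, hj, rfl⟩, (h2 x j).symm⟩

theorem starDist_self (K : ℕ) (u : ℕ × Option (ℕ × ℕ)) : starDist K u u = 0 := by
  obtain ⟨x, s⟩ := u
  rcases s with _ | a <;> simp [starDist, baseDist_self, leafHeight, leafOverlap]

theorem pathDist_starredPath (hk : 2 ≤ k) {u v : ℕ × Option (ℕ × ℕ)}
    (hu : u ∈ V(starredPath k ℓ c)) (hv : v ∈ V(starredPath k ℓ c)) :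
    (starredPath k ℓ c).pathDist u v = starDist (k - 1) u v := by
  have hK : 1 ≤ k - 1 := by omega
  refine pathDist_eq_of_step _ (starDist_self _) ?_ ?_ hu hv
  · intro e he u hu v hv w
    have h3 := starDist_add (k - 1) u w
    have h4 := starDist_add (k - 1) v w
    rcases mem_edgeSet_starredPath.1 he with ⟨t, ht, rfl⟩ | ⟨x, hx, j, hj, rfl⟩
    · obtain ⟨hu1, hu2, hu3⟩ := hu
      obtain ⟨hv1, hv2, hv3⟩ := hv
      have h5 := baseDist_le_of_mem (z := w.1) hK hu1 hu2 hv1 hv2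
      rw [hu3] at h3
      rw [hv3] at h4
      simp only [leafOverlap, ite_self, leafHeight] at h3 h4
      omega
    · obtain ⟨rfl, hu⟩ := hu
      obtain ⟨hvu, hv⟩ := hv
      rw [hvu] at h4
      obtain ⟨x, s⟩ := u
      obtain ⟨y, s'⟩ := v
      obtain ⟨z, r⟩ := w
      rcases s with _ | ⟨a, b⟩ <;> rcases s' with _ | ⟨a', b'⟩ <;> rcases r with _ | ⟨a'', b''⟩ <;>
        simp only [leafOverlap, leafHeight, Option.some.injEq, forall_eq', ite_self] at * <;>
        (try split_ifs at *) <;> omega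
  · rintro ⟨x, s⟩ hu ⟨y, r⟩ hv hne
    have hu' := mem_vertexSet_starredPath.1 hu
    have hv' := mem_vertexSet_starredPath.1 hv
    have h3 := starDist_add (k - 1) (x, s) (y, r)
    simp only [mem_edgeSet_starredPath] at hu' hv' h3 ⊢
    rcases s with _ | ⟨j, i⟩
    · by_cases hxy : x = y
      · subst hxy
        rcases r with _ | ⟨j, i⟩
        · exact absurd rfl hne
        · obtain ⟨hj, hi⟩ := hv'.2 _ rfl
          refine ⟨_, Or.inr ⟨x, hu'.1, j, hj, rfl⟩, (x, some (j, i)), ⟨rfl, ?_⟩, ⟨rfl, ?_⟩, ?_⟩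
          · simpa using hi
          · simp
          · rw [starDist_self]
            simp only [leafOverlap, ite_self, leafHeight, baseDist_self] at h3
            omega
      · obtain ⟨t, ht, h1, h2, z, hz1, hz2, hz3⟩ := exists_baseDist_step hK hxy hu'.1 hv'.1
        refine ⟨_, Or.inl ⟨t, ht, rfl⟩, (z, none), ⟨hz1, hz2, rfl⟩, ⟨h1, h2, rfl⟩, ?_⟩
        have h4 := starDist_add (k - 1) (z, none) (y, r)
        simp only [leafOverlap, ite_self, leafHeight] at h3 h4
        omega
    · obtain ⟨hj, hi⟩ := hu'.2 _ rfl
      by_cases hsame : x = y ∧ ∃ i', r = some (j, i')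
      · obtain ⟨rfl, i', rfl⟩ := hsame
        refine ⟨_, Or.inr ⟨x, hu'.1, j, hj, rfl⟩, (x, some (j, i')), ⟨rfl, ?_⟩, ⟨rfl, ?_⟩, ?_⟩
        · simpa using (hv'.2 _ rfl).2
        · simpa using hi
        · rw [starDist_self]
          have : i ≠ i' := by
            rintro rfl
            exact hne rfl
          simp only [leafOverlap, if_true, leafHeight, baseDist_self, if_neg this] at h3
          omega
      · refine ⟨_, Or.inr ⟨x, hu'.1, j, hj, rfl⟩, (x, none), ⟨rfl, by simp⟩, ⟨rfl, ?_⟩, ?_⟩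
        · simpa using hi
        · have h4 := starDist_add (k - 1) (x, none) (y, r)
          have h5 : (if x = y then leafOverlap (some (j, i)) r else 0) = 0 := by
            rw [ite_eq_right_iff]
            rintro rfl
            rcases r with _ | ⟨j', i'⟩
            · rfl
            · have : j ≠ j' := by
                rintro rfl
                exact hsame ⟨rfl, i', rfl⟩
              simp [leafOverlap, this]
          rw [h5] at h3
          simp only [leafOverlap, ite_self, leafHeight] at h3 h4
          omega

end Hypergraph

/-! ### Rayleigh quotients of vectors that are constant on the leaves at each path vertex -/

namespace Hypergraph

open Finset

variable {K ℓ : ℕ} {c : ℕ → ℕ}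

/-- The total weight at the path vertex `x` (the vertex itself and all leaves attached to it), if
path vertices carry the weights `φ` and each leaf at `x` carries the weight `s x`. -/
noncomputable def mass (K : ℕ) (c : ℕ → ℕ) (φ s : ℕ → ℝ) (x : ℕ) : ℝ := φ x + c x * K * s x

/-- The weighted sum of the distances along the path from `x`. -/
noncomputable def potential (K ℓ : ℕ) (W : ℕ → ℝ) (x : ℕ) : ℝ :=
  ∑ y ∈ range (ℓ * K + 1), (baseDist K x y : ℝ) * W y

/-- The total weight on the path. -/
noncomputable def total (K ℓ : ℕ) (W : ℕ → ℝ) : ℝ := ∑ x ∈ range (ℓ * K + 1), W x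

/-- The total weight of the leaves. -/
noncomputable def leafTotal (K ℓ : ℕ) (c : ℕ → ℕ) (s : ℕ → ℝ) : ℝ :=
  ∑ x ∈ range (ℓ * K + 1), c x * K * s x

/-- The quadratic form of the distances along the path. -/
noncomputable def distForm (K ℓ : ℕ) (W : ℕ → ℝ) : ℝ :=
  ∑ x ∈ range (ℓ * K + 1), W x * potential K ℓ W x

/-- The quadratic form of the distance matrix of a caterpillar, at the vector with value `φ x` at
the path vertex `x` and value `s x` at the leaves attached to `x`. -/
noncomputable def energy (K ℓ : ℕ) (c : ℕ → ℕ) (φ s : ℕ → ℝ) : ℝ :=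
  distForm K ℓ (mass K c φ s) + 2 * leafTotal K ℓ c s * total K ℓ (mass K c φ s) -
    (K + 1) * K * ∑ x ∈ range (ℓ * K + 1), c x * s x ^ 2

/-- The squared Euclidean norm of the vector with value `φ x` at the path vertex `x` and value `s x`
at the leaves attached to `x`. -/
noncomputable def sqNorm (K ℓ : ℕ) (c : ℕ → ℕ) (φ s : ℕ → ℝ) : ℝ :=
  ∑ x ∈ range (ℓ * K + 1), φ x ^ 2 + K * ∑ x ∈ range (ℓ * K + 1), c x * s x ^ 2

/-- A positive eigenvector of the distance matrix, constant on the leaves at each path vertex, for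
the eigenvalue `ρ`. -/
structure IsPerron (K ℓ : ℕ) (c : ℕ → ℕ) (ρ : ℝ) (φ s : ℕ → ℝ) : Prop where
  rho_pos : 0 < ρ
  path_pos : ∀ x ≤ ℓ * K, 0 < φ x
  leaf_pos : ∀ x ≤ ℓ * K, 0 < s x
  path_eq : ∀ x ≤ ℓ * K, ρ * φ x = potential K ℓ (mass K c φ s) x + leafTotal K ℓ c s
  leaf_eq : ∀ x ≤ ℓ * K, (ρ + K + 1) * s x = ρ * φ x + total K ℓ (mass K c φ s)

theorem sum_vertexSet_starredPath [Fintype V(starredPath (K + 1) ℓ c)]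
    (G : ℕ × Option (ℕ × ℕ) → ℝ) :
    ∑ v : V(starredPath (K + 1) ℓ c), G v = ∑ x ∈ range (ℓ * K + 1),
      (G (x, none) + ∑ j ∈ range (c x), ∑ i ∈ range K, G (x, some (j, i))) := by
  classical
  rw [← Finset.sum_subtype (V(starredPath (K + 1) ℓ c)).toFinset (fun x => Set.mem_toFinset) G,
    Finset.sum_finset_product _ (range (ℓ * K + 1))
      (fun x => insertNone (range (c x) ×ˢ range K))]
  · simp only [sum_insertNone, sum_product]
  · rintro ⟨x, s⟩
    rw [Set.mem_toFinset, mem_vertexSet_starredPath]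
    rcases s with _ | ⟨j, i⟩ <;> simp

theorem starDist_none (x y : ℕ) (s : Option (ℕ × ℕ)) :
    (starDist K (x, none) (y, s) : ℝ) = baseDist K x y + leafHeight s := by
  have h := starDist_add K (x, none) (y, s)
  simp only [leafOverlap, ite_self, leafHeight, add_zero] at h
  exact_mod_cast h

theorem starDist_some (x y : ℕ) (a : ℕ × ℕ) (s : Option (ℕ × ℕ)) :
    (starDist K (x, some a) (y, s) : ℝ) =
      baseDist K x y + 1 + leafHeight s - if x = y then (leafOverlap (some a) s : ℝ) else 0 := by
  have h := starDist_add K (x, some a) (y, s)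
  rw [eq_sub_iff_add_eq]
  simp only [leafHeight] at h
  exact_mod_cast h

theorem sum_starDist_none [Fintype V(starredPath (K + 1) ℓ c)] (G : ℕ × Option (ℕ × ℕ) → ℝ)
    (x : ℕ) :
    ∑ v : V(starredPath (K + 1) ℓ c), (starDist K (x, none) v : ℝ) * G v =
      ∑ y ∈ range (ℓ * K + 1), (baseDist K x y : ℝ) *
        (G (y, none) + ∑ j ∈ range (c y), ∑ i ∈ range K, G (y, some (j, i))) +
      ∑ y ∈ range (ℓ * K + 1), ∑ j ∈ range (c y), ∑ i ∈ range K, G (y, some (j, i)) := by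
  rw [sum_vertexSet_starredPath fun v => (starDist K (x, none) v : ℝ) * G v, ← sum_add_distrib]
  refine sum_congr rfl fun y _ => ?_
  simp only [starDist_none, leafHeight, Nat.cast_zero, Nat.cast_one, add_zero, add_mul, one_mul,
    sum_add_distrib, mul_add, mul_sum, add_assoc]

theorem sum_starDist_some [Fintype V(starredPath (K + 1) ℓ c)] (G : ℕ × Option (ℕ × ℕ) → ℝ)
    {x j i : ℕ} (hx : x ≤ ℓ * K) (hj : j < c x) (hi : i < K) :
    ∑ v : V(starredPath (K + 1) ℓ c), (starDist K (x, some (j, i)) v : ℝ) * G v =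
      ∑ v : V(starredPath (K + 1) ℓ c), (starDist K (x, none) v : ℝ) * G v +
      ∑ v : V(starredPath (K + 1) ℓ c), G v -
      (∑ i' ∈ range K, G (x, some (j, i')) + G (x, some (j, i))) := by
  have h : ∑ v : V(starredPath (K + 1) ℓ c),
      (if x = v.1.1 then (leafOverlap (some (j, i)) v.1.2 : ℝ) else 0) * G v =
      ∑ i' ∈ range K, G (x, some (j, i')) + G (x, some (j, i)) := by
    rw [sum_vertexSet_starredPath fun v =>
      (if x = v.1 then (leafOverlap (some (j, i)) v.2 : ℝ) else 0) * G v]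
    simp only [ite_mul, zero_mul]
    rw [sum_eq_single_of_mem x (by simpa [Nat.lt_succ_iff] using hx)]
    · rw [sum_eq_single_of_mem j (by simpa using hj)]
      · have h1 : ∀ i', ((leafOverlap (some (j, i)) (some (j, i')) : ℕ) : ℝ) =
            1 + if i = i' then 1 else 0 := by
          intro i'
          by_cases h : i = i' <;> simp [leafOverlap, h]
          norm_num
        simp only [if_true, h1, add_mul, one_mul, ite_mul, zero_mul, sum_add_distrib,
          sum_ite_eq, mem_range, hi]
        simp [leafOverlap]
      · intro j' _ hne
        simp [leafOverlap, hne.symm]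
    · intro y _ hne
      simp [hne.symm]
  rw [← h, ← sum_add_distrib, ← sum_sub_distrib]
  refine sum_congr rfl fun v _ => ?_
  rw [show (v : ℕ × Option (ℕ × ℕ)) = (v.1.1, v.1.2) from rfl, starDist_none, starDist_some]
  ring

/-- The vector on the vertices of a caterpillar with value `φ x` at the path vertex `x` and value
`s x` at the leaves attached to `x`. -/
def liftVec (φ s : ℕ → ℝ) : ℕ × Option (ℕ × ℕ) → ℝ
  | (x, none) => φ x
  | (x, some _) => s x

theorem liftVec_leaves (φ s : ℕ → ℝ) (x : ℕ) :
    ∑ j ∈ range (c x), ∑ i ∈ range K, liftVec φ s (x, some (j, i)) = c x * K * s x := by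
  simp [liftVec, mul_assoc]

theorem liftVec_mass (φ s : ℕ → ℝ) (x : ℕ) :
    liftVec φ s (x, none) + ∑ j ∈ range (c x), ∑ i ∈ range K, liftVec φ s (x, some (j, i)) =
      mass K c φ s x := by
  rw [liftVec_leaves]
  rfl

theorem sum_starDist_liftVec_none [Fintype V(starredPath (K + 1) ℓ c)] (φ s : ℕ → ℝ) (x : ℕ) :
    ∑ v : V(starredPath (K + 1) ℓ c), (starDist K (x, none) v : ℝ) * liftVec φ s v =
      potential K ℓ (mass K c φ s) x + leafTotal K ℓ c s := by
  rw [sum_starDist_none]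
  simp only [liftVec_leaves]
  rfl

theorem sum_liftVec [Fintype V(starredPath (K + 1) ℓ c)] (φ s : ℕ → ℝ) :
    ∑ v : V(starredPath (K + 1) ℓ c), liftVec φ s v = total K ℓ (mass K c φ s) := by
  rw [sum_vertexSet_starredPath]
  simp only [liftVec_mass]
  rfl

theorem sum_starDist_liftVec_some [Fintype V(starredPath (K + 1) ℓ c)] (φ s : ℕ → ℝ)
    {x j i : ℕ} (hx : x ≤ ℓ * K) (hj : j < c x) (hi : i < K) :
    ∑ v : V(starredPath (K + 1) ℓ c), (starDist K (x, some (j, i)) v : ℝ) * liftVec φ s v =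
      potential K ℓ (mass K c φ s) x + leafTotal K ℓ c s + total K ℓ (mass K c φ s) -
        (K + 1) * s x := by
  rw [sum_starDist_some _ hx hj hi, sum_starDist_liftVec_none, sum_liftVec]
  simp [liftVec]
  ring

theorem sum_mul_self_liftVec [Fintype V(starredPath (K + 1) ℓ c)] (φ s : ℕ → ℝ) :
    ∑ v : V(starredPath (K + 1) ℓ c), liftVec φ s v * liftVec φ s v = sqNorm K ℓ c φ s := by
  rw [sum_vertexSet_starredPath fun v => liftVec φ s v * liftVec φ s v, sqNorm, mul_sum,
    ← sum_add_distrib]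
  refine sum_congr rfl fun x _ => ?_
  simp [liftVec]
  ring

theorem sum_mul_sum_starDist_liftVec [Fintype V(starredPath (K + 1) ℓ c)] (φ s : ℕ → ℝ) :
    ∑ u : V(starredPath (K + 1) ℓ c), liftVec φ s u *
      ∑ v : V(starredPath (K + 1) ℓ c), (starDist K u v : ℝ) * liftVec φ s v =
        energy K ℓ c φ s := by
  rw [sum_vertexSet_starredPath fun u => liftVec φ s u *
      ∑ v : V(starredPath (K + 1) ℓ c), (starDist K u v : ℝ) * liftVec φ s v]
  have h : ∀ x ∈ range (ℓ * K + 1), (liftVec φ s (x, none) *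
      ∑ v : V(starredPath (K + 1) ℓ c), (starDist K (x, none) v : ℝ) * liftVec φ s v +
      ∑ j ∈ range (c x), ∑ i ∈ range K, liftVec φ s (x, some (j, i)) *
      ∑ v : V(starredPath (K + 1) ℓ c), (starDist K (x, some (j, i)) v : ℝ) * liftVec φ s v) =
      mass K c φ s x * potential K ℓ (mass K c φ s) x +
      leafTotal K ℓ c s * mass K c φ s x + c x * K * s x * total K ℓ (mass K c φ s) -
      (K + 1) * K * (c x * s x ^ 2) := by
    intro x hx
    have hx' : x ≤ ℓ * K := by simpa [Nat.lt_succ_iff] using hx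
    rw [sum_starDist_liftVec_none]
    rw [sum_congr rfl fun j hj => sum_congr rfl fun i hi => by
      rw [sum_starDist_liftVec_some φ s hx' (mem_range.1 hj) (mem_range.1 hi)]]
    simp only [liftVec, sum_const, card_range, nsmul_eq_mul, mass]
    ring
  rw [sum_congr rfl h, sum_sub_distrib, sum_add_distrib, sum_add_distrib, ← mul_sum, ← sum_mul,
    ← mul_sum]
  unfold energy distForm leafTotal total
  ring

theorem isHermitian_distanceMatrix_starredPath (hK : 1 ≤ K) :
    (starredPath (K + 1) ℓ c).distanceMatrix.IsHermitian := by
  ext u v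
  simp only [distanceMatrix, Matrix.conjTranspose_apply, Matrix.of_apply, star_trivial]
  rw [pathDist_starredPath (by omega) u.2 v.2, pathDist_starredPath (by omega) v.2 u.2]
  have h1 := starDist_add (K + 1 - 1) u.1 v.1
  have h2 := starDist_add (K + 1 - 1) v.1 u.1
  have h3 : leafOverlap u.1.2 v.1.2 = leafOverlap v.1.2 u.1.2 := by
    rcases u.1.2 with _ | a <;> rcases v.1.2 with _ | b <;> simp only [leafOverlap, eq_comm]
  rw [baseDist_comm, ← h3] at h2
  simp only [eq_comm (a := v.1.1)] at h2
  norm_cast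
  omega

theorem distanceMatrix_mulVec_starredPath (hK : 1 ≤ K) [Fintype V(starredPath (K + 1) ℓ c)]
    (G : V(starredPath (K + 1) ℓ c) → ℝ) (u : V(starredPath (K + 1) ℓ c)) :
    (starredPath (K + 1) ℓ c).distanceMatrix.mulVec G u =
      ∑ v : V(starredPath (K + 1) ℓ c), (starDist K u v : ℝ) * G v := by
  refine sum_congr rfl fun v _ => ?_
  simp only [distanceMatrix, Matrix.of_apply]
  rw [pathDist_starredPath (by omega) u.2 v.2, Nat.add_sub_cancel]

theorem mem_vertexSet_none {x : ℕ} (hx : x ≤ ℓ * K) :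
    ((x, none) : ℕ × Option (ℕ × ℕ)) ∈ V(starredPath (K + 1) ℓ c) :=
  mem_vertexSet_starredPath.2 ⟨hx, by simp⟩

/-- The Rayleigh quotient is at most the spectral radius. -/
theorem energy_le (hK : 1 ≤ K) (φ s : ℕ → ℝ) :
    energy K ℓ c φ s ≤
      (starredPath (K + 1) ℓ c).distanceSpectralRadius * sqNorm K ℓ c φ s := by
  classical
  let _ : Fintype V(starredPath (K + 1) ℓ c) := Fintype.ofFinite _
  have h := (isHermitian_distanceMatrix_starredPath (ℓ := ℓ) (c := c) hK).dotProduct_mulVec_le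
    (fun v => liftVec φ s v)
  rw [← distanceSpectralRadius_eq_maxEigenvalue] at h
  simp only [dotProduct, distanceMatrix_mulVec_starredPath hK] at h
  rwa [sum_mul_sum_starDist_liftVec, sum_mul_self_liftVec] at h

/-- A vector whose Rayleigh quotient is the spectral radius is an eigenvector; this is its
eigenvalue equation at the path vertex `x`. -/
theorem path_eq_of_energy_eq (hK : 1 ≤ K) {φ s : ℕ → ℝ} (he : energy K ℓ c φ s =
      (starredPath (K + 1) ℓ c).distanceSpectralRadius * sqNorm K ℓ c φ s) {x : ℕ}
    (hx : x ≤ ℓ * K) :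
    (starredPath (K + 1) ℓ c).distanceSpectralRadius * φ x =
      potential K ℓ (mass K c φ s) x + leafTotal K ℓ c s := by
  classical
  let _ : Fintype V(starredPath (K + 1) ℓ c) := Fintype.ofFinite _
  have h := (isHermitian_distanceMatrix_starredPath (ℓ := ℓ) (c := c)
    hK).mulVec_eq_of_dotProduct_mulVec_eq (x := fun v => liftVec φ s v) (by
      rw [← distanceSpectralRadius_eq_maxEigenvalue]
      simp only [dotProduct, distanceMatrix_mulVec_starredPath hK]
      rwa [sum_mul_sum_starDist_liftVec, sum_mul_self_liftVec])
  have h' := congrFun h ⟨(x, none), mem_vertexSet_none hx⟩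
  rw [← distanceSpectralRadius_eq_maxEigenvalue, distanceMatrix_mulVec_starredPath hK,
    sum_starDist_liftVec_none] at h'
  exact h'.symm

/-- The top eigenvector of the distance matrix can be taken positive, and the eigenvalue equation
forces equal values on leaves with the same neighbor on the path. -/
theorem exists_isPerron (hK : 1 ≤ K) (hℓ : 1 ≤ ℓ) :
    ∃ φ s, IsPerron K ℓ c (starredPath (K + 1) ℓ c).distanceSpectralRadius φ s := by
  classical
  let _ : Fintype V(starredPath (K + 1) ℓ c) := Fintype.ofFinite _
  have hN : 1 ≤ ℓ * K := Nat.mul_pos hℓ hK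
  have : Nontrivial V(starredPath (K + 1) ℓ c) :=
    ⟨⟨(0, none), mem_vertexSet_none (Nat.zero_le _)⟩, ⟨(1, none), mem_vertexSet_none hN⟩, by simp⟩
  have hne : ∀ u v : V(starredPath (K + 1) ℓ c), u ≠ v →
      0 < (starredPath (K + 1) ℓ c).distanceMatrix u v := by
    intro u v huv
    simp only [distanceMatrix, Matrix.of_apply]
    rw [pathDist_starredPath (by omega) u.2 v.2, Nat.add_sub_cancel, Nat.cast_pos]
    have h := starDist_add K u.1 v.1
    obtain ⟨⟨x, s⟩, hu⟩ := u
    obtain ⟨⟨y, r⟩, hv⟩ := v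
    dsimp only at h ⊢
    by_cases hxy : x = y
    · subst hxy
      have hsr : s ≠ r := fun h => huv (by subst h; rfl)
      rcases s with _ | ⟨j, i⟩ <;> rcases r with _ | ⟨j', i'⟩ <;>
        simp only [leafOverlap, leafHeight, if_true] at h
      · exact absurd rfl hsr
      · omega
      · omega
      · split_ifs at h with h1 h2
        · exact absurd (by rw [h1, h2]) hsr
        · omega
        · omega
    · have := baseDist_pos hK hxy
      rw [if_neg hxy] at h
      omega
  obtain ⟨hρ, v, hv, hev⟩ := (isHermitian_distanceMatrix_starredPath (ℓ := ℓ) (c := c)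
    hK).exists_pos_eigenvector (fun u v => by simp [distanceMatrix]) hne
  rw [← distanceSpectralRadius_eq_maxEigenvalue] at hρ hev
  set ρ := (starredPath (K + 1) ℓ c).distanceSpectralRadius
  set G : ℕ × Option (ℕ × ℕ) → ℝ := fun u =>
    if h : u ∈ V(starredPath (K + 1) ℓ c) then v ⟨u, h⟩ else 0 with hG
  have hGv : ∀ u : V(starredPath (K + 1) ℓ c), G u = v u := fun u => by simp [hG]
  have heq : ∀ u ∈ V(starredPath (K + 1) ℓ c),
      ∑ w : V(starredPath (K + 1) ℓ c), (starDist K u w : ℝ) * G w = ρ * G u := by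
    intro u hu
    have := congrFun hev ⟨u, hu⟩
    rw [distanceMatrix_mulVec_starredPath hK] at this
    simp only [hGv]
    rw [this, hGv ⟨u, hu⟩]
    rfl
  have hpos : ∀ u ∈ V(starredPath (K + 1) ℓ c), 0 < G u := fun u hu => by
    rw [hGv ⟨u, hu⟩]
    exact hv _
  set S := ∑ w : V(starredPath (K + 1) ℓ c), G w with hS
  have hSpos : 0 < S := sum_pos (fun w _ => hpos w w.2) univ_nonempty
  set φ : ℕ → ℝ := fun x => G (x, none) with hφ
  set s : ℕ → ℝ := fun x => (ρ * φ x + S) / (ρ + K + 1) with hs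
  have hden : (0 : ℝ) < ρ + K + 1 := by positivity
  have hleaf : ∀ x ≤ ℓ * K, ∀ j < c x, ∀ i < K, G (x, some (j, i)) = s x := by
    intro x hx j hj i hi
    have hmem : ∀ i < K, (x, some (j, i)) ∈ V(starredPath (K + 1) ℓ c) := fun i hi =>
      mem_vertexSet_starredPath.2 ⟨hx, by rintro a ⟨⟩; exact ⟨hj, hi⟩⟩
    have h1 : ∀ i < K, (ρ + 1) * G (x, some (j, i)) =
        ρ * φ x + S - ∑ i' ∈ range K, G (x, some (j, i')) := by
      intro i hi
      have := sum_starDist_some G hx hj hi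
      rw [heq _ (hmem i hi), heq _ (mem_vertexSet_none hx)] at this
      simp only [hφ]
      linarith
    have h2 : ∀ i' ∈ range K, G (x, some (j, i')) = G (x, some (j, i)) := by
      intro i' hi'
      have := (h1 i' (mem_range.1 hi')).trans (h1 i hi).symm
      exact mul_left_cancel₀ (by positivity) this
    have h3 := h1 i hi
    rw [sum_congr rfl h2] at h3
    simp only [sum_const, card_range, nsmul_eq_mul] at h3
    simp only [hs]
    rw [eq_div_iff hden.ne']
    linarith
  have hlift : ∀ u : V(starredPath (K + 1) ℓ c), G u = liftVec φ s u := by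
    rintro ⟨⟨x, r⟩, hu⟩
    have hu' := mem_vertexSet_starredPath.1 hu
    rcases r with _ | ⟨j, i⟩
    · rfl
    · exact hleaf x hu'.1 j (hu'.2 _ rfl).1 i (hu'.2 _ rfl).2
  have hφpos : ∀ x ≤ ℓ * K, 0 < φ x := fun x hx => hpos _ (mem_vertexSet_none hx)
  refine ⟨φ, s, hρ, hφpos, fun x hx => ?_, fun x hx => ?_, fun x hx => ?_⟩
  · have := hφpos x hx
    positivity
  · have := heq _ (mem_vertexSet_none hx)
    simp only [hlift] at this
    rw [sum_starDist_liftVec_none] at this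
    exact this.symm
  · rw [← sum_liftVec, ← sum_congr rfl fun u _ => hlift u, ← hS]
    simp only [hs]
    field_simp

theorem IsPerron.energy_eq {ρ : ℝ} {φ s : ℕ → ℝ} (h : IsPerron K ℓ c ρ φ s) :
    energy K ℓ c φ s = ρ * sqNorm K ℓ c φ s := by
  have h1 : ∀ x ∈ range (ℓ * K + 1), ρ * φ x ^ 2 + K * (ρ * (c x * s x ^ 2)) =
      mass K c φ s x * potential K ℓ (mass K c φ s) x +
      leafTotal K ℓ c s * mass K c φ s x + c x * K * s x * total K ℓ (mass K c φ s) -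
      (K + 1) * K * (c x * s x ^ 2) := by
    intro x hx
    have hx' : x ≤ ℓ * K := by simpa [Nat.lt_succ_iff] using hx
    have h2 := h.path_eq x hx'
    have h3 := h.leaf_eq x hx'
    unfold mass at *
    linear_combination (φ x + c x * K * s x) * h2 + (c x * K * s x) * h3
  unfold sqNorm
  rw [mul_add, mul_left_comm, mul_sum, mul_sum, mul_sum, ← sum_add_distrib, sum_congr rfl h1,
    sum_sub_distrib, sum_add_distrib, sum_add_distrib, ← mul_sum, ← sum_mul, ← mul_sum]
  unfold energy distForm leafTotal total
  ring

end Hypergraph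

/-! ### Branches and the transfer of pendant edges -/

namespace Hypergraph

open Finset

variable {K ℓ : ℕ} {c : ℕ → ℕ}

/-- The weight of the branch at the vertex `z` of the path edge `[tK, (t+1)K]`: the weight of all
vertices whose nearest vertex in that edge is `z`. -/
noncomputable def branchMass (K ℓ : ℕ) (W : ℕ → ℝ) (t z : ℕ) : ℝ :=
  ∑ y ∈ range (ℓ * K + 1), if edgeProj K t y = z then W y else 0

/-- Going from `z` to `x` in the same edge changes the distances only to the branches at these two
vertices. -/
theorem potential_sub_potential (hK : 1 ≤ K) (W : ℕ → ℝ) {t x z : ℕ} (hx : t * K ≤ x)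
    (hx' : x ≤ (t + 1) * K) (hz : t * K ≤ z) (hz' : z ≤ (t + 1) * K) :
    potential K ℓ W x - potential K ℓ W z = branchMass K ℓ W t z - branchMass K ℓ W t x := by
  unfold potential branchMass
  rw [← sum_sub_distrib, ← sum_sub_distrib]
  refine sum_congr rfl fun y _ => ?_
  have h := congrArg (Nat.cast (R := ℝ)) (baseDist_add_of_mem (z := y) hK hx hx' hz hz')
  push_cast at h
  simp only [eq_comm (b := edgeProj K t y)] at h
  split_ifs at h ⊢ <;> linear_combination (W y) * h

theorem sum_branchMass (W : ℕ → ℝ) (t : ℕ) :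
    ∑ z ∈ Icc (t * K) ((t + 1) * K), branchMass K ℓ W t z = total K ℓ W := by
  unfold branchMass total
  rw [sum_comm]
  refine sum_congr rfl fun y _ => ?_
  rw [sum_ite_eq, if_pos (mem_Icc.2 ⟨le_edgeProj, edgeProj_le⟩)]

theorem branchMass_of_mem {W : ℕ → ℝ} {t z : ℕ} (ht : t < ℓ) (hz : t * K < z)
    (hz' : z < (t + 1) * K) : branchMass K ℓ W t z = W z := by
  have h1 : (t + 1) * K ≤ ℓ * K := Nat.mul_le_mul_right _ ht
  unfold branchMass
  rw [sum_eq_single_of_mem z (mem_range.2 (by omega)), if_pos (edgeProj_of_mem hz.le hz'.le)]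
  intro y _ hy
  rw [if_neg]
  unfold edgeProj
  omega

theorem branchMass_left (hK : 1 ≤ K) {W : ℕ → ℝ} {t : ℕ} (ht : t < ℓ) :
    branchMass K ℓ W t (t * K) = ∑ y ∈ range (t * K + 1), W y := by
  have h1 : (t + 1) * K ≤ ℓ * K := Nat.mul_le_mul_right _ ht
  have h2 : (t + 1) * K = t * K + K := by ring
  unfold branchMass
  rw [← sum_filter]
  refine sum_congr ?_ fun _ _ => rfl
  ext y
  rw [mem_filter]
  simp only [mem_range, edgeProj]
  omega

theorem branchMass_right (hK : 1 ≤ K) {W : ℕ → ℝ} {t : ℕ} :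
    branchMass K ℓ W t ((t + 1) * K) = ∑ y ∈ Ico ((t + 1) * K) (ℓ * K + 1), W y := by
  have h2 : (t + 1) * K = t * K + K := by ring
  unfold branchMass
  rw [← sum_filter]
  refine sum_congr ?_ fun _ _ => rfl
  ext y
  rw [mem_filter]
  simp only [mem_range, edgeProj, mem_Ico]
  omega

/-- The distance `d(x, y)` counts the edges that separate `x` and `y`, and each edge contributes the
squared total weight minus the squared weights of its branches. -/
theorem distForm_eq_sum (hK : 1 ≤ K) (W : ℕ → ℝ) :
    distForm K ℓ W = ∑ t ∈ range ℓ, (total K ℓ W ^ 2 -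
      ∑ z ∈ Icc (t * K) ((t + 1) * K), branchMass K ℓ W t z ^ 2) := by
  have h1 : distForm K ℓ W = ∑ t ∈ range ℓ, ∑ x ∈ range (ℓ * K + 1), ∑ y ∈ range (ℓ * K + 1),
      (W x * W y - if edgeProj K t x = edgeProj K t y then W x * W y else 0) := by
    unfold distForm potential
    rw [sum_comm]
    refine sum_congr rfl fun x hx => ?_
    rw [sum_comm, mul_sum]
    refine sum_congr rfl fun y hy => ?_
    rw [baseDist_eq_sum (L := ℓ) hK (Nat.lt_succ_iff.1 (mem_range.1 hx))
      (Nat.lt_succ_iff.1 (mem_range.1 hy))]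
    push_cast
    rw [sum_mul, mul_sum]
    refine sum_congr rfl fun t _ => ?_
    split_ifs <;> ring
  rw [h1]
  refine sum_congr rfl fun t _ => ?_
  simp only [sum_sub_distrib]
  congr 1
  · unfold total
    rw [sq, sum_mul_sum]
  · have h2 : ∀ z, branchMass K ℓ W t z ^ 2 = ∑ x ∈ range (ℓ * K + 1), ∑ y ∈ range (ℓ * K + 1),
        if edgeProj K t x = z then (if edgeProj K t y = z then W x * W y else 0) else 0 := by
      intro z
      unfold branchMass
      rw [sq, sum_mul_sum]
      refine sum_congr rfl fun x _ => sum_congr rfl fun y _ => ?_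
      split_ifs <;> ring
    simp only [h2]
    rw [sum_comm (s := Icc _ _)]
    refine sum_congr rfl fun x _ => ?_
    rw [sum_comm (s := Icc _ _)]
    refine sum_congr rfl fun y _ => ?_
    rw [sum_ite_eq, if_pos (mem_Icc.2 ⟨le_edgeProj, edgeProj_le⟩)]
    simp only [eq_comm]

theorem distForm_nonpos (hK : 1 ≤ K) {W : ℕ → ℝ} (h : total K ℓ W = 0) : distForm K ℓ W ≤ 0 := by
  rw [distForm_eq_sum hK, h]
  exact sum_nonpos fun t _ => by
    have := sum_nonneg fun z (_ : z ∈ Icc (t * K) ((t + 1) * K)) => sq_nonneg (branchMass K ℓ W t z)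
    simpa using this

theorem IsPerron.sqNorm_pos {ρ : ℝ} {φ s : ℕ → ℝ} (h : IsPerron K ℓ c ρ φ s) :
    0 < sqNorm K ℓ c φ s := by
  unfold sqNorm
  have h1 : 0 < ∑ x ∈ range (ℓ * K + 1), φ x ^ 2 :=
    sum_pos (fun x hx => pow_pos (h.path_pos x (by simpa [Nat.lt_succ_iff] using hx)) 2)
      ⟨0, by simp⟩
  have h2 : 0 ≤ ∑ x ∈ range (ℓ * K + 1), (c x : ℝ) * s x ^ 2 :=
    sum_nonneg fun x _ => by positivity
  positivity

/-- Transferring `r` pendant edges from the path vertex `p` to the path vertex `q`. -/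
def transfer (c : ℕ → ℕ) (p q r : ℕ) : ℕ → ℕ :=
  fun x => if x = q then r else if x = p then c p - r else c x

/-- Transferring pendant edges of total weight `P` from `p` to `q` changes the quadratic form by
`2 P (f q - f p - P d(p, q))`, where `f` is the potential. If this vanishes, then the radius still
grows: otherwise the old eigenvector would also be one for the new matrix, but the potential at `q`
has changed. -/
theorem distanceSpectralRadius_lt_transfer (hK : 1 ≤ K) {φ s : ℕ → ℝ}
    (h : IsPerron K ℓ c (starredPath (K + 1) ℓ c).distanceSpectralRadius φ s) {p q r : ℕ}
    (hp : p ≤ ℓ * K) (hq : q ≤ ℓ * K) (hpq : p ≠ q) (hcq : c q = 0) (hr : 0 < r) (hrp : r ≤ c p)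
    (hgain : r * K * s p * baseDist K p q ≤
      potential K ℓ (mass K c φ s) q - potential K ℓ (mass K c φ s) p) :
    (starredPath (K + 1) ℓ c).distanceSpectralRadius <
      (starredPath (K + 1) ℓ (transfer c p q r)).distanceSpectralRadius := by
  set W := mass K c φ s with hW
  set f := potential K ℓ W with hf
  set P : ℝ := r * K * s p with hP
  have hPpos : 0 < P := by
    have := h.leaf_pos p hp
    positivity
  -- the transferred leaves keep their values; as `c q = 0`, the value `s q` is not needed
  set s' : ℕ → ℝ := fun x => if x = q then s p else s x with hs'
  set c' := transfer c p q r with hc'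
  set W' := mass K c' φ s' with hW'
  have hNq : q ∈ range (ℓ * K + 1) := mem_range.2 (by omega)
  have hNp : p ∈ range (ℓ * K + 1) := mem_range.2 (by omega)
  have hpt : ∀ x, (c' x : ℝ) * s' x = c x * s x + (if x = q then r * s p else 0) -
      (if x = p then r * s p else 0) ∧ (c' x : ℝ) * s' x ^ 2 = c x * s x ^ 2 +
      (if x = q then r * s p ^ 2 else 0) - (if x = p then r * s p ^ 2 else 0) := by
    intro x
    by_cases hxq : x = q
    · subst hxq
      simp [hc', hs', transfer, hcq, hpq.symm]
    · by_cases hxp : x = p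
      · subst hxp
        simp [hc', hs', transfer, hxq, Nat.cast_sub hrp]
        constructor <;> ring
      · simp [hc', hs', transfer, hxq, hxp]
  have hWpt : ∀ x, W' x = W x + (if x = q then P else 0) - (if x = p then P else 0) := by
    intro x
    have := (hpt x).1
    simp only [hW', hW, mass, hP]
    split_ifs at this ⊢ <;> linear_combination (K : ℝ) * this
  have htot : total K ℓ W' = total K ℓ W := by
    unfold total
    simp only [hWpt, sum_sub_distrib, sum_add_distrib, sum_ite_eq', hNq, hNp, if_true]
    ring
  have hleaf : leafTotal K ℓ c' s' = leafTotal K ℓ c s := by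
    have h1 : ∀ x, (c' x : ℝ) * K * s' x = c x * K * s x + (if x = q then P else 0) -
        (if x = p then P else 0) := by
      intro x
      have := hWpt x
      simp only [hW', hW, mass] at this
      linarith
    unfold leafTotal
    simp only [h1, sum_sub_distrib, sum_add_distrib, sum_ite_eq', hNq, hNp, if_true]
    ring
  have hsq : ∑ x ∈ range (ℓ * K + 1), (c' x : ℝ) * s' x ^ 2 =
      ∑ x ∈ range (ℓ * K + 1), (c x : ℝ) * s x ^ 2 := by
    simp only [(hpt _).2, sum_sub_distrib, sum_add_distrib, sum_ite_eq', hNq, hNp, if_true]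
    ring
  have hpot : ∀ x, potential K ℓ W' x = f x + P * (baseDist K x q - baseDist K x p) := by
    intro x
    simp only [hf]
    unfold potential
    simp only [hWpt, mul_sub, mul_add, mul_ite, mul_zero, sum_sub_distrib, sum_add_distrib,
      sum_ite_eq', hNq, hNp, if_true]
    ring
  have hcross : ∀ z, ∑ x ∈ range (ℓ * K + 1), W x * (baseDist K x z : ℝ) = f z := by
    intro z
    simp only [hf]
    unfold potential
    exact sum_congr rfl fun x _ => by rw [baseDist_comm, mul_comm]
  have hform : distForm K ℓ W' = distForm K ℓ W + 2 * P * (f q - f p - P * baseDist K p q) := by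
    have h1 : ∀ x ∈ range (ℓ * K + 1), W' x * potential K ℓ W' x =
        W x * f x + P * (W x * baseDist K x q) - P * (W x * baseDist K x p) +
        (if x = q then P * (f q - P * baseDist K p q) else 0) -
        (if x = p then P * (f p + P * baseDist K p q) else 0) := by
      intro x _
      rw [hpot, hWpt]
      by_cases hxq : x = q
      · subst hxq
        simp only [if_true, hpq.symm, if_false, baseDist_self]
        rw [baseDist_comm (x := x) (y := p)]
        push_cast
        ring
      · by_cases hxp : x = p
        · subst hxp
          simp only [if_true, hxq, if_false, baseDist_self]
          push_cast
          ring
        · simp only [hxq, hxp, if_false]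
          ring
    unfold distForm
    rw [sum_congr rfl h1]
    simp only [sum_sub_distrib, sum_add_distrib, ← mul_sum, sum_ite_eq', hNq, hNp, if_true, hcross]
    ring
  have hnorm : sqNorm K ℓ c' φ s' = sqNorm K ℓ c φ s := by
    unfold sqNorm
    rw [hsq]
  have hen : energy K ℓ c' φ s' =
      energy K ℓ c φ s + 2 * P * (f q - f p - P * baseDist K p q) := by
    unfold energy
    rw [← hW', ← hW, htot, hleaf, hsq, hform]
    ring
  have hsqpos := h.sqNorm_pos
  have hle := energy_le (ℓ := ℓ) (c := c') hK φ s'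
  have hge : 0 ≤ 2 * P * (f q - f p - P * baseDist K p q) := by
    have : 0 ≤ f q - f p - P * baseDist K p q := by linarith
    positivity
  rw [hen, hnorm, h.energy_eq] at hle
  by_contra hlt
  rw [not_lt] at hlt
  have heq : (starredPath (K + 1) ℓ c').distanceSpectralRadius =
      (starredPath (K + 1) ℓ c).distanceSpectralRadius := by
    refine le_antisymm hlt ?_
    by_contra hcon
    rw [not_le] at hcon
    have := mul_lt_mul_of_pos_right hcon hsqpos
    linarith
  rw [heq] at hle
  have hz : 2 * P * (f q - f p - P * baseDist K p q) = 0 := by linarith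
  have h1 := path_eq_of_energy_eq (ℓ := ℓ) (c := c') (φ := φ) (s := s') hK
    (by rw [hen, hnorm, h.energy_eq, heq, hz, add_zero]) hq
  rw [heq, ← hW', hpot, hleaf, h.path_eq q hq, ← hW, baseDist_self] at h1
  have h2 : (0 : ℝ) < baseDist K q p := by exact_mod_cast baseDist_pos hK hpq.symm
  have h3 : P * ((0 : ℕ) - (baseDist K q p : ℝ)) = 0 := by linarith
  have h4 := mul_pos hPpos h2
  push_cast at h3
  linarith

end Hypergraph

/-! ### Reflection of the path -/

namespace Hypergraph

open Finset

section

variable {K ℓ : ℕ} {c : ℕ → ℕ}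

theorem edgeProj_reflect {t x : ℕ} (ht : t < ℓ) (hx : x ≤ ℓ * K) :
    edgeProj K (ℓ - 1 - t) (ℓ * K - x) = ℓ * K - edgeProj K t x := by
  obtain ⟨d, rfl⟩ : ∃ d, ℓ = t + 1 + d := ⟨ℓ - (t + 1), by omega⟩
  have h1 : t + 1 + d - 1 - t = d := by omega
  rw [h1]
  unfold edgeProj
  have h2 : (t + 1 + d) * K = t * K + K + d * K := by ring
  have h3 : (t + 1) * K = t * K + K := by ring
  have h4 : (d + 1) * K = d * K + K := by ring
  rw [h2] at hx
  rw [h2, h3, h4]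
  omega

theorem edgeProj_le_of_le {t x : ℕ} (ht : t < ℓ) : edgeProj K t x ≤ ℓ * K :=
  edgeProj_le.trans (Nat.mul_le_mul_right K (show t + 1 ≤ ℓ from ht))

theorem baseDist_reflect (hK : 1 ≤ K) {x y : ℕ} (hx : x ≤ ℓ * K) (hy : y ≤ ℓ * K) :
    baseDist K (ℓ * K - x) (ℓ * K - y) = baseDist K x y := by
  rw [baseDist_eq_sum (L := ℓ) hK (Nat.sub_le _ _) (Nat.sub_le _ _),
    baseDist_eq_sum (L := ℓ) hK hx hy, ← sum_range_reflect]
  refine sum_congr rfl fun t ht => ?_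
  rw [mem_range] at ht
  rw [edgeProj_reflect ht hx, edgeProj_reflect ht hy]
  have h1 : edgeProj K t x ≤ ℓ * K := edgeProj_le_of_le ht
  have h2 : edgeProj K t y ≤ ℓ * K := edgeProj_le_of_le ht
  congr 1
  rw [eq_iff_iff]
  omega

theorem sum_reflect {M : Type*} [AddCommMonoid M] (N : ℕ) (h : ℕ → M) :
    ∑ x ∈ range (N + 1), h (N - x) = ∑ x ∈ range (N + 1), h x := by
  rw [← sum_range_reflect h]
  exact sum_congr rfl fun x _ => by rw [Nat.add_sub_cancel]

theorem potential_reflect (hK : 1 ≤ K) (W : ℕ → ℝ) {x : ℕ} (hx : x ≤ ℓ * K) :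
    potential K ℓ (fun y => W (ℓ * K - y)) x = potential K ℓ W (ℓ * K - x) := by
  unfold potential
  rw [← sum_reflect]
  refine sum_congr rfl fun y hy => ?_
  have hy' : y ≤ ℓ * K := by simpa [Nat.lt_succ_iff] using hy
  dsimp only
  rw [Nat.sub_sub_self hy', ← baseDist_reflect hK hx (Nat.sub_le _ _), Nat.sub_sub_self hy']

theorem IsPerron.reflect (hK : 1 ≤ K) {ρ : ℝ} {φ s : ℕ → ℝ} (h : IsPerron K ℓ c ρ φ s) :
    IsPerron K ℓ (fun x => c (ℓ * K - x)) ρ (fun x => φ (ℓ * K - x)) (fun x => s (ℓ * K - x)) := by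
  have hW : mass K (fun x => c (ℓ * K - x)) (fun x => φ (ℓ * K - x)) (fun x => s (ℓ * K - x)) =
      fun x => mass K c φ s (ℓ * K - x) := rfl
  have hQ : leafTotal K ℓ (fun x => c (ℓ * K - x)) (fun x => s (ℓ * K - x)) = leafTotal K ℓ c s :=
    sum_reflect _ fun x => (c x : ℝ) * K * s x
  have hS : total K ℓ (fun x => mass K c φ s (ℓ * K - x)) = total K ℓ (mass K c φ s) :=
    sum_reflect _ (mass K c φ s)
  refine ⟨h.rho_pos, fun x _ => h.path_pos _ (Nat.sub_le _ _), fun x _ => h.leaf_pos _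
    (Nat.sub_le _ _), fun x hx => ?_, fun x hx => ?_⟩
  · rw [hW, hQ, potential_reflect hK _ hx]
    exact h.path_eq _ (Nat.sub_le _ _)
  · rw [hW, hS]
    exact h.leaf_eq _ (Nat.sub_le _ _)

theorem IsPerron.mass_pos {ρ : ℝ} {φ s : ℕ → ℝ} (h : IsPerron K ℓ c ρ φ s) {x : ℕ}
    (hx : x ≤ ℓ * K) : 0 < mass K c φ s x := by
  have h1 := h.path_pos x hx
  have h2 := h.leaf_pos x hx
  unfold mass
  positivity

end

/-! ### Straightening: drawing a pendant edge at an inner vertex of a path edge into the path -/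

section

variable {K ℓ : ℕ} {c : ℕ → ℕ}

theorem branchMass_left_add (hK : 1 ≤ K) {W : ℕ → ℝ} {t : ℕ} (ht : t < ℓ) :
    ∑ y ∈ range (t * K + 1), W y + ∑ y ∈ Ioo (t * K) ((t + 1) * K), W y +
      ∑ y ∈ Ico ((t + 1) * K) (ℓ * K + 1), W y = total K ℓ W := by
  have h1 : (t + 1) * K ≤ ℓ * K := Nat.mul_le_mul_right _ ht
  have h2 : (t + 1) * K = t * K + K := by ring
  have h3 : Ioo (t * K) ((t + 1) * K) = Ico (t * K + 1) ((t + 1) * K) := by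
    ext y
    simp only [mem_Ioo, mem_Ico]
    omega
  unfold total
  rw [h3, sum_range_add_sum_Ico _ (by omega), sum_range_add_sum_Ico _ (by omega)]

theorem sum_branchMass_sq (hK : 1 ≤ K) {W : ℕ → ℝ} {t : ℕ} (ht : t < ℓ) :
    ∑ z ∈ Icc (t * K) ((t + 1) * K), branchMass K ℓ W t z ^ 2 =
      (∑ y ∈ range (t * K + 1), W y) ^ 2 + ∑ y ∈ Ioo (t * K) ((t + 1) * K), W y ^ 2 +
        (∑ y ∈ Ico ((t + 1) * K) (ℓ * K + 1), W y) ^ 2 := by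
  have h2 : t * K < (t + 1) * K := Nat.mul_lt_mul_of_pos_right (Nat.lt_succ_self t) hK
  rw [← Ioc_insert_left h2.le, sum_insert (by simp), ← Ioo_insert_right h2, sum_insert (by simp),
    branchMass_left hK ht, branchMass_right hK, sum_congr (s₁ := Ioo _ _) rfl fun z hz => by
      rw [branchMass_of_mem ht (mem_Ioo.1 hz).1 (mem_Ioo.1 hz).2]]
  ring

/-- If the path continues beyond the right end of the edge `t`, then the branch there is heavier
than `K - 1` leaves of an inner vertex `x` of that edge. Otherwise the eigenvalue equations would
force the `K` new vertices of the next edge to weigh more on average than such a leaf. -/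
theorem IsPerron.lt_sum_right (hK : 1 ≤ K) {ρ : ℝ} {φ s : ℕ → ℝ} (h : IsPerron K ℓ c ρ φ s)
    {t x : ℕ} (ht : t + 2 ≤ ℓ) (hx : t * K < x) (hx' : x < (t + 1) * K) (hc : 0 < c x) :
    (K - 1) * s x < ∑ y ∈ Ico ((t + 1) * K) (ℓ * K + 1), mass K c φ s y := by
  set W := mass K c φ s with hW
  set u := (t + 1) * K with hu
  have hv : (t + 1 + 1) * K = u + K := by rw [hu]; ring
  have hu1 : u = t * K + K := by rw [hu]; ring
  have hN : (t + 1 + 1) * K ≤ ℓ * K := Nat.mul_le_mul_right _ ht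
  have hR : branchMass K ℓ W t u = ∑ y ∈ Ico u (ℓ * K + 1), W y := branchMass_right hK
  have hL : branchMass K ℓ W (t + 1) u = ∑ y ∈ range (u + 1), W y :=
    branchMass_left hK (by omega)
  set R := ∑ y ∈ Ico u (ℓ * K + 1), W y with hRdef
  set R' := ∑ y ∈ Ico (u + 1) (ℓ * K + 1), W y with hR'
  have hS : ∑ y ∈ range (u + 1), W y + R' = total K ℓ W := sum_range_add_sum_Ico _ (by omega)
  have hRR : R = W u + R' := by
    rw [hRdef, hR', sum_eq_sum_Ico_succ_bot (by omega)]
  have hWpos : ∀ y ≤ ℓ * K, 0 < W y := fun y hy => h.mass_pos hy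
  have hsum : ∑ z ∈ Ioc u (u + K), (potential K ℓ W z - potential K ℓ W u) =
      K * (total K ℓ W - R') - R' := by
    have h1 : ∀ z ∈ Ioc u (u + K), potential K ℓ W z - potential K ℓ W u =
        (total K ℓ W - R') - branchMass K ℓ W (t + 1) z := by
      intro z hz
      rw [mem_Ioc] at hz
      rw [potential_sub_potential (t := t + 1) hK W (by omega) (by omega) le_rfl (by omega), hL,
        ← hS]
      ring
    have h2 := sum_branchMass (K := K) (ℓ := ℓ) W (t + 1)
    rw [← Ioc_insert_left (by omega), sum_insert (by simp), ← hu, hL, hv] at h2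
    rw [sum_congr rfl h1, sum_sub_distrib]
    simp only [sum_const, Nat.card_Ioc, nsmul_eq_mul, Nat.add_sub_cancel_left]
    linarith
  have hxu : potential K ℓ W x - potential K ℓ W u = R - W x := by
    rw [potential_sub_potential (t := t) hK W hx.le hx'.le (by omega) le_rfl, ← hu, hR,
      branchMass_of_mem (by omega) hx hx']
  have hφ : ∑ z ∈ Ioc u (u + K), φ z ≤ R' := by
    have h1 : ∀ z ∈ Ioc u (u + K), φ z ≤ W z := by
      intro z hz
      rw [mem_Ioc] at hz
      have := h.leaf_pos z (by omega)
      have h2 : 0 ≤ (c z : ℝ) * K * s z := by positivity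
      simp only [hW, mass]
      linarith
    refine (sum_le_sum h1).trans (sum_le_sum_of_subset_of_nonneg ?_ ?_)
    · intro z hz
      rw [mem_Ioc] at hz
      rw [mem_Ico]
      omega
    · intro z hz _
      rw [mem_Ico] at hz
      exact (hWpos z (by omega)).le
  have hρ : ρ * (∑ z ∈ Ioc u (u + K), φ z - K * s x) =
      K * (W x + (K + 1) * s x - R - R') - R' := by
    have h1 : ρ * ∑ z ∈ Ioc u (u + K), φ z =
        ∑ z ∈ Ioc u (u + K), (potential K ℓ W z - potential K ℓ W u) +
          K * (potential K ℓ W u + leafTotal K ℓ c s) := by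
      rw [mul_sum, sum_congr rfl fun z hz => h.path_eq z (by rw [mem_Ioc] at hz; omega),
        sum_add_distrib, sum_sub_distrib]
      simp only [sum_const, Nat.card_Ioc, nsmul_eq_mul, Nat.add_sub_cancel_left]
      ring
    have h2 := h.leaf_eq x (by omega)
    have h3 := h.path_eq x (by omega)
    rw [← hW] at h2 h3
    rw [mul_sub, h1, hsum]
    linear_combination (-(K : ℝ)) * h2 - K * h3 - K * hxu
  by_contra hcon
  rw [not_lt] at hcon
  have hs := h.leaf_pos x (by omega)
  have hφx := h.path_pos x (by omega)
  have hWx : K * s x ≤ W x := by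
    have h1 : (1 : ℝ) ≤ c x := by exact_mod_cast hc
    have h2 : (0 : ℝ) ≤ (c x - 1) * (K * s x) := mul_nonneg (by linarith) (by positivity)
    simp only [hW, mass]
    linarith
  have hWu := hWpos u (by omega)
  have hK' : (1 : ℝ) ≤ K := by exact_mod_cast hK
  have hpos : 0 < K * (W x + (K + 1) * s x - R - R') - R' := by nlinarith
  rw [← hρ] at hpos
  have := pos_of_mul_pos_right hpos h.rho_pos.le
  linarith

theorem IsPerron.lt_sum_left (hK : 1 ≤ K) {ρ : ℝ} {φ s : ℕ → ℝ} (h : IsPerron K ℓ c ρ φ s)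
    {t x : ℕ} (ht : 1 ≤ t) (htℓ : t < ℓ) (hx : t * K < x) (hx' : x < (t + 1) * K) (hc : 0 < c x) :
    (K - 1) * s x < ∑ y ∈ range (t * K + 1), mass K c φ s y := by
  obtain ⟨d, rfl⟩ : ∃ d, ℓ = t + 1 + d := ⟨ℓ - (t + 1), by omega⟩
  have h2 : (t + 1 + d) * K = t * K + K + d * K := by ring
  have h3 : (t + 1) * K = t * K + K := by ring
  have h4 : (d + 1) * K = d * K + K := by ring
  have h1 := (h.reflect hK).lt_sum_right hK (t := d) (x := (t + 1 + d) * K - x) (by omega)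
    (by omega) (by omega) (by rwa [Nat.sub_sub_self (by omega)])
  rw [Nat.sub_sub_self (by omega)] at h1
  refine h1.trans_eq ?_
  have h5 := sum_Ico_reflect (mass K c φ s) ((d + 1) * K) (m := (t + 1 + d) * K + 1)
    (n := (t + 1 + d) * K) (by omega)
  rw [show (t + 1 + d) * K + 1 - ((t + 1 + d) * K + 1) = 0 by omega,
    show (t + 1 + d) * K + 1 - (d + 1) * K = t * K + 1 by omega, Nat.Ico_zero_eq_range] at h5
  exact h5

/-- The sequence on the path that arises from `h` when `K` vertices are inserted: the value at `x`
becomes `a`, the value at `(t+1)K` is `b`, the next `K - 1` values are `d`, and the old values from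
`(t+1)K` onwards are shifted by `K`. -/
def insertEdge {M : Type*} (K t x : ℕ) (a b d : M) (h : ℕ → M) (z : ℕ) : M :=
  if z = x then a else if z < (t + 1) * K then h z else if z = (t + 1) * K then b else
    if z < (t + 2) * K then d else h (z - K)

section

variable {M : Type*} {t x z : ℕ} {a b d : M} {h : ℕ → M}

theorem insertEdge_of_lt (hz : z < (t + 1) * K) (hzx : z ≠ x) :
    insertEdge K t x a b d h z = h z := by
  rw [insertEdge, if_neg hzx, if_pos hz]

theorem insertEdge_self : insertEdge K t x a b d h x = a := if_pos rfl

theorem insertEdge_end (hx' : x < (t + 1) * K) :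
    insertEdge K t x a b d h ((t + 1) * K) = b := by
  rw [insertEdge, if_neg hx'.ne', if_neg (lt_irrefl _), if_pos rfl]

theorem insertEdge_mid (hx' : x < (t + 1) * K) (hz : (t + 1) * K < z) (hz' : z < (t + 2) * K) :
    insertEdge K t x a b d h z = d := by
  rw [insertEdge, if_neg (by omega), if_neg (by omega), if_neg (by omega), if_pos hz']

theorem insertEdge_add (hx' : x < (t + 1) * K) (hz : (t + 1) * K ≤ z) :
    insertEdge K t x a b d h (z + K) = h z := by
  have h1 : (t + 2) * K = (t + 1) * K + K := by ring
  rcases Nat.eq_zero_or_pos K with rfl | hK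
  · simp at hx'
  rw [insertEdge, if_neg (by omega), if_neg (by omega), if_neg (by omega), if_neg (by omega),
    Nat.add_sub_cancel]

theorem sum_insertEdge_Ico [AddCommMonoid M] (hx' : x < (t + 1) * K) {m n : ℕ}
    (hm : (t + 1) * K ≤ m) :
    ∑ y ∈ Ico (m + K) (n + K), insertEdge K t x a b d h y = ∑ y ∈ Ico m n, h y := by
  rw [← sum_Ico_add']
  exact sum_congr rfl fun y hy => insertEdge_add hx' (hm.trans (mem_Ico.1 hy).1)

theorem sum_insertEdge [AddCommMonoid M] (ht : t < ℓ) (hx' : x < (t + 1) * K) :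
    ∑ z ∈ range ((ℓ + 1) * K + 1), insertEdge K t x a b d h z + h x =
      ∑ z ∈ range (ℓ * K + 1), h z + a + b + (K - 1) • d := by
  have h1 : (t + 2) * K = (t + 1) * K + K := by ring
  have h2 : (ℓ + 1) * K = ℓ * K + K := by ring
  have h3 : (t + 1) * K ≤ ℓ * K := Nat.mul_le_mul_right _ ht
  have hK : 1 ≤ K := by
    rcases Nat.eq_zero_or_pos K with rfl | hK
    · simp at hx'
    · exact hK
  have hx : x ∈ range ((t + 1) * K) := mem_range.2 hx'
  have e1 : ∑ z ∈ range ((t + 1) * K), insertEdge K t x a b d h z + h x =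
      ∑ z ∈ range ((t + 1) * K), h z + a := by
    rw [← add_sum_erase _ _ hx, ← add_sum_erase _ h hx, insertEdge_self,
      sum_congr rfl fun z hz => insertEdge_of_lt (mem_range.1 (mem_of_mem_erase hz))
        (ne_of_mem_erase hz)]
    abel
  have e2 : ∑ z ∈ Ico ((t + 1) * K) ((t + 2) * K), insertEdge K t x a b d h z = b + (K - 1) • d := by
    rw [sum_eq_sum_Ico_succ_bot (by omega), insertEdge_end hx', sum_congr rfl fun z hz =>
      insertEdge_mid hx' (by rw [mem_Ico] at hz; omega) (mem_Ico.1 hz).2, sum_const, Nat.card_Ico]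
    congr 2
    omega
  have e3 : ∑ z ∈ Ico ((t + 2) * K) ((ℓ + 1) * K + 1), insertEdge K t x a b d h z =
      ∑ z ∈ Ico ((t + 1) * K) (ℓ * K + 1), h z := by
    rw [h1, show (ℓ + 1) * K + 1 = ℓ * K + 1 + K by omega]
    exact sum_insertEdge_Ico hx' le_rfl
  rw [← sum_range_add_sum_Ico (insertEdge K t x a b d h) (show (t + 1) * K ≤ (ℓ + 1) * K + 1 by omega),
    ← sum_Ico_consecutive _ (show (t + 1) * K ≤ (t + 2) * K by omega)
      (show (t + 2) * K ≤ (ℓ + 1) * K + 1 by omega), e2, e3,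
    ← sum_range_add_sum_Ico h (show (t + 1) * K ≤ ℓ * K + 1 by omega)]
  calc _ = (∑ z ∈ range ((t + 1) * K), insertEdge K t x a b d h z + h x) + (b + (K - 1) • d) +
        ∑ z ∈ Ico ((t + 1) * K) (ℓ * K + 1), h z := by abel
    _ = _ := by
      rw [e1]
      abel

end

theorem sum_insert_term {F F' : ℕ → ℝ} {t : ℕ} (ht : t < ℓ) (h1 : ∀ j < t, F' j = F j)
    (h2 : ∀ j, t < j → j < ℓ → F' (j + 1) = F j) :
    ∑ j ∈ range (ℓ + 1), F' j + F t = ∑ j ∈ range ℓ, F j + F' t + F' (t + 1) := by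
  rw [← sum_range_add_sum_Ico F' (show t ≤ ℓ + 1 by omega),
    ← sum_range_add_sum_Ico F (show t ≤ ℓ by omega),
    sum_eq_sum_Ico_succ_bot (show t < ℓ + 1 by omega), sum_eq_sum_Ico_succ_bot ht,
    sum_eq_sum_Ico_succ_bot (show t + 1 < ℓ + 1 by omega),
    sum_congr rfl fun j hj => h1 j (mem_range.1 hj), ← sum_Ico_add' _ (t + 1) ℓ 1,
    sum_congr rfl fun j hj => h2 j (mem_Ico.1 hj).1 (mem_Ico.1 hj).2]
  ring

/-- A pendant edge at an inner vertex `x` of the path edge `t` can be made the next path edge, one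
of its leaves taking the place of `x`. If `R` and `L` are the weights of the branches at the ends of
the edge `t`, and `O` that of the other inner branches, then the quadratic form grows by
`2 (R - s) (L + O - (K - 1) s)`, where `s` is the weight of a leaf. -/
theorem distanceSpectralRadius_lt_insertEdge (hK : 1 ≤ K) {t x : ℕ} (ht : 1 ≤ t) (ht' : t + 2 ≤ ℓ)
    (hx : t * K < x) (hx' : x < (t + 1) * K) (hc : 0 < c x) :
    (starredPath (K + 1) ℓ c).distanceSpectralRadius <
      (starredPath (K + 1) (ℓ + 1)
        (insertEdge K t x 0 (c x - 1) 0 c)).distanceSpectralRadius := by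
  obtain ⟨φ, s, h⟩ := exists_isPerron (ℓ := ℓ) (c := c) hK (by omega)
  set ρ := (starredPath (K + 1) ℓ c).distanceSpectralRadius
  set c' := insertEdge K t x 0 (c x - 1) 0 c with hc'
  -- all old vertices keep their values in the new caterpillar
  set φ' := insertEdge K t x (s x) (φ x) (s x) φ with hφ'
  set s' := insertEdge K t x 0 (s x) 0 s with hs'
  set W := mass K c φ s with hW
  have hcast : ((c x - 1 : ℕ) : ℝ) = c x - 1 := by
    rw [Nat.cast_sub hc, Nat.cast_one]
  have hpt : ∀ (F : ℕ → ℝ → ℝ → ℝ) (z : ℕ), F (c' z) (φ' z) (s' z) =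
      insertEdge K t x (F 0 (s x) 0) (F (c x - 1 : ℕ) (φ x) (s x)) (F 0 (s x) 0)
        (fun z => F (c z) (φ z) (s z)) z := by
    intro F z
    simp only [hc', hφ', hs', insertEdge]
    split_ifs <;> rfl
  set W' := mass K c' φ' s' with hW'
  have hWins : W' = insertEdge K t x (s x) (W x - K * s x) (s x) W := by
    ext z
    have := hpt (fun a b d => b + a * K * d) z
    simp only [hW', hW, mass]
    refine this.trans ?_
    congr 1
    · simp
    · rw [hcast]
      ring
    · simp
  have hKcast : ((K - 1 : ℕ) : ℝ) = K - 1 := by rw [Nat.cast_sub hK, Nat.cast_one]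
  have htℓ : t < ℓ := by omega
  have hsumF : ∀ F : ℕ → ℝ → ℝ → ℝ, ∑ z ∈ range ((ℓ + 1) * K + 1), F (c' z) (φ' z) (s' z) =
      ∑ z ∈ range (ℓ * K + 1), F (c z) (φ z) (s z) + F 0 (s x) 0 + F (c x - 1 : ℕ) (φ x) (s x) +
        (K - 1) * F 0 (s x) 0 - F (c x) (φ x) (s x) := by
    intro F
    simp only [hpt F]
    rw [eq_sub_iff_add_eq, ← hKcast, ← nsmul_eq_mul]
    exact sum_insertEdge htℓ hx'
  have hS : total K (ℓ + 1) W' = total K ℓ W := by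
    have := hsumF fun a b d => b + a * K * d
    simp only [hcast] at this
    refine this.trans ?_
    simp only [hW, mass, total]
    push_cast
    ring
  have hQ : leafTotal K (ℓ + 1) c' s' = leafTotal K ℓ c s - K * s x := by
    have := hsumF fun a _ d => a * K * d
    simp only [hcast] at this
    refine this.trans ?_
    simp only [leafTotal]
    push_cast
    ring
  have hsq : ∑ z ∈ range ((ℓ + 1) * K + 1), (c' z : ℝ) * s' z ^ 2 =
      ∑ z ∈ range (ℓ * K + 1), (c z : ℝ) * s z ^ 2 - s x ^ 2 := by
    have := hsumF fun a _ d => a * d ^ 2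
    simp only [hcast] at this
    refine this.trans ?_
    push_cast
    ring
  have hsqφ : ∑ z ∈ range ((ℓ + 1) * K + 1), φ' z ^ 2 =
      ∑ z ∈ range (ℓ * K + 1), φ z ^ 2 + K * s x ^ 2 := by
    have := hsumF fun _ b _ => b ^ 2
    refine this.trans ?_
    ring
  have hnorm : sqNorm K (ℓ + 1) c' φ' s' = sqNorm K ℓ c φ s := by
    unfold sqNorm
    rw [hsq, hsqφ]
    ring
  have hu : (t + 1) * K = t * K + K := by ring
  have hu2 : (t + 1 + 1) * K = (t + 1) * K + K := by ring
  have hN : (ℓ + 1) * K + 1 = ℓ * K + 1 + K := by ring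
  -- prefix sums to the left of `x` and suffix sums to the right of the edge `t` are unchanged
  have hpre : ∀ z < (t + 1) * K, z ≠ x → W' z = W z := fun z hz hzx => by
    rw [hWins, insertEdge_of_lt hz hzx]
  have hprefix : ∀ j ≤ t, ∑ y ∈ range (j * K + 1), W' y = ∑ y ∈ range (j * K + 1), W y := by
    intro j hj
    have h1 : j * K ≤ t * K := Nat.mul_le_mul_right _ hj
    exact sum_congr rfl fun y hy => by
      rw [mem_range] at hy
      exact hpre y (by omega) (by omega)
  have hsuffix : ∀ j, t + 1 ≤ j → ∑ y ∈ Ico ((j + 1) * K) ((ℓ + 1) * K + 1), W' y =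
      ∑ y ∈ Ico (j * K) (ℓ * K + 1), W y := by
    intro j hj
    have h1 : (t + 1) * K ≤ j * K := Nat.mul_le_mul_right _ hj
    rw [hN, show (j + 1) * K = j * K + K by ring, hWins]
    exact sum_insertEdge_Ico hx' h1
  have hmidl : ∀ G : ℝ → ℝ, ∀ j < t,
      ∑ y ∈ Ioo (j * K) ((j + 1) * K), G (W' y) = ∑ y ∈ Ioo (j * K) ((j + 1) * K), G (W y) := by
    intro G j hj
    have h1 : (j + 1) * K ≤ t * K := Nat.mul_le_mul_right _ hj
    exact sum_congr rfl fun y hy => by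
      rw [mem_Ioo] at hy
      rw [hpre y (by omega) (by omega)]
  have hmidr : ∀ G : ℝ → ℝ, ∀ j, t < j →
      ∑ y ∈ Ioo ((j + 1) * K) ((j + 1 + 1) * K), G (W' y) =
        ∑ y ∈ Ioo (j * K) ((j + 1) * K), G (W y) := by
    intro G j hj
    have h1 : (t + 1) * K ≤ j * K := Nat.mul_le_mul_right _ hj
    have h2 : ∀ n, Ioo (n * K) ((n + 1) * K) = Ico (n * K + 1) ((n + 1) * K) := by
      intro n
      ext y
      simp only [mem_Ioo, mem_Ico]
      omega
    rw [h2, h2, show (j + 1) * K + 1 = j * K + 1 + K by ring,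
      show (j + 1 + 1) * K = (j + 1) * K + K by ring, ← sum_Ico_add']
    refine sum_congr rfl fun y hy => ?_
    rw [mem_Ico] at hy
    rw [hWins, insertEdge_add hx' (by omega)]
  set S := total K ℓ W with hSdef
  have hform := sum_insert_term (ℓ := ℓ)
    (F := fun j => S ^ 2 - ∑ z ∈ Icc (j * K) ((j + 1) * K), branchMass K ℓ W j z ^ 2)
    (F' := fun j => S ^ 2 - ∑ z ∈ Icc (j * K) ((j + 1) * K), branchMass K (ℓ + 1) W' j z ^ 2)
    htℓ (by
      intro j hj
      rw [sum_branchMass_sq hK (show j < ℓ by omega), sum_branchMass_sq hK (show j < ℓ + 1 by omega),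
        hprefix j hj.le, hmidl (fun w => w ^ 2) j hj]
      have e1 := branchMass_left_add (W := W) hK (show j < ℓ by omega)
      have e2 := branchMass_left_add (W := W') hK (show j < ℓ + 1 by omega)
      rw [hS, hprefix j hj.le, hmidl (fun w => w) j hj, hSdef, ← e1] at e2
      rw [add_left_cancel e2]) (by
      intro j hj hjℓ
      rw [sum_branchMass_sq hK hjℓ, sum_branchMass_sq hK (show j + 1 < ℓ + 1 by omega),
        hsuffix (j + 1) (by omega), hmidr (fun w => w ^ 2) j hj]
      have e1 := branchMass_left_add (W := W) hK hjℓ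
      have e2 := branchMass_left_add (W := W') hK (show j + 1 < ℓ + 1 by omega)
      rw [hS, hsuffix (j + 1) (by omega), hmidr (fun w => w) j hj, hSdef, ← e1] at e2
      have e3 := add_right_cancel (add_right_cancel e2)
      rw [e3])
  have hform' : distForm K (ℓ + 1) W' = ∑ j ∈ range (ℓ + 1),
      (S ^ 2 - ∑ z ∈ Icc (j * K) ((j + 1) * K), branchMass K (ℓ + 1) W' j z ^ 2) := by
    rw [distForm_eq_sum hK, hS]
  rw [← distForm_eq_sum hK, ← hform', sum_branchMass_sq hK htℓ,
    sum_branchMass_sq hK (show t < ℓ + 1 by omega),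
    sum_branchMass_sq hK (show t + 1 < ℓ + 1 by omega), hprefix t le_rfl,
    hsuffix (t + 1) le_rfl] at hform
  set L := ∑ y ∈ range (t * K + 1), W y with hL
  set R := ∑ y ∈ Ico ((t + 1) * K) (ℓ * K + 1), W y with hR
  have hxmem : x ∈ Ioo (t * K) ((t + 1) * K) := mem_Ioo.2 ⟨hx, hx'⟩
  set O := ∑ y ∈ (Ioo (t * K) ((t + 1) * K)).erase x, W y with hO
  set O2 := ∑ y ∈ (Ioo (t * K) ((t + 1) * K)).erase x, W y ^ 2 with hO2
  have herase : ∀ G : ℝ → ℝ, ∑ y ∈ Ioo (t * K) ((t + 1) * K), G (W' y) =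
      G (s x) + ∑ y ∈ (Ioo (t * K) ((t + 1) * K)).erase x, G (W y) := by
    intro G
    rw [← add_sum_erase _ _ hxmem]
    congr 1
    · rw [hWins, insertEdge_self]
    · refine sum_congr rfl fun y hy => ?_
      rw [hpre y (mem_Ioo.1 (mem_of_mem_erase hy)).2 (ne_of_mem_erase hy)]
  have hmid2 : ∀ G : ℝ → ℝ, ∑ y ∈ Ioo ((t + 1) * K) ((t + 1 + 1) * K), G (W' y) =
      (K - 1) * G (s x) := by
    intro G
    rw [sum_congr rfl fun y hy => by
      rw [hWins, insertEdge_mid hx' (mem_Ioo.1 hy).1 (mem_Ioo.1 hy).2]]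
    rw [sum_const, Nat.card_Ioo, nsmul_eq_mul, ← hKcast, show (t + 1 + 1) * K - (t + 1) * K - 1 =
      K - 1 by omega]
  have f1 := branchMass_left_add (W := W) hK htℓ
  have f2 := branchMass_left_add (W := W') hK (show t < ℓ + 1 by omega)
  have f3 := branchMass_left_add (W := W') hK (show t + 1 < ℓ + 1 by omega)
  rw [hS, hprefix t le_rfl, herase fun w => w, ← hL, ← hO] at f2
  rw [hS, hsuffix (t + 1) le_rfl, hmid2 fun w => w, ← hR] at f3
  rw [← add_sum_erase _ _ hxmem, ← hO, ← hL, ← hR, ← hSdef] at f1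
  rw [← add_sum_erase _ (fun y => W y ^ 2) hxmem, ← hO2, herase fun w => w ^ 2, ← hO2,
    hmid2 fun w => w ^ 2] at hform
  set A := ∑ y ∈ Ico ((t + 1) * K) ((ℓ + 1) * K + 1), W' y
  set B := ∑ y ∈ range ((t + 1) * K + 1), W' y
  have hA : A = S - L - s x - O := by linarith
  have hB : B = S - R - (K - 1) * s x := by linarith
  have hSL : S = L + (W x + O) + R := f1.symm
  have hgain : energy K (ℓ + 1) c' φ' s' =
      energy K ℓ c φ s + 2 * (R - s x) * (L + O - (K - 1) * s x) := by
    unfold energy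
    rw [← hW', ← hW, hS, ← hSdef, hQ, hsq]
    rw [hA, hB] at hform
    rw [eq_sub_of_add_eq hform]
    rw [hSL]
    ring
  have hs := h.leaf_pos x (by have := Nat.mul_le_mul_right K (show t + 1 ≤ ℓ from htℓ); omega)
  have hR1 := h.lt_sum_right hK ht' hx hx' hc
  have hL1 := h.lt_sum_left hK ht htℓ hx hx' hc
  rw [← hW, ← hR] at hR1
  rw [← hW, ← hL] at hL1
  have hO0 : 0 ≤ O := sum_nonneg fun y hy => by
    have h1 := (mem_Ioo.1 (mem_of_mem_erase hy)).2
    have h2 : (t + 1) * K ≤ ℓ * K := Nat.mul_le_mul_right K (show t + 1 ≤ ℓ from htℓ)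
    exact (h.mass_pos (by omega)).le
  have hK2 : (2 : ℝ) ≤ K := by
    have : 2 ≤ K := by omega
    exact_mod_cast this
  have hRs : 0 < R - s x := by nlinarith
  have hLO : 0 < L + O - (K - 1) * s x := by linarith
  have hle := energy_le (ℓ := ℓ + 1) (c := c') hK φ' s'
  rw [hgain, hnorm, h.energy_eq] at hle
  have hpos := mul_pos (mul_pos two_pos hRs) hLO
  exact lt_of_mul_lt_mul_right (by linarith) h.sqNorm_pos.le

end

end Hypergraph

/-! ### The antisymmetric resolvent on a symmetric path -/

namespace Hypergraph

open Finset

variable {K ℓ : ℕ}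

theorem sum_mul_potential_comm (A B : ℕ → ℝ) :
    ∑ x ∈ range (ℓ * K + 1), A x * potential K ℓ B x =
      ∑ x ∈ range (ℓ * K + 1), B x * potential K ℓ A x := by
  unfold potential
  simp only [mul_sum]
  rw [sum_comm]
  refine sum_congr rfl fun x _ => sum_congr rfl fun y _ => ?_
  rw [baseDist_comm]
  ring

theorem potential_congr {A B : ℕ → ℝ} (h : ∀ y ≤ ℓ * K, A y = B y) (x : ℕ) :
    potential K ℓ A x = potential K ℓ B x :=
  sum_congr rfl fun y hy => by rw [h y (Nat.lt_succ_iff.1 (mem_range.1 hy))]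

theorem potential_add (A B : ℕ → ℝ) (x : ℕ) :
    potential K ℓ (fun y => A y + B y) x = potential K ℓ A x + potential K ℓ B x := by
  unfold potential
  simp only [mul_add, sum_add_distrib]

theorem potential_smul (a : ℝ) (A : ℕ → ℝ) (x : ℕ) :
    potential K ℓ (fun y => a * A y) x = a * potential K ℓ A x := by
  unfold potential
  rw [mul_sum]
  exact sum_congr rfl fun y _ => by ring

theorem potential_neg (A : ℕ → ℝ) (x : ℕ) :
    potential K ℓ (fun y => -A y) x = -potential K ℓ A x := by
  unfold potential
  rw [← sum_neg_distrib]
  exact sum_congr rfl fun y _ => by ring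

theorem potential_ite {q : ℕ} (hq : q ≤ ℓ * K) (P : ℝ) (x : ℕ) :
    potential K ℓ (fun y => if y = q then P else 0) x = P * baseDist K x q := by
  unfold potential
  simp only [mul_ite, mul_zero, sum_ite_eq', mem_range, Nat.lt_succ_iff, hq, if_true]
  ring

/-- A function that is antisymmetric under the reflection of the path has total zero. -/
theorem total_eq_zero_of_odd {A : ℕ → ℝ} (h : ∀ x ≤ ℓ * K, A (ℓ * K - x) = -A x) :
    total K ℓ A = 0 := by
  have h1 : total K ℓ A = -total K ℓ A := by
    conv_lhs => unfold total
    rw [← sum_reflect]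
    unfold total
    rw [← sum_neg_distrib]
    exact sum_congr rfl fun x hx => h x (Nat.lt_succ_iff.1 (mem_range.1 hx))
  linarith

theorem potential_odd (hK : 1 ≤ K) {A : ℕ → ℝ} (h : ∀ x ≤ ℓ * K, A (ℓ * K - x) = -A x) {x : ℕ}
    (hx : x ≤ ℓ * K) : potential K ℓ A (ℓ * K - x) = -potential K ℓ A x := by
  rw [← potential_reflect hK A hx, ← potential_neg]
  exact potential_congr h x

/-- The linear system `ρ ζ = D (g ζ) + d(·, N) - d(·, 0)` has a solution that is antisymmetric under
the reflection of the path `[0, N]`: restricted to antisymmetric vectors, the distance form is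
negative semidefinite, so that the system is uniquely solvable. -/
theorem exists_odd_solution (hK : 1 ≤ K) {ρ : ℝ} (hρ : 0 < ρ) {g : ℕ → ℝ} (hg : ∀ x, 1 ≤ g x)
    (hgsymm : ∀ x ≤ ℓ * K, g (ℓ * K - x) = g x) :
    ∃ ζ : ℕ → ℝ, (∀ x ≤ ℓ * K, ζ (ℓ * K - x) = -ζ x) ∧
      ∀ x ≤ ℓ * K, ρ * ζ x =
        potential K ℓ (fun y => g y * ζ y) x + baseDist K x (ℓ * K) - baseDist K x 0 := by
  set N := ℓ * K with hN
  let ext : (Fin (N + 1) → ℝ) → ℕ → ℝ := fun w x =>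
    if h : x ≤ N then w ⟨x, Nat.lt_succ_of_le h⟩ else 0
  have hext : ∀ (w : Fin (N + 1) → ℝ) (i : Fin (N + 1)), ext w i = w i := fun w i =>
    dif_pos (Nat.le_of_lt_succ i.2)
  let odd : (Fin (N + 1) → ℝ) → ℕ → ℝ := fun w x => g x * ((ext w x - ext w (N - x)) / 2)
  let A : (Fin (N + 1) → ℝ) →ₗ[ℝ] (Fin (N + 1) → ℝ) :=
    { toFun := fun w i => ρ * w i - potential K ℓ (odd w) i
      map_add' := by
        intro v w
        ext i
        have h : ∀ x, odd (v + w) x = odd v x + odd w x := by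
          intro x
          have : ∀ x, ext (v + w) x = ext v x + ext w x := by
            intro x
            by_cases h : x ≤ N <;> simp [ext, h]
          simp only [odd, this]
          ring
        simp only [Pi.add_apply]
        rw [show odd (v + w) = fun x => odd v x + odd w x from funext h, potential_add]
        ring
      map_smul' := by
        intro a w
        ext i
        have h : ∀ x, odd (a • w) x = a * odd w x := by
          intro x
          have : ∀ x, ext (a • w) x = a * ext w x := by
            intro x
            by_cases h : x ≤ N <;> simp [ext, h]
          simp only [odd, this]
          ring
        simp only [Pi.smul_apply, smul_eq_mul, RingHom.id_apply]
        rw [show odd (a • w) = fun x => a * odd w x from funext h, potential_smul]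
        ring }
  have hodd : ∀ w, ∀ x ≤ N, odd w (N - x) = -odd w x := by
    intro w x hx
    simp only [odd]
    rw [hgsymm x hx, Nat.sub_sub_self hx]
    ring
  -- a solution of the system with an antisymmetric right-hand side is antisymmetric itself
  have key : ∀ (w : Fin (N + 1) → ℝ) (b : ℕ → ℝ), (∀ x ≤ N, b (N - x) = -b x) →
      (∀ i, A w i = b i) → (∀ x ≤ N, ext w (N - x) = -ext w x) ∧
        ∀ x ≤ N, ρ * ext w x = potential K ℓ (fun y => g y * ext w y) x + b x := by
    intro w b hb h
    have h1 : ∀ x ≤ N, ρ * ext w x = potential K ℓ (odd w) x + b x := by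
      intro x hx
      have h2 : ρ * w ⟨x, by omega⟩ - potential K ℓ (odd w) x = b x := h ⟨x, by omega⟩
      have h3 : ext w x = w ⟨x, by omega⟩ := hext w ⟨x, by omega⟩
      rw [h3]
      linarith
    have h2 : ∀ x ≤ N, ext w (N - x) = -ext w x := by
      intro x hx
      have h3 := h1 (N - x) (Nat.sub_le _ _)
      rw [potential_odd hK (hodd w) hx, hb x hx] at h3
      have h4 := h1 x hx
      exact mul_left_cancel₀ hρ.ne' (by linarith)
    refine ⟨h2, fun x hx => ?_⟩
    rw [h1 x hx]
    congr 1
    refine potential_congr (fun y hy => ?_) x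
    simp only [odd]
    rw [h2 y hy]
    ring
  have hinj : Function.Injective A := by
    rw [injective_iff_map_eq_zero]
    intro w hw
    obtain ⟨h1, h2⟩ := key w (fun _ => 0) (fun _ _ => by simp) (fun i => by rw [hw]; rfl)
    have h3 : total K ℓ (fun y => g y * ext w y) = 0 := total_eq_zero_of_odd fun x hx => by
      rw [hgsymm x hx, h1 x hx]
      ring
    have h4 := distForm_nonpos hK h3
    have h5 : distForm K ℓ (fun y => g y * ext w y) =
        ∑ x ∈ range (N + 1), ρ * (g x * ext w x ^ 2) := by
      refine sum_congr rfl fun x hx => ?_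
      have := h2 x (Nat.lt_succ_iff.1 (mem_range.1 hx))
      rw [add_zero] at this
      rw [← this]
      ring
    have h6 : ∀ x ∈ range (N + 1), 0 ≤ ρ * (g x * ext w x ^ 2) := fun x _ =>
      mul_nonneg hρ.le (mul_nonneg (zero_le_one.trans (hg x)) (sq_nonneg _))
    rw [h5] at h4
    have h7 := (sum_eq_zero_iff_of_nonneg h6).1 (le_antisymm h4 (sum_nonneg h6))
    ext i
    have h8 := h7 i (mem_range.2 i.2)
    rw [hext] at h8
    have h9 : g i ≠ 0 := (zero_lt_one.trans_le (hg i)).ne'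
    simpa [hρ.ne', h9] using h8
  obtain ⟨w, hw⟩ := LinearMap.surjective_of_injective hinj
    (fun i : Fin (N + 1) => (baseDist K i N : ℝ) - baseDist K i 0)
  obtain ⟨h1, h2⟩ := key w (fun x => (baseDist K x N : ℝ) - baseDist K x 0) (by
    intro x hx
    have e1 : baseDist K (N - x) N = baseDist K x 0 := by
      have := baseDist_reflect hK hx (Nat.zero_le (ℓ * K))
      rwa [Nat.sub_zero] at this
    have e2 : baseDist K (N - x) 0 = baseDist K x N := by
      have := baseDist_reflect hK hx (le_refl (ℓ * K))
      rwa [Nat.sub_self] at this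
    simp only [e1, e2]
    ring) (fun i => by rw [hw])
  exact ⟨ext w, h1, fun x hx => by rw [h2 x hx]; ring⟩

/-- If `ρ ζ` is the potential of a charge `ν` of total zero which is a nonnegative multiple of `ζ`
inside the path, then nonnegativity of `ζ` at `u_t` and of the charge up to `u_t` propagates to
`u_{t+1}`. -/
theorem propagate (hK : 1 ≤ K) {ρ : ℝ} (hρ : 0 < ρ) {g ζ ν : ℕ → ℝ}
    (hg1 : ∀ t < ℓ, ∀ x, t * K < x → x < (t + 1) * K → g x = 1)
    (hν : ∀ x, 0 < x → x < ℓ * K → ν x = g x * ζ x) (htot : total K ℓ ν = 0)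
    (heq : ∀ x ≤ ℓ * K, ρ * ζ x = potential K ℓ ν x) {t : ℕ} (ht : t < ℓ)
    (h1 : 0 ≤ ζ (t * K)) (h2 : 0 ≤ ∑ y ∈ range (t * K + 1), ν y) :
    0 ≤ ζ ((t + 1) * K) ∧
      ∑ y ∈ range (t * K + 1), ν y ≤ ∑ y ∈ range ((t + 1) * K), ν y ∧
      (0 < ∑ y ∈ range (t * K + 1), ν y → 0 < ζ ((t + 1) * K)) := by
  have hu : (t + 1) * K = t * K + K := by ring
  have hN : (t + 1) * K ≤ ℓ * K := Nat.mul_le_mul_right K (show t + 1 ≤ ℓ from ht)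
  set Λ := ∑ y ∈ range (t * K + 1), ν y with hΛ
  have hmid : ∀ x ∈ Ioo (t * K) ((t + 1) * K), 0 ≤ ν x := by
    intro x hx
    rw [mem_Ioo] at hx
    have e1 := potential_sub_potential (ℓ := ℓ) (t := t) hK ν hx.1.le hx.2.le le_rfl (by omega)
    rw [branchMass_left hK ht, branchMass_of_mem ht hx.1 hx.2, ← heq x (by omega),
      ← heq (t * K) (by omega), hν x (by omega) (by omega), hg1 t ht x hx.1 hx.2, one_mul,
      ← hΛ] at e1
    rw [hν x (by omega) (by omega), hg1 t ht x hx.1 hx.2, one_mul]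
    have e2 : (ρ + 1) * ζ x = ρ * ζ (t * K) + Λ := by linarith
    have e3 : 0 ≤ (ρ + 1) * ζ x := by
      rw [e2]
      positivity
    exact nonneg_of_mul_nonneg_right e3 (by positivity)
  have hmids := sum_nonneg hmid
  have e1 := potential_sub_potential (ℓ := ℓ) (t := t) hK ν (show t * K ≤ (t + 1) * K by omega)
    le_rfl le_rfl (show t * K ≤ (t + 1) * K by omega)
  rw [branchMass_left hK ht, branchMass_right hK, ← heq _ hN, ← heq (t * K) (by omega), ← hΛ] at e1
  have e2 := branchMass_left_add (W := ν) hK ht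
  rw [htot, ← hΛ] at e2
  have e3 : ρ * ζ ((t + 1) * K) =
      ρ * ζ (t * K) + 2 * Λ + ∑ y ∈ Ioo (t * K) ((t + 1) * K), ν y := by linarith
  have e4 : 0 ≤ ρ * ζ (t * K) := by positivity
  refine ⟨nonneg_of_mul_nonneg_right (by rw [e3]; positivity) hρ, ?_, fun h3 => ?_⟩
  · rw [← sum_range_add_sum_Ico ν (show t * K + 1 ≤ (t + 1) * K by omega), ← hΛ]
    have e5 : Ico (t * K + 1) ((t + 1) * K) = Ioo (t * K) ((t + 1) * K) := by
      ext y
      simp only [mem_Ioo, mem_Ico]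
      omega
    rw [e5]
    linarith
  · exact pos_of_mul_pos_right (by rw [e3]; positivity) hρ.le

theorem propagate_iterate (hK : 1 ≤ K) {ρ : ℝ} (hρ : 0 < ρ) {g ζ ν : ℕ → ℝ}
    (hg : ∀ x, 1 ≤ g x) (hg1 : ∀ t < ℓ, ∀ x, t * K < x → x < (t + 1) * K → g x = 1)
    (hν : ∀ x, 0 < x → x < ℓ * K → ν x = g x * ζ x) (htot : total K ℓ ν = 0)
    (heq : ∀ x ≤ ℓ * K, ρ * ζ x = potential K ℓ ν x) {t : ℕ}
    (h1 : 0 ≤ ζ (t * K)) (h2 : 0 ≤ ∑ y ∈ range (t * K + 1), ν y) (d : ℕ) (hd : t + d < ℓ) :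
    0 ≤ ζ ((t + d) * K) ∧
      ∑ y ∈ range (t * K + 1), ν y ≤ ∑ y ∈ range ((t + d) * K + 1), ν y ∧
      (0 < d → 0 < ∑ y ∈ range (t * K + 1), ν y → 0 < ζ ((t + d) * K)) := by
  induction d with
  | zero => exact ⟨h1, le_rfl, fun h => absurd h (lt_irrefl 0)⟩
  | succ d ih =>
    obtain ⟨i1, i2, -⟩ := ih (by omega)
    obtain ⟨j1, j2, j3⟩ := propagate hK hρ hg1 hν htot heq (t := t + d) (by omega) i1 (h2.trans i2)
    have hlt : (t + d + 1) * K < ℓ * K := Nat.mul_lt_mul_of_pos_right hd hK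
    have hpos : 0 < (t + d + 1) * K := by positivity
    refine ⟨j1, ?_, fun _ h => j3 (h.trans_le i2)⟩
    rw [show t + (d + 1) = t + d + 1 from rfl, sum_range_succ _ ((t + d + 1) * K),
      hν _ hpos hlt]
    have := mul_nonneg (zero_le_one.trans (hg ((t + d + 1) * K))) j1
    linarith

/-- The antisymmetric solution is positive at the vertices `iK` of the first half of the path. Up to
the factor `ρ` it is the potential of the charge `g ζ` with an additional `-1` at `0` and `1` at the
other end. If `ζ` were not positive at `iK`, signs would propagate along the path in contradiction to
the antisymmetry or to the positive charge at the far end. -/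
theorem exists_odd_solution_pos (hK : 1 ≤ K) {ρ : ℝ} (hρ : 0 < ρ) {g : ℕ → ℝ} (hg : ∀ x, 1 ≤ g x)
    (hgsymm : ∀ x ≤ ℓ * K, g (ℓ * K - x) = g x)
    (hg1 : ∀ t < ℓ, ∀ x, t * K < x → x < (t + 1) * K → g x = 1) {i : ℕ} (hi : 1 ≤ i)
    (hiℓ : 2 * i < ℓ) :
    ∃ ζ : ℕ → ℝ, (∀ x ≤ ℓ * K, ζ (ℓ * K - x) = -ζ x) ∧
      (∀ x ≤ ℓ * K, ρ * ζ x =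
        potential K ℓ (fun y => g y * ζ y) x + baseDist K x (ℓ * K) - baseDist K x 0) ∧
      0 < ζ (i * K) := by
  obtain ⟨ζ, hodd, heq⟩ := exists_odd_solution hK hρ hg hgsymm
  refine ⟨ζ, hodd, heq, ?_⟩
  set N := ℓ * K with hN
  have hNpos : 0 < N := Nat.mul_pos (by omega) hK
  set ν : ℕ → ℝ := fun y => g y * ζ y + ((if y = N then 1 else 0) + (if y = 0 then -1 else 0))
    with hνdef
  have hνodd : ∀ x ≤ N, ν (N - x) = -ν x := by
    intro x hx
    simp only [hνdef]
    rw [hgsymm x hx, hodd x hx]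
    have h1 : N - x = N ↔ x = 0 := by omega
    have h2 : N - x = 0 ↔ x = N := by omega
    simp only [h1, h2]
    split_ifs <;> ring
  have htot : total K ℓ ν = 0 := total_eq_zero_of_odd hνodd
  have hν : ∀ x, 0 < x → x < N → ν x = g x * ζ x := by
    intro x hx hx'
    simp [hνdef, hx.ne', hx'.ne]
  have heq' : ∀ x ≤ N, ρ * ζ x = potential K ℓ ν x := by
    intro x hx
    rw [heq x hx, hνdef, potential_add, potential_add, potential_ite le_rfl,
      potential_ite (Nat.zero_le _)]
    ring
  have hiN : i * K < N := Nat.mul_lt_mul_of_pos_right (by omega) hK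
  have hpN : (ℓ - i) * K = N - i * K := Nat.sub_mul _ _ _
  have hipos : 0 < i * K := by positivity
  have hpζ : ζ ((ℓ - i) * K) = -ζ (i * K) := by rw [hpN, hodd _ hiN.le]
  by_contra hcon
  rw [not_lt] at hcon
  rcases lt_or_ge (∑ y ∈ range (i * K + 1), ν y) 0 with hΛ | hΛ
  -- negative charge up to `iK`: then `ζ` is negative at the mirror image of `iK`, too
  · have := (propagate_iterate (ζ := fun x => -ζ x) (ν := fun x => -ν x) (g := g) hK hρ hg hg1
      (fun x h1 h2 => by rw [hν x h1 h2]; ring)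
      (by unfold total at htot ⊢; rw [sum_neg_distrib, htot, neg_zero])
      (fun x hx => by rw [potential_neg, ← heq' x hx]; ring) (t := i) (by linarith)
      (by rw [sum_neg_distrib]; linarith) (ℓ - i - i) (by omega)).2.2 (by omega)
      (by rw [sum_neg_distrib]; linarith)
    rw [show i + (ℓ - i - i) = ℓ - i by omega, hpζ] at this
    linarith
  -- otherwise `ζ` is nonnegative from the mirror image of `iK` on, and the total charge is positive
  · have hp : 0 ≤ ∑ y ∈ range ((ℓ - i) * K + 1), ν y := by
      have e1 : ∑ y ∈ range ((ℓ - i) * K + 1), ν y + ∑ y ∈ Ico ((ℓ - i) * K + 1) (N + 1), ν y = 0 := by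
        rw [sum_range_add_sum_Ico _ (by omega)]
        exact htot
      have e2 := sum_Ico_reflect ν ((ℓ - i) * K + 1) (m := N + 1) (n := N) le_rfl
      rw [show N + 1 - (N + 1) = 0 by omega, show N + 1 - ((ℓ - i) * K + 1) = i * K by omega,
        Nat.Ico_zero_eq_range, sum_congr rfl fun y hy => hνodd y (by rw [mem_Ico] at hy; omega),
        sum_neg_distrib] at e2
      rw [sum_range_succ, hν _ hipos hiN] at hΛ
      have e3 : g (i * K) * ζ (i * K) ≤ 0 :=
        mul_nonpos_of_nonneg_of_nonpos (zero_le_one.trans (hg _)) hcon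
      linarith
    obtain ⟨j1, j2, -⟩ := propagate_iterate hK hρ hg hg1 hν htot heq' (t := ℓ - i)
      (by rw [hpζ]; linarith) hp (i - 1) (by omega)
    rw [show ℓ - i + (i - 1) = ℓ - 1 by omega] at j1 j2
    obtain ⟨k1, k2, -⟩ := propagate hK hρ hg1 hν htot heq' (t := ℓ - 1) (by omega) j1 (hp.trans j2)
    rw [show ℓ - 1 + 1 = ℓ by omega] at k1 k2
    have e4 : ∑ y ∈ range N, ν y + ν N = 0 := by
      rw [← sum_range_succ]
      exact htot
    have e5 : ν N = g N * ζ N + 1 := by simp [hνdef, hNpos.ne']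
    have e6 := mul_nonneg (zero_le_one.trans (hg N)) k1
    linarith

end Hypergraph

/-! ### Balancing: comparison of two transfers related by a reflection of a part of the path -/

namespace Hypergraph

open Finset

variable {K ℓ : ℕ} {c : ℕ → ℕ}

theorem sum_range_ite_le {N₀ N : ℕ} (h : N₀ ≤ N) (A : ℕ → ℝ) :
    ∑ x ∈ range (N + 1), (if x ≤ N₀ then A x else 0) = ∑ x ∈ range (N₀ + 1), A x := by
  rw [← sum_filter]
  refine sum_congr ?_ fun _ _ => rfl
  ext x
  rw [mem_filter]
  simp only [mem_range]
  omega

/-- A vertex between two others lies on the path joining them. -/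
theorem baseDist_add_baseDist (hK : 1 ≤ K) {t x y : ℕ} (hx : x ≤ t * K) (hy : t * K ≤ y) :
    baseDist K x y = baseDist K x (t * K) + baseDist K (t * K) y := by
  have hy' : y ≤ y * K := Nat.le_mul_of_pos_right _ hK
  rw [baseDist_eq_sum (L := y) hK (by omega) hy', baseDist_eq_sum (L := y) hK (by omega) (by omega),
    baseDist_eq_sum (L := y) hK (by omega) hy', ← sum_add_distrib]
  refine sum_congr rfl fun j _ => ?_
  rcases Nat.lt_or_ge j t with h | h
  · have h1 : (j + 1) * K ≤ t * K := Nat.mul_le_mul_right _ h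
    rw [edgeProj_of_ge h1, edgeProj_of_ge (h1.trans hy)]
    simp
  · have h1 : t * K ≤ j * K := Nat.mul_le_mul_right _ h
    rw [edgeProj_of_le h1, edgeProj_of_le (hx.trans h1)]
    simp

/-- The distance form for a weight that consists of a part `A` on the initial segment `[0, mK]`, a
part `ξ` on the rest, attached to the segment at its end `mK`, and a weight `P` at the vertex `q` of
the segment. -/
theorem distForm_split (hK : 1 ≤ K) {m q : ℕ} (hm : m ≤ ℓ) (hq : q ≤ m * K) (A ξ : ℕ → ℝ)
    (hξ : ∀ x < m * K, ξ x = 0) (P : ℝ) :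
    distForm K ℓ (fun x => (if x ≤ m * K then A x else 0) + (ξ x + if x = q then P else 0)) =
      distForm K m A + distForm K ℓ ξ +
        2 * (total K ℓ ξ * potential K m A (m * K) +
          total K m A * potential K ℓ ξ (m * K)) + 2 * P * potential K m A q +
        2 * P * (total K ℓ ξ * baseDist K q (m * K) + potential K ℓ ξ (m * K)) := by
  have hmN : m * K ≤ ℓ * K := Nat.mul_le_mul_right _ hm
  have hqN : q ∈ range (ℓ * K + 1) := mem_range.2 (by omega)
  have hpA : ∀ x, potential K ℓ (fun y => if y ≤ m * K then A y else 0) x = potential K m A x := by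
    intro x
    unfold potential
    simp only [mul_ite, mul_zero]
    exact sum_range_ite_le hmN fun y => (baseDist K x y : ℝ) * A y
  have hpξ : ∀ x ≤ m * K, potential K ℓ ξ x =
      total K ℓ ξ * baseDist K x (m * K) + potential K ℓ ξ (m * K) := by
    intro x hx
    unfold potential total
    rw [sum_mul, ← sum_add_distrib]
    refine sum_congr rfl fun y _ => ?_
    rcases Nat.lt_or_ge y (m * K) with hy | hy
    · rw [hξ y hy]
      ring
    · rw [baseDist_add_baseDist hK hx hy]
      push_cast
      ring
  have hAξ : ∑ x ∈ range (ℓ * K + 1), (if x ≤ m * K then A x else 0) * potential K ℓ ξ x =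
      total K ℓ ξ * potential K m A (m * K) + total K m A * potential K ℓ ξ (m * K) := by
    simp only [ite_mul, zero_mul]
    rw [sum_range_ite_le hmN, sum_congr rfl fun x hx => by
      rw [hpξ x (Nat.lt_succ_iff.1 (mem_range.1 hx))]]
    simp only [mul_add, sum_add_distrib]
    congr 1
    · unfold potential
      rw [mul_sum]
      refine sum_congr rfl fun x _ => ?_
      rw [baseDist_comm]
      ring
    · unfold total
      rw [sum_mul]
  have hAA : ∑ x ∈ range (ℓ * K + 1), (if x ≤ m * K then A x else 0) * potential K m A x =
      distForm K m A := by
    simp only [ite_mul, zero_mul]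
    exact sum_range_ite_le hmN _
  have hPB : ∀ B : ℕ → ℝ, ∑ x ∈ range (ℓ * K + 1), (if x = q then P else 0) * B x = P * B q := by
    intro B
    simp only [ite_mul, zero_mul, sum_ite_eq', hqN, if_true]
  have hBP : ∀ B : ℕ → ℝ, ∑ x ∈ range (ℓ * K + 1),
      B x * potential K ℓ (fun y => if y = q then P else 0) x = P * potential K ℓ B q := by
    intro B
    rw [sum_mul_potential_comm, hPB]
  have hξA := sum_mul_potential_comm (K := K) (ℓ := ℓ) ξ (fun x => if x ≤ m * K then A x else 0)
  rw [hAξ] at hξA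
  simp only [hpA] at hξA
  have hPP := hPB (potential K ℓ (fun y => if y = q then P else 0))
  rw [potential_ite (by omega), baseDist_self] at hPP
  have hlhs : distForm K ℓ
      (fun x => (if x ≤ m * K then A x else 0) + (ξ x + if x = q then P else 0)) =
      ∑ x ∈ range (ℓ * K + 1), (((if x ≤ m * K then A x else 0) * potential K m A x +
        (if x ≤ m * K then A x else 0) * potential K ℓ ξ x +
        (if x ≤ m * K then A x else 0) * potential K ℓ (fun y => if y = q then P else 0) x) +
        (ξ x * potential K m A x + ξ x * potential K ℓ ξ x +
        ξ x * potential K ℓ (fun y => if y = q then P else 0) x) +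
        ((if x = q then P else 0) * potential K m A x + (if x = q then P else 0) * potential K ℓ ξ x +
        (if x = q then P else 0) * potential K ℓ (fun y => if y = q then P else 0) x)) := by
    unfold distForm
    refine sum_congr rfl fun x _ => ?_
    rw [potential_add (fun y => if y ≤ m * K then A y else 0) (fun y => ξ y + if y = q then P else 0),
      potential_add ξ, hpA]
    ring
  rw [hlhs]
  simp only [sum_add_distrib]
  rw [hAA, hAξ, hBP (fun x => if x ≤ m * K then A x else 0), hpA, hξA, hBP ξ, hPB, hPB, hPP,
    hpξ q hq]
  unfold distForm
  push_cast
  ring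

/-- Let the path have an initial segment `[0, mK]` on which the pendant edges are distributed
symmetrically, except for those at `p = (m-i)K`, to which nothing corresponds at `q = iK`, `2i < m`.
Then it is better to attach the latter at `q`. The test vector is obtained from the Perron vector by
reflecting it on the segment and adding the multiple by the outer weight `X` of the antisymmetric
solution `ζ`; it gains `2 P X ρ ζ(q) > 0`, where `P` is the weight transferred. -/
theorem distanceSpectralRadius_lt_transfer_reflect (hK : 1 ≤ K) {m i : ℕ} (hm : m < ℓ)
    (hi : 1 ≤ i) (him : 2 * i < m)
    (hmid : ∀ t < m, ∀ x, t * K < x → x < (t + 1) * K → c x = 0)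
    (h0 : c 0 = 0) (hq : c (i * K) = 0) (hp : 0 < c ((m - i) * K))
    (hsymm : ∀ x, 0 < x → x < m * K → x ≠ i * K → x ≠ (m - i) * K → c (m * K - x) = c x) :
    (starredPath (K + 1) ℓ c).distanceSpectralRadius <
      (starredPath (K + 1) ℓ
        (transfer c ((m - i) * K) (i * K) (c ((m - i) * K)))).distanceSpectralRadius := by
  obtain ⟨φ, s, h⟩ := exists_isPerron (ℓ := ℓ) (c := c) hK (by omega)
  set ρ := (starredPath (K + 1) ℓ c).distanceSpectralRadius
  have hρ := h.rho_pos
  have hmN : m * K < ℓ * K := Nat.mul_lt_mul_of_pos_right hm hK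
  have hpm : (m - i) * K = m * K - i * K := Nat.sub_mul _ _ _
  set N := m * K with hN
  set q := i * K with hqdef
  set p := (m - i) * K with hpdef
  have hq0 : 0 < q := by positivity
  have hqp : q < p := Nat.mul_lt_mul_of_pos_right (by omega) hK
  have hpq : N - p = q := by omega
  have hqp' : N - q = p := by omega
  -- the symmetric part of the pendant edges on the segment
  set c₁ : ℕ → ℕ := fun x => if 0 < x ∧ x < N ∧ x ≠ p then c x else 0 with hc₁
  have hc₁symm : ∀ x ≤ N, c₁ (N - x) = c₁ x := by
    intro x hx
    simp only [hc₁]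
    by_cases hxp : x = p
    · rw [hxp, hpq, if_pos ⟨hq0, by omega, hqp.ne⟩, hq, if_neg (by simp)]
    · by_cases hxq : x = q
      · rw [hxq, hqp', if_neg (by simp), if_pos ⟨hq0, by omega, hqp.ne⟩, hq]
      · by_cases hx0 : 0 < x ∧ x < N
        · rw [if_pos (show 0 < N - x ∧ N - x < N ∧ N - x ≠ p by omega),
            if_pos (show 0 < x ∧ x < N ∧ x ≠ p from ⟨hx0.1, hx0.2, hxp⟩),
            hsymm x hx0.1 hx0.2 hxq hxp]
        · rw [if_neg (show ¬(0 < N - x ∧ N - x < N ∧ N - x ≠ p) by omega),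
            if_neg (show ¬(0 < x ∧ x < N ∧ x ≠ p) by omega)]
  have hden : 0 < ρ + K + 1 := by positivity
  -- `g x` is the weight over `x` if `x` itself has weight `1` and the leaves have `ρ / (ρ + K + 1)`,
  -- as the difference of the eigenvalue equations demands for a vector of total zero
  set g : ℕ → ℝ := fun x => 1 + c₁ x * K * (ρ / (ρ + K + 1)) with hg
  obtain ⟨ζ, hζodd, hζeq, hζq⟩ := exists_odd_solution_pos (ℓ := m) (K := K) (g := g) (i := i) hK hρ
    (fun x => by
      have : (0 : ℝ) ≤ c₁ x * K * (ρ / (ρ + K + 1)) := by positivity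
      simp only [hg]
      linarith)
    (fun x hx => by
      simp only [hg]
      rw [← hN, hc₁symm x hx])
    (fun t ht x h1 h2 => by
      have : c₁ x = 0 := by
        simp only [hc₁, hmid t ht x h1 h2, ite_self]
      simp [hg, this]) hi him
  rw [← hN] at hζodd hζeq
  set η : ℕ → ℝ := fun x => ρ / (ρ + K + 1) * ζ x with hη
  have hηeq : ∀ x, (ρ + K + 1) * η x = ρ * ζ x := by
    intro x
    simp only [hη]
    field_simp
  set V : ℕ → ℝ := fun x => φ x + c₁ x * K * s x with hV
  -- the weight that hangs on the end of the segment
  set ξ : ℕ → ℝ := fun x => if x < N then 0 else if x = N then c N * K * s N else mass K c φ s x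
    with hξ
  set P : ℝ := c p * K * s p with hP
  set X := total K ℓ ξ with hX
  have hPpos : 0 < P := by
    have := h.leaf_pos p (by omega)
    positivity
  have hXpos : 0 < X := by
    refine sum_pos' (fun x hx => ?_) ⟨N + 1, mem_range.2 (by omega), ?_⟩
    · have hx' := Nat.lt_succ_iff.1 (mem_range.1 hx)
      have h1 := h.leaf_pos N (by omega)
      have h2 := h.mass_pos hx'
      simp only [hξ]
      split_ifs
      · exact le_rfl
      · positivity
      · exact h2.le
    · simp only [hξ]
      rw [if_neg (by omega), if_neg (by omega)]
      exact h.mass_pos (by omega)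
  set c' := transfer c p q (c p) with hc'
  -- the test vector
  set φ' : ℕ → ℝ := fun x => if x ≤ N then φ (N - x) + X * ζ x else φ x with hφ'
  set s' : ℕ → ℝ := fun x =>
    if x = q then s p else if x < N then s (N - x) + X * η x else s x with hs'
  have hcc : ∀ F : ℝ → ℝ, ∀ x, (c' x : ℝ) * F (s' x) = (if x ≤ N then c₁ x * F (s (N - x) + X * η x)
      else 0) + ((if x < N then 0 else c x * F (s x)) + if x = q then c p * F (s p) else 0) := by
    intro F x
    by_cases hxq : x = q
    · subst hxq
      have e1 : c₁ q = 0 := by simp only [hc₁, hq, ite_self]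
      simp [hc', hs', transfer, e1, show q < N by omega]
    · by_cases hxp : x = p
      · have e1 : c₁ x = 0 := by simp [hc₁, hxp]
        have e2 : c' x = 0 := by simp [hc', transfer, hxp, hqp.ne']
        rw [if_neg hxq, e1, e2, if_pos (by omega : x < N)]
        simp
      · have e2 : c' x = c x := by simp [hc', transfer, hxp, hxq]
        rw [if_neg hxq, e2]
        simp only [hs', if_neg hxq]
        rcases lt_trichotomy x N with hxN | hxN | hxN
        · have e1 : c₁ x = c x := by
            rcases Nat.eq_zero_or_pos x with rfl | hx0
            · simp [hc₁, h0]
            · simp [hc₁, hx0, hxN, hxp]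
          simp only [hxN, hxN.le, if_true, e1]
          ring
        · have e1 : c₁ x = 0 := by simp [hc₁, hxN]
          simp [hxN.not_lt, e1]
        · simp only [hxN.not_gt, hxN.not_ge, if_false]
          ring
  have hcc0 : ∀ F : ℝ → ℝ, ∀ x, (c x : ℝ) * F (s x) = (if x ≤ N then c₁ x * F (s x) else 0) +
      ((if x < N then 0 else c x * F (s x)) + if x = p then c p * F (s p) else 0) := by
    intro F x
    by_cases hxp : x = p
    · have e1 : c₁ x = 0 := by simp [hc₁, hxp]
      rw [if_pos hxp, e1, if_pos (by omega : x < N), hxp]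
      simp
    · rw [if_neg hxp]
      rcases lt_trichotomy x N with hxN | hxN | hxN
      · have e1 : c₁ x = c x := by
          rcases Nat.eq_zero_or_pos x with rfl | hx0
          · simp [hc₁, h0]
          · simp [hc₁, hx0, hxN, hxp]
        simp only [hxN, hxN.le, if_true, e1]
        ring
      · have e1 : c₁ x = 0 := by simp [hc₁, hxN]
        simp [hxN.not_lt, e1]
      · simp only [hxN.not_gt, hxN.not_ge, if_false]
        ring
  have hW : mass K c φ s =
      fun x => (if x ≤ N then V x else 0) + (ξ x + if x = p then P else 0) := by
    ext x
    have e1 := hcc0 (fun w => w) x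
    simp only [mass, hV, hξ, hP]
    rcases lt_trichotomy x N with hxN | hxN | hxN
    · simp only [hxN, hxN.le, if_true] at e1 ⊢
      split_ifs at e1 ⊢ <;> linear_combination (K : ℝ) * e1
    · have e2 : c₁ x = 0 := by simp [hc₁, hxN]
      have e3 : x ≠ p := by omega
      rw [hxN] at e2 e3
      simp [hxN, e2, e3]
    · simp only [hxN.not_gt, hxN.not_ge, hxN.ne', show x ≠ p by omega, if_false]
      ring
  have hW' : mass K c' φ' s' = fun x => (if x ≤ N then V (N - x) + X * (g x * ζ x) else 0) +
      (ξ x + if x = q then P else 0) := by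
    ext x
    have e1 := hcc (fun w => w) x
    simp only [mass, hV, hξ, hP, hφ']
    rcases lt_trichotomy x N with hxN | hxN | hxN
    · simp only [hxN, hxN.le, if_true] at e1 ⊢
      simp only [hg, hη] at e1 ⊢
      rw [hc₁symm x hxN.le]
      split_ifs at e1 ⊢ <;> linear_combination (K : ℝ) * e1
    · have e2 : c₁ x = 0 := by simp [hc₁, hxN]
      have e3 : x ≠ q := by omega
      simp only [hxN.not_lt, hxN.le, e2, e3, if_true, if_false] at e1 ⊢
      simp only [hg]
      rw [hc₁symm x hxN.le, e2, if_pos hxN, ← hxN]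
      simp only [Nat.cast_zero, zero_mul, zero_add, add_zero] at e1 ⊢
      linear_combination (K : ℝ) * e1
    · simp only [hxN.not_gt, hxN.not_ge, hxN.ne', show x ≠ q by omega, if_false] at e1 ⊢
      linear_combination (K : ℝ) * e1
  have hξ0 : ∀ x < N, ξ x = 0 := fun x hx => if_pos hx
  set Vr : ℕ → ℝ := fun x => V (N - x) with hVr
  set Y : ℕ → ℝ := fun x => g x * ζ x with hY
  have hYodd : ∀ x ≤ m * K, Y (m * K - x) = -Y x := by
    intro x hx
    simp only [hY, hg]
    rw [← hN, hc₁symm x hx, hζodd x hx]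
    ring
  have hYtot : total K m Y = 0 := total_eq_zero_of_odd hYodd
  have hVrtot : total K m Vr = total K m V := sum_reflect _ V
  set Y' : ℕ → ℝ := fun x => X * Y x with hY'
  have hAtot : total K m (fun x => Vr x + Y' x) = total K m V := by
    unfold total at *
    rw [sum_add_distrib, hVrtot, hY', ← mul_sum, hYtot]
    ring
  have hpot : ∀ x, potential K m (fun x => Vr x + Y' x) x =
      potential K m Vr x + X * potential K m Y x := by
    intro x
    rw [potential_add, hY', potential_smul]
  have hpotr : ∀ x ≤ N, potential K m Vr x = potential K m V (N - x) := fun x hx =>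
    potential_reflect hK V hx
  have hVrY : ∑ x ∈ range (m * K + 1), Vr x * potential K m Y x =
      ρ * ∑ x ∈ range (m * K + 1), Vr x * ζ x - potential K m V 0 + potential K m V N := by
    have e1 : ∀ x ∈ range (m * K + 1), Vr x * potential K m Y x =
        ρ * (Vr x * ζ x) - baseDist K N x * Vr x + baseDist K 0 x * Vr x := by
      intro x hx
      have e2 := hζeq x (Nat.lt_succ_iff.1 (mem_range.1 hx))
      rw [baseDist_comm (x := N), baseDist_comm (x := 0)]
      linear_combination (-Vr x) * e2
    have e2 := hpotr N le_rfl
    have e3 := hpotr 0 (Nat.zero_le _)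
    rw [Nat.sub_self] at e2
    rw [Nat.sub_zero] at e3
    rw [← e2, ← e3, sum_congr rfl e1, sum_add_distrib, sum_sub_distrib, mul_sum]
    rfl
  have hYN := potential_odd hK hYodd (le_refl (m * K))
  rw [Nat.sub_self, ← hN] at hYN
  have hYY : ∑ x ∈ range (m * K + 1), Y x * potential K m Y x =
      ρ * ∑ x ∈ range (m * K + 1), Y x * ζ x - 2 * potential K m Y N := by
    have e1 : ∀ x ∈ range (m * K + 1), Y x * potential K m Y x =
        ρ * (Y x * ζ x) - baseDist K N x * Y x + baseDist K 0 x * Y x := by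
      intro x hx
      have e2 := hζeq x (Nat.lt_succ_iff.1 (mem_range.1 hx))
      rw [baseDist_comm (x := N), baseDist_comm (x := 0)]
      linear_combination (-Y x) * e2
    rw [sum_congr rfl e1, sum_add_distrib, sum_sub_distrib, mul_sum]
    have e3 : potential K m Y N - potential K m Y 0 = 2 * potential K m Y N := by
      rw [hYN]
      ring
    rw [← e3]
    unfold potential
    ring
  have hVV : ∑ x ∈ range (m * K + 1), Vr x * potential K m Vr x = distForm K m V := by
    rw [sum_congr rfl fun x hx => by rw [hpotr x (Nat.lt_succ_iff.1 (mem_range.1 hx))]]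
    exact sum_reflect (m * K) fun x => V x * potential K m V x
  have hformA : distForm K m (fun x => Vr x + Y' x) = distForm K m V +
      2 * X * ∑ x ∈ range (m * K + 1), Vr x * potential K m Y x +
      X ^ 2 * ∑ x ∈ range (m * K + 1), Y x * potential K m Y x := by
    have e1 : ∀ x ∈ range (m * K + 1), (Vr x + Y' x) * potential K m (fun x => Vr x + Y' x) x =
        Vr x * potential K m Vr x + X * (Vr x * potential K m Y x) + X * (Y x * potential K m Vr x) +
        X ^ 2 * (Y x * potential K m Y x) := by
      intro x _
      rw [hpot]
      simp only [hY']
      ring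
    conv_lhs => unfold distForm
    rw [sum_congr rfl e1, sum_add_distrib, sum_add_distrib, sum_add_distrib, ← mul_sum, ← mul_sum,
      ← mul_sum, hVV, sum_mul_potential_comm Y Vr]
    ring
  have hqeq := hζeq q (by omega)
  have hqN : baseDist K p N = baseDist K q 0 := by
    have := baseDist_reflect (ℓ := m) hK (show q ≤ m * K by omega) (Nat.zero_le _)
    rwa [← hN, hqp', Nat.sub_zero] at this
  have hform : distForm K ℓ (mass K c' φ' s') = distForm K ℓ (mass K c φ s) +
      2 * X * ρ * ∑ x ∈ range (m * K + 1), Vr x * ζ x +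
      X ^ 2 * ρ * ∑ x ∈ range (m * K + 1), Y x * ζ x + 2 * P * X * (ρ * ζ q) := by
    have e1 := hpotr N le_rfl
    have e2 := hpotr q (by omega)
    rw [Nat.sub_self] at e1
    rw [hqp'] at e2
    rw [hW, hW', distForm_split hK hm.le (show p ≤ m * K by omega) V ξ hξ0,
      distForm_split hK hm.le (show q ≤ m * K by omega) (fun x => Vr x + Y' x) ξ hξ0,
      hAtot, hpot, hpot, hformA, hVrY, hYY, ← hN, e1, e2, ← hX, hqN, hqeq]
    ring
  have hmN' : N ≤ ℓ * K := hmN.le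
  have hpmem : p ∈ range (ℓ * K + 1) := mem_range.2 (by omega)
  have hqmem : q ∈ range (ℓ * K + 1) := mem_range.2 (by omega)
  have htot : total K ℓ (mass K c' φ' s') = total K ℓ (mass K c φ s) := by
    rw [hW, hW']
    unfold total at *
    simp only [sum_add_distrib, sum_ite_eq', hpmem, hqmem, if_true]
    rw [sum_range_ite_le hmN', sum_range_ite_le hmN', ← hN] at *
    rw [hAtot]
  have hcsum : ∀ F : ℝ → ℝ, ∑ x ∈ range (ℓ * K + 1), (c' x : ℝ) * F (s' x) =
      ∑ x ∈ range (ℓ * K + 1), (c x : ℝ) * F (s x) +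
      ∑ x ∈ range (N + 1), c₁ x * (F (s (N - x) + X * η x) - F (s (N - x))) := by
    intro F
    have e1 : ∑ x ∈ range (N + 1), (c₁ x : ℝ) * F (s (N - x)) =
        ∑ x ∈ range (N + 1), (c₁ x : ℝ) * F (s x) := by
      rw [← sum_reflect N fun x => (c₁ x : ℝ) * F (s x)]
      exact sum_congr rfl fun x hx => by
        rw [hc₁symm x (Nat.lt_succ_iff.1 (mem_range.1 hx))]
    rw [sum_congr rfl fun x _ => hcc F x, sum_congr (s₁ := range (ℓ * K + 1))
      (f := fun x => (c x : ℝ) * F (s x)) rfl fun x _ => hcc0 F x]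
    simp only [sum_add_distrib, sum_ite_eq', hpmem, hqmem, if_true, mul_sub, sum_sub_distrib]
    rw [sum_range_ite_le hmN' fun x => (c₁ x : ℝ) * F (s (N - x) + X * η x),
      sum_range_ite_le hmN' fun x => (c₁ x : ℝ) * F (s x), e1]
    ring
  have hleaf : leafTotal K ℓ c' s' = leafTotal K ℓ c s := by
    have e1 := hcsum fun w => w
    have e2 : ∑ x ∈ range (N + 1), (c₁ x : ℝ) * (s (N - x) + X * η x - s (N - x)) = 0 := by
      have e3 : total K m (fun x => (c₁ x : ℝ) * (X * η x)) = 0 := by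
        refine total_eq_zero_of_odd fun x hx => ?_
        simp only [hη]
        rw [← hN, hc₁symm x hx, hζodd x hx]
        ring
      rw [← e3]
      exact sum_congr rfl fun x _ => by ring
    rw [e2, add_zero] at e1
    have e4 : ∀ (a : ℕ → ℕ) (b : ℕ → ℝ), leafTotal K ℓ a b =
        K * ∑ x ∈ range (ℓ * K + 1), (a x : ℝ) * b x := by
      intro a b
      unfold leafTotal
      rw [mul_sum]
      exact sum_congr rfl fun x _ => by ring
    rw [e4, e4, e1]
  have hsq := hcsum fun w => w ^ 2
  have hφsq : ∑ x ∈ range (ℓ * K + 1), φ' x ^ 2 = ∑ x ∈ range (ℓ * K + 1), φ x ^ 2 +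
      ∑ x ∈ range (N + 1), ((φ (N - x) + X * ζ x) ^ 2 - φ (N - x) ^ 2) := by
    have e1 : ∀ x, φ' x ^ 2 = (if x ≤ N then (φ (N - x) + X * ζ x) ^ 2 - φ x ^ 2 else 0) +
        φ x ^ 2 := by
      intro x
      simp only [hφ']
      split_ifs <;> ring
    rw [sum_congr rfl fun x _ => e1 x, sum_add_distrib, sum_range_ite_le hmN', sum_sub_distrib,
      sum_sub_distrib, sum_reflect N fun x => φ x ^ 2]
    ring
  -- the terms with `ζ` cancel pointwise by the equation `(ρ + K + 1) η = ρ ζ`, except at `q`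
  have hgain : energy K ℓ c' φ' s' - ρ * sqNorm K ℓ c' φ' s' =
      energy K ℓ c φ s - ρ * sqNorm K ℓ c φ s + 2 * P * X * (ρ * ζ q) := by
    unfold energy sqNorm
    rw [htot, hleaf, hform, hsq, hφsq]
    have e1 : 2 * X * ρ * ∑ x ∈ range (N + 1), Vr x * ζ x +
        X ^ 2 * ρ * ∑ x ∈ range (N + 1), Y x * ζ x =
        (K + 1 + ρ) * K *
          ∑ x ∈ range (N + 1), c₁ x * ((s (N - x) + X * η x) ^ 2 - s (N - x) ^ 2) +
        ρ * ∑ x ∈ range (N + 1), ((φ (N - x) + X * ζ x) ^ 2 - φ (N - x) ^ 2) := by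
      simp only [mul_sum, ← sum_add_distrib]
      refine sum_congr rfl fun x hx => ?_
      have e2 := hηeq x
      have e3 : g x * ζ x = ζ x + c₁ x * K * η x := by
        simp only [hg, hη]
        ring
      simp only [hVr, hY, hV]
      rw [hc₁symm x (Nat.lt_succ_iff.1 (mem_range.1 hx)), e3]
      linear_combination (-(K * c₁ x * (2 * X * s (N - x) + X ^ 2 * η x) : ℝ)) * e2
    linear_combination e1
  have hle := energy_le (ℓ := ℓ) (c := c') hK φ' s'
  rw [h.energy_eq] at hgain
  have hgpos : 0 < 2 * P * X * (ρ * ζ q) := by positivity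
  have hnn : 0 ≤ sqNorm K ℓ c' φ' s' := by
    unfold sqNorm
    have h1 : 0 ≤ ∑ x ∈ range (ℓ * K + 1), φ' x ^ 2 := sum_nonneg fun x _ => sq_nonneg _
    have h2 : 0 ≤ ∑ x ∈ range (ℓ * K + 1), (c' x : ℝ) * s' x ^ 2 :=
      sum_nonneg fun x _ => by positivity
    positivity
  exact lt_of_mul_lt_mul_right (by linarith) hnn

end Hypergraph

/-! ### Isomorphisms between caterpillars -/

namespace Hypergraph

universe u v

variable {K ℓ : ℕ} {c c' : ℕ → ℕ}

theorem isIsomorphic_of_image {α : Type u} {β : Type v} {H : Hypergraph α} {L : Hypergraph β}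
    (f : α → β) (hinj : Set.InjOn f V(H)) (hV : f '' V(H) = V(L))
    (hE : ∀ e ∈ E(H), f '' e ∈ E(L)) (hE' : ∀ e ∈ E(L), ∃ e' ∈ E(H), f '' e' = e) :
    H.IsIsomorphic L := by
  refine ⟨f, hinj, Hypergraph.ext hV ?_⟩
  ext e
  constructor
  · rintro ⟨e', he', rfl⟩
    exact hE e' he'
  · intro he
    obtain ⟨e', he', rfl⟩ := hE' e he
    exact ⟨e', he', rfl⟩

theorem IsIsomorphic.refl {α : Type u} (H : Hypergraph α) : H.IsIsomorphic H :=
  isIsomorphic_of_image id (Set.injOn_id _) (Set.image_id _) (fun e he => by rwa [Set.image_id])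
    fun e he => ⟨e, he, Set.image_id e⟩

theorem starredPath_congr (h : ∀ x ≤ ℓ * K, c x = c' x) :
    starredPath (K + 1) ℓ c = starredPath (K + 1) ℓ c' := by
  refine Hypergraph.ext ?_ ?_
  · ext u
    rw [mem_vertexSet_starredPath, mem_vertexSet_starredPath, Nat.add_sub_cancel]
    exact and_congr_right fun hu => by rw [h _ hu]
  · ext s
    rw [mem_edgeSet_starredPath, mem_edgeSet_starredPath, Nat.add_sub_cancel]
    refine or_congr_right (exists_congr fun x => and_congr_right fun hx => ?_)
    rw [h x hx]

/-- An involution `g` of the loose path, inducing `σ` on the edges, carries a caterpillar to a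
caterpillar. -/
theorem isIsomorphic_starredPath_comp (g σ : ℕ → ℕ)
    (hg : ∀ x ≤ ℓ * K, g x ≤ ℓ * K ∧ g (g x) = x) (hσ : ∀ t < ℓ, σ t < ℓ ∧ σ (σ t) = t)
    (hgσ : ∀ t < ℓ, ∀ x, t * K ≤ x → x ≤ (t + 1) * K →
      σ t * K ≤ g x ∧ g x ≤ (σ t + 1) * K) :
    (starredPath (K + 1) ℓ c).IsIsomorphic (starredPath (K + 1) ℓ fun x => c (g x)) := by
  have hle : ∀ t < ℓ, ∀ x ≤ (t + 1) * K, x ≤ ℓ * K := fun t ht x hx =>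
    hx.trans (Nat.mul_le_mul_right _ ht)
  have hpath : ∀ t < ℓ, (fun u : ℕ × Option (ℕ × ℕ) => (g u.1, u.2)) '' pathEdge K t =
      pathEdge K (σ t) := by
    intro t ht
    ext ⟨x, s⟩
    constructor
    · rintro ⟨⟨y, r⟩, ⟨h1, h2, h3⟩, h4⟩
      obtain ⟨rfl, rfl⟩ := Prod.mk.injEq _ _ _ _ ▸ h4
      exact ⟨(hgσ t ht y h1 h2).1, (hgσ t ht y h1 h2).2, h3⟩
    · rintro ⟨h1, h2, h3⟩
      have h4 := hgσ _ (hσ t ht).1 x h1 h2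
      rw [(hσ t ht).2] at h4
      exact ⟨(g x, s), ⟨h4.1, h4.2, h3⟩, 
        congrArg (·, s) (hg x (hle _ (hσ t ht).1 x h2)).2⟩
  have hstar : ∀ x ≤ ℓ * K, ∀ j, (fun u : ℕ × Option (ℕ × ℕ) => (g u.1, u.2)) '' starEdge K x j =
      starEdge K (g x) j := by
    intro x hx j
    ext ⟨y, s⟩
    constructor
    · rintro ⟨⟨z, r⟩, ⟨h1, h2⟩, h3⟩
      obtain ⟨rfl, rfl⟩ := Prod.mk.injEq _ _ _ _ ▸ h3
      exact ⟨congrArg g h1, h2⟩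
    · rintro ⟨h1, h2⟩
      exact ⟨(x, s), ⟨rfl, h2⟩, congrArg (·, s) h1.symm⟩
  refine isIsomorphic_of_image (fun u => (g u.1, u.2)) ?_ ?_ ?_ ?_
  · rintro ⟨x, s⟩ hu ⟨y, r⟩ hv h
    obtain ⟨h1, rfl⟩ := Prod.mk.injEq _ _ _ _ ▸ h
    have h2 := congrArg g h1
    dsimp only at h2
    rw [(hg x (mem_vertexSet_starredPath.1 hu).1).2,
      (hg y (mem_vertexSet_starredPath.1 hv).1).2] at h2
    rw [h2]
  · ext ⟨x, s⟩
    constructor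
    · rintro ⟨⟨y, r⟩, hv, h⟩
      obtain ⟨rfl, rfl⟩ := Prod.mk.injEq _ _ _ _ ▸ h
      have hv := mem_vertexSet_starredPath.1 hv
      refine mem_vertexSet_starredPath.2 ⟨(hg y hv.1).1, ?_⟩
      dsimp only
      rw [(hg y hv.1).2]
      exact hv.2
    · intro hv
      have hv := mem_vertexSet_starredPath.1 hv
      exact ⟨(g x, s), mem_vertexSet_starredPath.2 ⟨(hg x hv.1).1, hv.2⟩,
        congrArg (·, s) (hg x hv.1).2⟩
  · intro e he
    rcases mem_edgeSet_starredPath.1 he with ⟨t, ht, rfl⟩ | ⟨x, hx, j, hj, rfl⟩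
    · exact mem_edgeSet_starredPath.2 (Or.inl ⟨σ t, (hσ t ht).1, hpath t ht⟩)
    · refine mem_edgeSet_starredPath.2 (Or.inr ⟨g x, (hg x hx).1, j, ?_, hstar x hx j⟩)
      rwa [(hg x hx).2]
  · intro e he
    rcases mem_edgeSet_starredPath.1 he with ⟨t, ht, rfl⟩ | ⟨x, hx, j, hj, rfl⟩
    · refine ⟨_, mem_edgeSet_starredPath.2 (Or.inl ⟨σ t, (hσ t ht).1, rfl⟩), ?_⟩
      exact (hpath _ (hσ t ht).1).trans (by rw [(hσ t ht).2]; rfl)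
    · refine ⟨_, mem_edgeSet_starredPath.2 (Or.inr ⟨g x, (hg x hx).1, j, hj, rfl⟩), ?_⟩
      exact (hstar _ (hg x hx).1 j).trans (by rw [(hg x hx).2]; rfl)

theorem isIsomorphic_starredPath_reflect :
    (starredPath (K + 1) ℓ c).IsIsomorphic (starredPath (K + 1) ℓ fun x => c (ℓ * K - x)) := by
  refine isIsomorphic_starredPath_comp (fun x => ℓ * K - x) (fun t => ℓ - 1 - t)
    (fun x hx => ⟨Nat.sub_le _ _, Nat.sub_sub_self hx⟩) (fun t ht => by omega) ?_
  intro t ht x h1 h2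
  obtain ⟨d, rfl⟩ : ∃ d, ℓ = t + 1 + d := ⟨ℓ - (t + 1), by omega⟩
  have h3 : t + 1 + d - 1 - t = d := by omega
  rw [h3]
  have h4 : (t + 1 + d) * K = t * K + K + d * K := by ring
  have h5 : (t + 1) * K = t * K + K := by ring
  have h6 : (d + 1) * K = d * K + K := by ring
  omega

/-- The vertices of the first edge that lie in no other path edge can be permuted. -/
theorem isIsomorphic_starredPath_swap {x : ℕ} (hx : x ≤ K) (hx' : 2 ≤ ℓ → x < K) (hℓ : 1 ≤ ℓ) :
    (starredPath (K + 1) ℓ c).IsIsomorphic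
      (starredPath (K + 1) ℓ fun y => c (Equiv.swap 0 x y)) := by
  have hKN : K ≤ ℓ * K := Nat.le_mul_of_pos_left _ hℓ
  refine isIsomorphic_starredPath_comp (Equiv.swap 0 x) id (fun y hy => ?_) (fun t ht => ⟨ht, rfl⟩)
    fun t ht y h1 h2 => ?_
  · refine ⟨?_, Equiv.swap_apply_self 0 x y⟩
    rw [Equiv.swap_apply_def]
    split_ifs <;> omega
  · have h3 : (t + 1) * K = t * K + K := by ring
    simp only [id]
    rw [Equiv.swap_apply_def]
    rcases Nat.eq_zero_or_pos t with rfl | ht0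
    · split_ifs <;> omega
    · have h4 := hx' (by omega)
      have h5 : K ≤ t * K := Nat.le_mul_of_pos_left _ ht0
      split_ifs <;> omega

/-- A pendant edge at the end of the path can be regarded as one more edge of the path. -/
theorem isIsomorphic_starredPath_extend {j : ℕ} (hj : c (ℓ * K) = j + 1) :
    (starredPath (K + 1) ℓ c).IsIsomorphic (starredPath (K + 1) (ℓ + 1)
      fun x => if x < ℓ * K then c x else if x = ℓ * K then j else 0) := by
  set N := ℓ * K with hN
  have hN' : (ℓ + 1) * K = N + K := by rw [hN]; ring
  set c' : ℕ → ℕ := fun x => if x < N then c x else if x = N then j else 0 with hc'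
  let f : ℕ × Option (ℕ × ℕ) → ℕ × Option (ℕ × ℕ) := fun u =>
    match u with
    | (x, none) => (x, none)
    | (x, some (a, i)) => if x = N ∧ a = j then (N + 1 + i, none) else (x, some (a, i))
  have f0 : ∀ x, f (x, none) = (x, none) := fun x => rfl
  have f1 : ∀ x a i, ¬ (x = N ∧ a = j) → f (x, some (a, i)) = (x, some (a, i)) :=
    fun x a i h => if_neg h
  have f2 : ∀ i, f (N, some (j, i)) = (N + 1 + i, none) := fun i => if_pos ⟨rfl, rfl⟩
  have hpath : ∀ t, f '' pathEdge K t = pathEdge K t := by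
    intro t
    have : ∀ u ∈ pathEdge K t, f u = id u := by
      rintro ⟨x, s⟩ ⟨-, -, h⟩
      dsimp only at h
      subst h
      rfl
    rw [Set.image_congr this, Set.image_id]
  have hstar : ∀ x a, ¬ (x = N ∧ a = j) → f '' starEdge K x a = starEdge K x a := by
    intro x a h
    have : ∀ u ∈ starEdge K x a, f u = id u := by
      rintro ⟨y, s⟩ ⟨h1, h2⟩
      dsimp only at h1 h2
      subst h1
      rcases s with _ | ⟨b, i⟩
      · rfl
      · obtain ⟨rfl, -⟩ := h2 _ rfl
        exact f1 _ _ _ h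
    rw [Set.image_congr this, Set.image_id]
  have hlast : f '' starEdge K N j = pathEdge K ℓ := by
    ext ⟨y, r⟩
    constructor
    · rintro ⟨⟨x, s⟩, ⟨h1, h2⟩, h3⟩
      dsimp only at h1 h2
      subst h1
      rcases s with _ | ⟨b, i⟩
      · obtain ⟨rfl, rfl⟩ := Prod.mk.injEq _ _ _ _ ▸ h3
        exact ⟨le_rfl, by dsimp only; omega, rfl⟩
      · obtain ⟨h4, h5⟩ := h2 _ rfl
        dsimp only at h4 h5
        subst h4
        rw [f2] at h3
        obtain ⟨rfl, rfl⟩ := Prod.mk.injEq _ _ _ _ ▸ h3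
        exact ⟨by dsimp only; omega, by dsimp only; omega, rfl⟩
    · rintro ⟨h1, h2, h3⟩
      dsimp only at h1 h2 h3
      subst h3
      rcases Nat.lt_or_ge N y with h | h
      · refine ⟨(N, some (j, y - N - 1)), ⟨rfl, ?_⟩, ?_⟩
        · simp only [Option.some.injEq, forall_eq', true_and]
          omega
        · rw [f2]
          congr 1
          omega
      · obtain rfl : y = N := by omega
        exact ⟨(N, none), ⟨rfl, by simp⟩, rfl⟩
  have hc1 : ∀ x < N, c' x = c x := fun x hx => if_pos hx
  have hc2 : c' N = j := by simp [hc']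
  have hc3 : ∀ x, N < x → c' x = 0 := fun x hx => by
    simp [hc', hx.not_gt, hx.ne']
  refine isIsomorphic_of_image f ?_ ?_ ?_ ?_
  · rintro ⟨x, s⟩ hu ⟨y, r⟩ hv h
    have hu := (mem_vertexSet_starredPath.1 hu).1
    have hv := (mem_vertexSet_starredPath.1 hv).1
    simp only [Nat.add_sub_cancel, ← hN] at hu hv
    rcases s with _ | ⟨a, i⟩ <;> rcases r with _ | ⟨b, i'⟩ <;> simp only [f] at h ⊢ <;>
      (try split_ifs at h) <;>
      simp only [Prod.mk.injEq, Option.some.injEq, reduceCtorEq, and_false] at h ⊢ <;> omega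
  · ext ⟨y, r⟩
    constructor
    · rintro ⟨⟨x, s⟩, hu, h⟩
      have hu := mem_vertexSet_starredPath.1 hu
      simp only [Nat.add_sub_cancel, ← hN] at hu
      rw [mem_vertexSet_starredPath, Nat.add_sub_cancel, hN']
      rcases s with _ | ⟨a, i⟩
      · obtain ⟨rfl, rfl⟩ := Prod.mk.injEq _ _ _ _ ▸ h
        exact ⟨by dsimp only; omega, by simp⟩
      · have h2 := hu.2 _ rfl
        by_cases h1 : x = N ∧ a = j
        · obtain ⟨rfl, rfl⟩ := h1
          rw [f2] at h
          obtain ⟨rfl, rfl⟩ := Prod.mk.injEq _ _ _ _ ▸ h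
          exact ⟨by dsimp only at *; omega, by simp⟩
        · rw [f1 _ _ _ h1] at h
          obtain ⟨rfl, rfl⟩ := Prod.mk.injEq _ _ _ _ ▸ h
          refine ⟨by dsimp only; omega, ?_⟩
          simp only [Option.some.injEq, forall_eq'] at h2 ⊢
          refine ⟨?_, h2.2⟩
          rcases hu.1.lt_or_eq with h3 | h3
          · rw [hc1 _ h3]
            exact h2.1
          · subst h3
            rw [hc2]
            omega
    · intro hv
      rw [mem_vertexSet_starredPath, Nat.add_sub_cancel, hN'] at hv
      simp only [Set.mem_image, mem_vertexSet_starredPath, Nat.add_sub_cancel, ← hN]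
      rcases r with _ | ⟨a, i⟩
      · rcases Nat.lt_or_ge N y with h | h
        · refine ⟨(N, some (j, y - N - 1)), ⟨le_rfl, ?_⟩, ?_⟩
          · simp only [Option.some.injEq, forall_eq']
            have := hv.1
            omega
          · rw [f2]
            congr 1
            omega
        · exact ⟨(y, none), ⟨h, by simp⟩, rfl⟩
      · have h1 := hv.2 _ rfl
        dsimp only at h1
        have h2 : y ≤ N ∧ ¬ (y = N ∧ a = j) ∧ a < c y := by
          rcases lt_trichotomy y N with h | h | h
          · rw [hc1 _ h] at h1
            exact ⟨h.le, by omega, h1.1⟩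
          · rw [h, hc2] at h1
            rw [h]
            exact ⟨le_rfl, by omega, by omega⟩
          · rw [hc3 _ h] at h1
            omega
        exact ⟨(y, some (a, i)), ⟨h2.1, by simpa using ⟨h2.2.2, h1.2⟩⟩, f1 _ _ _ h2.2.1⟩
  · intro e he
    rw [mem_edgeSet_starredPath, Nat.add_sub_cancel] at he ⊢
    rcases he with ⟨t, ht, rfl⟩ | ⟨x, hx, a, ha, rfl⟩
    · exact Or.inl ⟨t, by omega, hpath t⟩
    · by_cases h : x = N ∧ a = j
      · obtain ⟨rfl, rfl⟩ := h
        exact Or.inl ⟨ℓ, by omega, hlast⟩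
      · refine Or.inr ⟨x, by omega, a, ?_, hstar x a h⟩
        rcases (show x ≤ N from hx).lt_or_eq with h3 | h3
        · rwa [hc1 _ h3]
        · subst h3
          rw [hc2]
          omega
  · intro e he
    rw [mem_edgeSet_starredPath, Nat.add_sub_cancel] at he
    simp only [mem_edgeSet_starredPath, Nat.add_sub_cancel, ← hN]
    rcases he with ⟨t, ht, rfl⟩ | ⟨x, hx, a, ha, rfl⟩
    · rcases Nat.lt_or_ge t ℓ with h | h
      · exact ⟨_, Or.inl ⟨t, h, rfl⟩, hpath t⟩
      · obtain rfl : t = ℓ := by omega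
        exact ⟨_, Or.inr ⟨N, le_rfl, j, by omega, rfl⟩, hlast⟩
    · have h2 : x ≤ N ∧ ¬ (x = N ∧ a = j) ∧ a < c x := by
        rcases lt_trichotomy x N with h | h | h
        · rw [hc1 _ h] at ha
          exact ⟨h.le, by omega, ha⟩
        · rw [h, hc2] at ha
          rw [h]
          exact ⟨le_rfl, by omega, by omega⟩
        · rw [hc3 _ h] at ha
          omega
      exact ⟨_, Or.inr ⟨x, h2.1, a, h2.2.2, rfl⟩, hstar x a h2.2.1⟩

end Hypergraph

/-! ### Degrees in a caterpillar -/

namespace Hypergraph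

open Finset

variable {K ℓ m Δ n : ℕ} {c c' : ℕ → ℕ}

/-- The number of edges of the loose path that contain the vertex `x`. -/
def pathDegree (K ℓ x : ℕ) : ℕ := #{t ∈ range ℓ | t * K ≤ x ∧ x ≤ (t + 1) * K}

/-- The degree of the path vertex `x` of a caterpillar. -/
def starredDegree (K ℓ : ℕ) (c : ℕ → ℕ) (x : ℕ) : ℕ := pathDegree K ℓ x + c x

theorem pathDegree_of_mem {t x : ℕ} (ht : t < ℓ) (hx : t * K < x) (hx' : x < (t + 1) * K) :
    pathDegree K ℓ x = 1 := by
  rw [pathDegree, card_eq_one]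
  refine ⟨t, ?_⟩
  ext s
  rw [mem_filter, mem_range, mem_singleton]
  constructor
  · rintro ⟨-, h1, h2⟩
    have h3 : s < t + 1 := lt_of_mul_lt_mul_right (h1.trans_lt hx') (Nat.zero_le _)
    have h4 : t < s + 1 := lt_of_mul_lt_mul_right (hx.trans_le h2) (Nat.zero_le _)
    omega
  · rintro rfl
    exact ⟨ht, hx.le, hx'.le⟩

theorem pathDegree_mul (hK : 1 ≤ K) {i : ℕ} (hi : 0 < i) (hi' : i < ℓ) :
    pathDegree K ℓ (i * K) = 2 := by
  obtain ⟨j, rfl⟩ : ∃ j, i = j + 1 := ⟨i - 1, by omega⟩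
  rw [pathDegree, show ({t ∈ range ℓ | t * K ≤ (j + 1) * K ∧ (j + 1) * K ≤ (t + 1) * K}) =
    {j, j + 1} from ?_, card_pair (by omega)]
  ext s
  simp only [mem_filter, mem_range, mem_insert, mem_singleton, Nat.mul_le_mul_right_iff hK]
  omega

theorem pathDegree_zero (hK : 1 ≤ K) (hℓ : 1 ≤ ℓ) : pathDegree K ℓ 0 = 1 := by
  rw [pathDegree, card_eq_one]
  refine ⟨0, ?_⟩
  ext s
  simp only [mem_filter, mem_range, mem_singleton, Nat.le_zero, Nat.mul_eq_zero]
  omega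

theorem pathDegree_last (hK : 1 ≤ K) (hℓ : 1 ≤ ℓ) : pathDegree K ℓ (ℓ * K) = 1 := by
  rw [pathDegree, card_eq_one]
  refine ⟨ℓ - 1, ?_⟩
  ext s
  simp only [mem_filter, mem_range, mem_singleton, Nat.mul_le_mul_right_iff hK]
  omega

/-- The numerical data of a caterpillar `starredPath (K + 1) ℓ c` with `m` edges and maximum degree
`Δ` in which exactly `n` vertices have degree `Δ`. -/
structure IsAdmissible (K m Δ n ℓ : ℕ) (c : ℕ → ℕ) : Prop where
  length_pos : 1 ≤ ℓ
  size : ℓ + ∑ x ∈ range (ℓ * K + 1), c x = m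
  degree_le : ∀ x ≤ ℓ * K, starredDegree K ℓ c x ≤ Δ
  count : #{x ∈ range (ℓ * K + 1) | starredDegree K ℓ c x = Δ} = n

theorem pathEdge_injective (hK : 1 ≤ K) : Function.Injective (pathEdge K) := by
  have key : ∀ t t', pathEdge K t = pathEdge K t' → t ≤ t' := by
    intro t t' h
    have h1 : ((t + 1) * K, (none : Option (ℕ × ℕ))) ∈ pathEdge K t :=
      ⟨Nat.mul_le_mul_right _ (by omega), le_rfl, rfl⟩
    rw [h] at h1
    have := Nat.le_of_mul_le_mul_right h1.2.1 hK
    omega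
  exact fun t t' h => le_antisymm (key _ _ h) (key _ _ h.symm)

theorem mem_starEdge_self (x j : ℕ) : (x, none) ∈ starEdge K x j := ⟨rfl, by simp⟩

theorem some_mem_starEdge (hK : 1 ≤ K) (x j : ℕ) : (x, some (j, 0)) ∈ starEdge K x j :=
  ⟨rfl, by simpa using Nat.pos_of_ne_zero (by omega)⟩

theorem starEdge_inj (hK : 1 ≤ K) {x y i j : ℕ} (h : starEdge K x i = starEdge K y j) :
    x = y ∧ i = j := by
  have h1 := some_mem_starEdge hK x i
  rw [h] at h1
  exact ⟨h1.1, (h1.2 _ rfl).1⟩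

theorem pathEdge_ne_starEdge (hK : 1 ≤ K) (t x j : ℕ) : pathEdge K t ≠ starEdge K x j := by
  intro h
  have h1 := some_mem_starEdge hK x j
  rw [← h] at h1
  simpa using h1.2.2

theorem ncard_edgeSet_starredPath (hK : 1 ≤ K) :
    E(starredPath (K + 1) ℓ c).ncard = ℓ + ∑ x ∈ range (ℓ * K + 1), c x := by
  have h : E(starredPath (K + 1) ℓ c) = pathEdge K '' (range ℓ : Set ℕ) ∪
      (fun a : (_ : ℕ) × ℕ => starEdge K a.1 a.2) ''
        ((range (ℓ * K + 1)).sigma fun x => range (c x) : Finset _) := by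
    ext s
    rw [mem_edgeSet_starredPath, Nat.add_sub_cancel]
    simp only [Set.mem_union, Set.mem_image, coe_range, Set.mem_Iio, mem_coe, mem_sigma, mem_range,
      Sigma.exists, Nat.lt_succ_iff]
    constructor
    · rintro (⟨t, ht, rfl⟩ | ⟨x, hx, j, hj, rfl⟩)
      · exact Or.inl ⟨t, ht, rfl⟩
      · exact Or.inr ⟨x, j, ⟨hx, hj⟩, rfl⟩
    · rintro (⟨t, ht, rfl⟩ | ⟨x, j, ⟨hx, hj⟩, rfl⟩)
      · exact Or.inl ⟨t, ht, rfl⟩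
      · exact Or.inr ⟨x, hx, j, hj, rfl⟩
  rw [h, Set.ncard_union_eq ?_ ((Finset.finite_toSet _).image _) ((Finset.finite_toSet _).image _),
    Set.ncard_image_of_injective _ (pathEdge_injective hK), Set.ncard_image_of_injective,
    Set.ncard_coe_finset, Set.ncard_coe_finset, card_range, card_sigma]
  · simp
  · rintro ⟨x, i⟩ ⟨y, j⟩ hxy
    obtain ⟨rfl, rfl⟩ := starEdge_inj hK hxy
    rfl
  · rw [Set.disjoint_left]
    rintro _ ⟨t, -, rfl⟩ ⟨a, -, ha⟩
    exact pathEdge_ne_starEdge hK _ _ _ ha.symm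

theorem degree_starredPath_none (hK : 1 ≤ K) {x : ℕ} (hx : x ≤ ℓ * K) :
    (starredPath (K + 1) ℓ c).degree (x, none) = starredDegree K ℓ c x := by
  have h : {e ∈ E(starredPath (K + 1) ℓ c) | (x, none) ∈ e} =
      pathEdge K '' ({t ∈ range ℓ | t * K ≤ x ∧ x ≤ (t + 1) * K} : Finset ℕ) ∪
        starEdge K x '' (range (c x) : Set ℕ) := by
    ext s
    rw [Set.mem_sep_iff, mem_edgeSet_starredPath, Nat.add_sub_cancel]
    simp only [Set.mem_union, Set.mem_image, coe_range, Set.mem_Iio, mem_coe, mem_filter, mem_range]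
    constructor
    · rintro ⟨⟨t, ht, rfl⟩ | ⟨y, hy, j, hj, rfl⟩, h⟩
      · exact Or.inl ⟨t, ⟨ht, h.1, h.2.1⟩, rfl⟩
      · obtain rfl : x = y := h.1
        exact Or.inr ⟨j, hj, rfl⟩
    · rintro (⟨t, ⟨ht, h1, h2⟩, rfl⟩ | ⟨j, hj, rfl⟩)
      · exact ⟨Or.inl ⟨t, ht, rfl⟩, h1, h2, rfl⟩
      · exact ⟨Or.inr ⟨x, hx, j, hj, rfl⟩, mem_starEdge_self x j⟩
  rw [degree, h, Set.ncard_union_eq ?_ ((Finset.finite_toSet _).image _)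
    ((Finset.finite_toSet _).image _), Set.ncard_image_of_injective _ (pathEdge_injective hK),
    Set.ncard_image_of_injective _ fun i j h => (starEdge_inj hK h).2, Set.ncard_coe_finset,
    Set.ncard_coe_finset, card_range]
  · rfl
  · rw [Set.disjoint_left]
    rintro _ ⟨t, -, rfl⟩ ⟨a, -, ha⟩
    exact pathEdge_ne_starEdge hK _ _ _ ha.symm

theorem degree_starredPath_some {x : ℕ} {a : ℕ × ℕ}
    (hx : (x, some a) ∈ V(starredPath (K + 1) ℓ c)) :
    (starredPath (K + 1) ℓ c).degree (x, some a) = 1 := by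
  have hx := mem_vertexSet_starredPath.1 hx
  have ha := hx.2 _ rfl
  rw [degree, Set.ncard_eq_one]
  refine ⟨starEdge K x a.1, ?_⟩
  ext s
  rw [Set.mem_sep_iff, mem_edgeSet_starredPath, Nat.add_sub_cancel, Set.mem_singleton_iff]
  constructor
  · rintro ⟨⟨t, ht, rfl⟩ | ⟨y, hy, j, hj, rfl⟩, h⟩
    · simpa using h.2.2
    · obtain rfl : x = y := h.1
      rw [(h.2 _ rfl).1]
  · rintro rfl
    refine ⟨Or.inr ⟨x, hx.1, a.1, ha.1, rfl⟩, rfl, ?_⟩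
    simpa using ha.2

theorem hasDegreeData_starredPath_iff (hK : 1 ≤ K) (hΔ : 2 ≤ Δ) (hℓ : 1 ≤ ℓ) :
    (starredPath (K + 1) ℓ c).HasDegreeData m Δ n ↔ IsAdmissible K m Δ n ℓ c := by
  have hmem : ∀ x ≤ ℓ * K, (x, none) ∈ V(starredPath (K + 1) ℓ c) := fun x hx =>
    mem_vertexSet_starredPath.2 ⟨hx, by simp⟩
  have hcount : {u ∈ V(starredPath (K + 1) ℓ c) | (starredPath (K + 1) ℓ c).degree u = Δ}.ncard =
      #{x ∈ range (ℓ * K + 1) | starredDegree K ℓ c x = Δ} := by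
    rw [← Set.ncard_coe_finset, ← Set.ncard_image_of_injective (f := fun x : ℕ =>
      (x, (none : Option (ℕ × ℕ)))) _ fun x y h => congrArg Prod.fst h]
    congr 1
    ext ⟨x, s⟩
    simp only [coe_filter, mem_range, Set.mem_image, Set.mem_ofPred_eq, Nat.lt_succ_iff]
    constructor
    · rintro ⟨hu, hd⟩
      rcases s with _ | a
      · have hx : x ≤ ℓ * K := (mem_vertexSet_starredPath.1 hu).1
        rw [degree_starredPath_none hK hx] at hd
        exact ⟨x, ⟨hx, hd⟩, rfl⟩
      · rw [degree_starredPath_some hu] at hd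
        omega
    · rintro ⟨y, ⟨hy, hd⟩, h⟩
      obtain ⟨rfl, rfl⟩ := Prod.mk.injEq _ _ _ _ ▸ h
      exact ⟨hmem y hy, by rw [degree_starredPath_none hK hy, hd]⟩
  constructor
  · intro h
    refine ⟨hℓ, ?_, fun x hx => ?_, ?_⟩
    · rw [← ncard_edgeSet_starredPath hK, h.size]
    · rw [← degree_starredPath_none hK hx]
      exact h.degree_le _ (hmem x hx)
    · rw [← hcount, h.count]
  · intro h
    refine ⟨?_, ?_, ?_⟩
    · rw [ncard_edgeSet_starredPath hK, h.size]
    · rintro ⟨x, s⟩ hu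
      rcases s with _ | a
      · have hx : x ≤ ℓ * K := (mem_vertexSet_starredPath.1 hu).1
        rw [degree_starredPath_none hK hx]
        exact h.degree_le x hx
      · rw [degree_starredPath_some hu]
        omega
    · rw [hcount, h.count]

theorem IsAdmissible.of_isIsomorphic (hK : 1 ≤ K) (hΔ : 2 ≤ Δ) (h : IsAdmissible K m Δ n ℓ c)
    {ℓ' : ℕ} (hℓ' : 1 ≤ ℓ')
    (hiso : (starredPath (K + 1) ℓ c).IsIsomorphic (starredPath (K + 1) ℓ' c')) :
    IsAdmissible K m Δ n ℓ' c' :=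
  (hasDegreeData_starredPath_iff hK hΔ hℓ').1
    (((hasDegreeData_starredPath_iff hK hΔ h.length_pos).2 h).of_isIsomorphic hiso)

/-- Exchanging the stars at two inner path vertices preserves all degrees. -/
theorem IsAdmissible.swap (hK : 1 ≤ K) (h : IsAdmissible K m Δ n ℓ c) {i j : ℕ} (hi : 0 < i)
    (hi' : i < ℓ) (hj : 0 < j) (hj' : j < ℓ) :
    IsAdmissible K m Δ n ℓ fun x => c (Equiv.swap (i * K) (j * K) x) := by
  set e := Equiv.swap (i * K) (j * K) with he
  have hi2 : i * K ≤ ℓ * K := Nat.mul_le_mul_right _ hi'.le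
  have hj2 : j * K ≤ ℓ * K := Nat.mul_le_mul_right _ hj'.le
  have hmem : ∀ x, e x ∈ range (ℓ * K + 1) ↔ x ∈ range (ℓ * K + 1) := by
    intro x
    rw [mem_range, mem_range, he, Equiv.swap_apply_def]
    split_ifs <;> omega
  have hdeg : ∀ x, starredDegree K ℓ (fun x => c (e x)) x = starredDegree K ℓ c (e x) := by
    intro x
    unfold starredDegree
    congr 1
    rw [he, Equiv.swap_apply_def]
    split_ifs with h1 h2
    · rw [h1, pathDegree_mul hK hi hi', pathDegree_mul hK hj hj']
    · rw [h2, pathDegree_mul hK hi hi', pathDegree_mul hK hj hj']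
    · rfl
  refine ⟨h.length_pos, ?_, fun x hx => ?_, ?_⟩
  · rw [← h.size]
    congr 1
    exact sum_equiv e (fun x => (hmem x).symm) fun x _ => rfl
  · rw [hdeg]
    exact h.degree_le _ (Nat.lt_succ_iff.1 (mem_range.1 ((hmem x).2 (mem_range.2 (by omega)))))
  · rw [← h.count]
    refine card_equiv e fun x => ?_
    rw [mem_filter, mem_filter, hdeg, hmem]

theorem transfer_eq_swap {p q : ℕ} (hpq : p ≠ q) (hq : c q = 0) :
    transfer c p q (c p) = fun x => c (Equiv.swap p q x) := by
  ext x
  rw [transfer, Equiv.swap_apply_def]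
  split_ifs with h1 h2 h2
  · exact absurd (h2.symm.trans h1) hpq
  · rfl
  · rw [hq, Nat.sub_self]
  · rfl

theorem sum_transfer {p q r N : ℕ} (hpq : p ≠ q) (hq : c q = 0) (hr : r ≤ c p) (hp : p ≤ N)
    (hqN : q ≤ N) :
    ∑ x ∈ range (N + 1), transfer c p q r x = ∑ x ∈ range (N + 1), c x := by
  have hp' : p ∈ range (N + 1) := mem_range.2 (by omega)
  have hq' : q ∈ (range (N + 1)).erase p := mem_erase.2 ⟨hpq.symm, mem_range.2 (by omega)⟩
  have h : ∑ x ∈ ((range (N + 1)).erase p).erase q, transfer c p q r x =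
      ∑ x ∈ ((range (N + 1)).erase p).erase q, c x := sum_congr rfl fun x hx => by
    rw [transfer, if_neg (ne_of_mem_erase hx), if_neg (ne_of_mem_erase (mem_of_mem_erase hx))]
  rw [← add_sum_erase _ _ hp', ← add_sum_erase _ _ hq', ← add_sum_erase _ c hp',
    ← add_sum_erase _ c hq', hq, transfer, if_neg hpq, if_pos rfl, transfer, if_pos rfl, h]
  omega

/-- Moving one pendant edge from a vertex of degree less than `Δ` to a vertex of degree `1`. -/
theorem IsAdmissible.transfer_one (hΔ : 3 ≤ Δ) (h : IsAdmissible K m Δ n ℓ c) {p q : ℕ}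
    (hp : p ≤ ℓ * K) (hq : q ≤ ℓ * K) (hpq : p ≠ q) (hcp : 0 < c p) (hcq : c q = 0)
    (hdp : starredDegree K ℓ c p < Δ) (hdq : pathDegree K ℓ q = 1) :
    IsAdmissible K m Δ n ℓ (transfer c p q 1) := by
  have h1 : starredDegree K ℓ (transfer c p q 1) p < Δ := by
    unfold starredDegree at hdp ⊢
    rw [transfer, if_neg hpq, if_pos rfl]
    omega
  have h2 : starredDegree K ℓ (transfer c p q 1) q < Δ := by
    unfold starredDegree
    rw [transfer, if_pos rfl]
    omega
  have h2' : starredDegree K ℓ c q < Δ := by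
    unfold starredDegree
    omega
  have h3 : ∀ x, x ≠ p → x ≠ q → starredDegree K ℓ (transfer c p q 1) x = starredDegree K ℓ c x := by
    intro x hxp hxq
    unfold starredDegree
    rw [transfer, if_neg hxq, if_neg hxp]
  refine ⟨h.length_pos, ?_, fun x hx => ?_, ?_⟩
  · rw [sum_transfer hpq hcq hcp hp hq, h.size]
  · by_cases hxp : x = p
    · exact hxp ▸ h1.le
    by_cases hxq : x = q
    · exact hxq ▸ h2.le
    rw [h3 x hxp hxq]
    exact h.degree_le x hx
  · rw [← h.count]
    congr 1
    refine filter_congr fun x _ => ?_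
    by_cases hxp : x = p
    · rw [hxp]
      omega
    by_cases hxq : x = q
    · rw [hxq]
      omega
    rw [h3 x hxp hxq]

theorem map_insertEdge {M M' : Type*} (F : M → M') {t x : ℕ} {a b d : M} {h : ℕ → M} (z : ℕ) :
    F (insertEdge K t x a b d h z) = insertEdge K t x (F a) (F b) (F d) (fun y => F (h y)) z := by
  unfold insertEdge
  split_ifs <;> rfl

theorem pathDegree_insertEdge (hK : 1 ≤ K) {t x : ℕ} (ht : t + 2 ≤ ℓ)
    (hx : t * K < x) (hx' : x < (t + 1) * K) {z : ℕ} (hz : z ≤ (ℓ + 1) * K) :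
    pathDegree K (ℓ + 1) z = insertEdge K t x 1 2 1 (pathDegree K ℓ) z := by
  have e2 : (t + 2) * K = (t + 1) * K + K := by ring
  have htℓ : (t + 2) * K ≤ ℓ * K := Nat.mul_le_mul_right _ ht
  have e3 : (ℓ + 1) * K = ℓ * K + K := by ring
  rcases eq_or_ne z x with rfl | hzx
  · rw [insertEdge_self, pathDegree_of_mem (by omega) hx hx']
  rcases lt_trichotomy z ((t + 1) * K) with h | h | h
  · rw [insertEdge_of_lt h hzx]
    unfold pathDegree
    congr 1
    ext s
    rw [mem_filter, mem_filter, mem_range, mem_range]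
    constructor
    · rintro ⟨h1, h2, h3⟩
      have h4 : s < t + 1 := lt_of_mul_lt_mul_right (h2.trans_lt h) (Nat.zero_le _)
      exact ⟨by omega, h2, h3⟩
    · rintro ⟨h1, h2, h3⟩
      exact ⟨by omega, h2, h3⟩
  · rw [h, insertEdge_end hx', pathDegree_mul hK (by omega) (by omega)]
  · rcases Nat.lt_or_ge z ((t + 2) * K) with h' | h'
    · rw [insertEdge_mid hx' h h', pathDegree_of_mem (t := t + 1) (by omega) h h']
    · obtain ⟨y, rfl⟩ : ∃ y, z = y + K := ⟨z - K, by omega⟩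
      have hy : (t + 1) * K ≤ y := by omega
      rw [insertEdge_add hx' hy]
      rcases hy.lt_or_eq with hy | rfl
      · unfold pathDegree
        refine card_bij' (fun s _ => s - 1) (fun s _ => s + 1) ?_ ?_ ?_ ?_ <;>
          simp only [mem_filter, mem_range]
        · rintro s ⟨h1, h2, h3⟩
          have h4 : t + 1 < s + 1 := lt_of_mul_lt_mul_right (by omega) (Nat.zero_le K)
          obtain ⟨s, rfl⟩ : ∃ r, s = r + 1 := ⟨s - 1, by omega⟩
          have h5 : (s + 1) * K = s * K + K := by ring
          have h6 : (s + 1 + 1) * K = s * K + K + K := by ring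
          rw [Nat.add_sub_cancel]
          omega
        · rintro s ⟨h1, h2, h3⟩
          have h5 : (s + 1) * K = s * K + K := by ring
          have h6 : (s + 1 + 1) * K = s * K + K + K := by ring
          omega
        · rintro s ⟨h1, h2, h3⟩
          have h4 : t + 1 < s + 1 := lt_of_mul_lt_mul_right (by omega) (Nat.zero_le K)
          omega
        · intro s _
          omega
      · rw [← e2, pathDegree_mul hK (by omega) (by omega), pathDegree_mul hK (by omega) (by omega)]

/-- Turning a pendant edge at an inner vertex `x` of an inner path edge into a path edge, whose
vertex shared with the shortened old edge takes over the other pendant edges of `x`, preserves the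
degrees. -/
theorem IsAdmissible.insertEdge (hK : 1 ≤ K) (hΔ : 3 ≤ Δ) (h : IsAdmissible K m Δ n ℓ c) {t x : ℕ}
    (ht : t + 2 ≤ ℓ) (hx : t * K < x) (hx' : x < (t + 1) * K) (hc : 0 < c x) :
    IsAdmissible K m Δ n (ℓ + 1) (insertEdge K t x 0 (c x - 1) 0 c) := by
  have htℓ : (t + 2) * K ≤ ℓ * K := Nat.mul_le_mul_right _ ht
  have e2 : (t + 2) * K = (t + 1) * K + K := by ring
  have hdx : starredDegree K ℓ c x = c x + 1 := by
    rw [starredDegree, pathDegree_of_mem (by omega) hx hx', Nat.add_comm]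
  have hdeg : ∀ z ≤ (ℓ + 1) * K,
      starredDegree K (ℓ + 1) (Hypergraph.insertEdge K t x 0 (c x - 1) 0 c) z =
        Hypergraph.insertEdge K t x 1 (starredDegree K ℓ c x) 1 (starredDegree K ℓ c) z := by
    intro z hz
    rw [starredDegree, pathDegree_insertEdge hK ht hx hx' hz, hdx]
    unfold Hypergraph.insertEdge starredDegree
    split_ifs <;> omega
  have hsum := sum_insertEdge (ℓ := ℓ) (a := 0) (b := c x - 1) (d := 0) (h := c)
    (show t < ℓ by omega) hx'
  have hcount := sum_insertEdge (ℓ := ℓ) (a := 0) (b := if starredDegree K ℓ c x = Δ then 1 else 0)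
    (d := 0) (h := fun y => if starredDegree K ℓ c y = Δ then 1 else 0) (show t < ℓ by omega) hx'
  refine ⟨by omega, ?_, fun z hz => ?_, ?_⟩
  · have := h.size
    simp only [smul_zero, add_zero] at hsum
    omega
  · rw [hdeg z hz]
    have h3 : (ℓ + 1) * K = ℓ * K + K := by ring
    have h4 := h.degree_le x (by omega)
    unfold Hypergraph.insertEdge
    split_ifs
    · omega
    · exact h.degree_le z (by omega)
    · exact h4
    · omega
    · exact h.degree_le _ (by omega)
  · have h1 := h.count
    rw [card_filter] at h1 ⊢
    rw [sum_congr rfl fun z hz => by rw [hdeg z (Nat.lt_succ_iff.1 (mem_range.1 hz))],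
      sum_congr rfl fun z hz => map_insertEdge (fun d => if d = Δ then 1 else 0) z,
      if_neg (by omega)]
    simp only [smul_zero, add_zero, h1] at hcount
    omega

end Hypergraph

/-! ### Convexity of the potential -/

namespace Hypergraph

open Finset

variable {K ℓ m Δ n : ℕ} {c : ℕ → ℕ}

theorem baseDist_mul (hK : 1 ≤ K) {i j : ℕ} (hij : i ≤ j) :
    baseDist K (i * K) (j * K) = j - i := by
  rw [baseDist_eq_sum (L := j) hK (Nat.mul_le_mul_right _ hij) le_rfl, ← Nat.card_Ico i j,
    card_eq_sum_ones, sum_congr (s₂ := range j) (g := fun t => if t ∈ Ico i j then 1 else 0) rfl,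
    sum_ite_mem, inter_eq_right.2 fun t ht => mem_range.2 (mem_Ico.1 ht).2]
  intro t ht
  rw [mem_range] at ht
  rw [edgeProj_of_ge (x := j * K) (Nat.mul_le_mul_right _ ht)]
  rcases Nat.lt_or_ge t i with h | h
  · rw [edgeProj_of_ge (Nat.mul_le_mul_right _ h), if_pos rfl, if_neg (by simp [h])]
  · have h1 : (t + 1) * K = t * K + K := by ring
    rw [edgeProj_of_le (Nat.mul_le_mul_right _ h), if_neg (by omega),
      if_pos (mem_Ico.2 ⟨h, ht⟩)]

/-- The increment of the potential along the path edge from `tK` to `(t + 1)K`. -/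
noncomputable def slope (K ℓ : ℕ) (W : ℕ → ℝ) (t : ℕ) : ℝ :=
  potential K ℓ W ((t + 1) * K) - potential K ℓ W (t * K)

theorem slope_eq (hK : 1 ≤ K) (W : ℕ → ℝ) {t : ℕ} (ht : t < ℓ) :
    slope K ℓ W t =
      ∑ y ∈ range (t * K + 1), W y - ∑ y ∈ Ico ((t + 1) * K) (ℓ * K + 1), W y := by
  have h1 : t * K ≤ (t + 1) * K := Nat.mul_le_mul_right _ (by omega)
  rw [slope, potential_sub_potential hK W h1 le_rfl le_rfl h1, branchMass_left hK ht,
    branchMass_right hK]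

/-- Passing an inner path vertex moves its weight from the right to the left. -/
theorem slope_add_le (hK : 1 ≤ K) {W : ℕ → ℝ} (hW : ∀ x ≤ ℓ * K, 0 ≤ W x) {t : ℕ}
    (ht : t + 1 < ℓ) : slope K ℓ W t + 2 * W ((t + 1) * K) ≤ slope K ℓ W (t + 1) := by
  have h1 : (t + 1) * K = t * K + K := by ring
  have h2 : (t + 1 + 1) * K = t * K + K + K := by ring
  have h3 : (t + 1 + 1) * K ≤ ℓ * K := Nat.mul_le_mul_right _ ht
  have hL : ∑ y ∈ range (t * K + 1), W y + W ((t + 1) * K) ≤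
      ∑ y ∈ range ((t + 1) * K + 1), W y := by
    rw [sum_range_succ _ ((t + 1) * K)]
    refine add_le_add_left (sum_le_sum_of_subset_of_nonneg (range_mono ?_) fun y hy _ =>
      hW y ?_) _
    · omega
    · rw [mem_range] at hy
      omega
  have hR : W ((t + 1) * K) + ∑ y ∈ Ico ((t + 1 + 1) * K) (ℓ * K + 1), W y ≤
      ∑ y ∈ Ico ((t + 1) * K) (ℓ * K + 1), W y := by
    rw [sum_eq_sum_Ico_succ_bot (show (t + 1) * K < ℓ * K + 1 by omega)]
    refine add_le_add_right (sum_le_sum_of_subset_of_nonneg (Ico_subset_Ico_left ?_) fun y hy _ =>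
      hW y ?_) _
    · omega
    · rw [mem_Ico] at hy
      omega
  rw [slope_eq hK W (by omega), slope_eq hK W ht]
  linarith

theorem slope_le_slope (hK : 1 ≤ K) {W : ℕ → ℝ} (hW : ∀ x ≤ ℓ * K, 0 ≤ W x) {t t' : ℕ}
    (h : t ≤ t') (ht' : t' < ℓ) : slope K ℓ W t ≤ slope K ℓ W t' := by
  induction t', h using Nat.le_induction with
  | base => exact le_rfl
  | succ s hs ih =>
    have h1 := slope_add_le hK hW ht'
    have h2 := hW ((s + 1) * K) (Nat.mul_le_mul_right _ ht'.le)
    linarith [ih (by omega)]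

theorem slope_add_add_le (hK : 1 ≤ K) {W : ℕ → ℝ} (hW : ∀ x ≤ ℓ * K, 0 ≤ W x) {i j : ℕ}
    (hij : i ≤ j) (hj : j + 1 < ℓ) :
    slope K ℓ W i + W ((i + 1) * K) + W ((j + 1) * K) ≤ slope K ℓ W (j + 1) := by
  have h1 := slope_add_le hK hW hj
  rcases hij.eq_or_lt with rfl | h
  · linarith
  · have h2 := slope_add_le hK hW (show i + 1 < ℓ by omega)
    have h3 := slope_le_slope hK hW (show i + 1 ≤ j by omega) (by omega)
    have h4 := hW ((i + 1) * K) (Nat.mul_le_mul_right _ (by omega))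
    have h5 := hW ((j + 1) * K) (Nat.mul_le_mul_right _ (by omega))
    linarith

theorem le_potential_sub_of_le_slope (hK : 1 ≤ K) {W : ℕ → ℝ} (hW : ∀ x ≤ ℓ * K, 0 ≤ W x)
    {i : ℕ} {P : ℝ} (hP : P ≤ slope K ℓ W i) {j : ℕ} (hij : i ≤ j) (hj : j ≤ ℓ) :
    P * (j - i : ℕ) ≤ potential K ℓ W (j * K) - potential K ℓ W (i * K) := by
  induction j, hij using Nat.le_induction with
  | base => simp
  | succ s hs ih =>
    have h1 := slope_le_slope hK hW hs (by omega)
    have h2 := ih (by omega)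
    rw [show s + 1 - i = s - i + 1 by omega]
    push_cast
    unfold slope at h1 hP
    linarith

theorem le_potential_sub_of_slope_le (hK : 1 ≤ K) {W : ℕ → ℝ} (hW : ∀ x ≤ ℓ * K, 0 ≤ W x)
    {i : ℕ} {P : ℝ} (hi : i < ℓ) (hP : slope K ℓ W i ≤ -P) {j : ℕ} (hj : j ≤ i + 1) :
    P * j ≤ potential K ℓ W ((i + 1 - j) * K) - potential K ℓ W ((i + 1) * K) := by
  induction j with
  | zero => simp
  | succ j ih =>
    have h1 := slope_le_slope hK hW (show i - j ≤ i by omega) hi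
    have h2 := ih (by omega)
    unfold slope at h1 hP
    rw [show i - j + 1 = i + 1 - j by omega] at h1
    rw [show i + 1 - (j + 1) = i - j by omega]
    push_cast
    linarith

/-! ### The shape of a maximal caterpillar -/

/-- The stars of `extremalCaterpillar (K + 1) ℓ Δ a b`: `Δ - 2` edges at each of the first `a` and
the last `b` inner path vertices. -/
noncomputable def blockStars (K ℓ Δ a b : ℕ) : ℕ → ℕ :=
  open Classical in fun x =>
    if ∃ i, 0 < i ∧ i < ℓ ∧ (i ≤ a ∨ ℓ ≤ i + b) ∧ x = i * K then Δ - 2 else 0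

theorem extremalCaterpillar_eq (K ℓ Δ a b : ℕ) :
    extremalCaterpillar (K + 1) ℓ Δ a b = starredPath (K + 1) ℓ (blockStars K ℓ Δ a b) := rfl

theorem blockStars_mul (hK : 1 ≤ K) {a b t : ℕ} (ht : 0 < t) (ht' : t < ℓ) :
    blockStars K ℓ Δ a b (t * K) = if t ≤ a ∨ ℓ ≤ t + b then Δ - 2 else 0 := by
  classical
  unfold blockStars
  refine if_congr ⟨?_, fun h => ⟨t, ht, ht', h, rfl⟩⟩ rfl rfl
  rintro ⟨i, -, -, h, hi⟩
  rwa [Nat.eq_of_mul_eq_mul_right hK hi]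

theorem blockStars_of_forall_ne {a b x : ℕ} (hx : ∀ t, 0 < t → t < ℓ → x ≠ t * K) :
    blockStars K ℓ Δ a b x = 0 :=
  if_neg fun ⟨t, h1, h2, _, h3⟩ => hx t h1 h2 h3

/-- Every vertex of the loose path is an end, an inner vertex `tK`, or in the interior of an
edge. -/
theorem pathVertex_cases (hK : 1 ≤ K) {x : ℕ} (hx : x ≤ ℓ * K) :
    x = 0 ∨ x = ℓ * K ∨ (∃ t, 0 < t ∧ t < ℓ ∧ x = t * K) ∨
      ∃ t < ℓ, t * K < x ∧ x < (t + 1) * K := by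
  have h1 := Nat.div_mul_le_self x K
  have h2 := Nat.lt_div_mul_add (a := x) hK
  rcases hx.lt_or_eq with h | h
  · have h3 : x / K < ℓ := (Nat.div_lt_iff_lt_mul hK).2 h
    rcases h1.lt_or_eq with h4 | h4
    · exact Or.inr (Or.inr (Or.inr ⟨_, h3, h4, by rw [Nat.add_mul]; omega⟩))
    · rcases Nat.eq_zero_or_pos (x / K) with h5 | h5
      · left
        rw [← h4, h5, Nat.zero_mul]
      · exact Or.inr (Or.inr (Or.inl ⟨_, h5, h3, h4.symm⟩))
  · exact Or.inr (Or.inl h)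

theorem ne_mul_of_mem {t x i : ℕ} (hx : t * K < x) (hx' : x < (t + 1) * K) : x ≠ i * K := by
  rintro rfl
  have h1 : t < i := lt_of_mul_lt_mul_right hx (Nat.zero_le _)
  have h2 : i < t + 1 := lt_of_mul_lt_mul_right hx' (Nat.zero_le _)
  omega

/-- A caterpillar of maximal radius in its class, in a presentation with the longest possible
path. -/
structure IsMaximal (K m Δ n ℓ : ℕ) (c : ℕ → ℕ) : Prop where
  admissible : IsAdmissible K m Δ n ℓ c
  radius_le : ∀ ℓ' c', IsAdmissible K m Δ n ℓ' c' →
    (starredPath (K + 1) ℓ' c').distanceSpectralRadius ≤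
      (starredPath (K + 1) ℓ c).distanceSpectralRadius
  length_le : ∀ ℓ' c', IsAdmissible K m Δ n ℓ' c' →
    (starredPath (K + 1) ℓ c).IsIsomorphic (starredPath (K + 1) ℓ' c') → ℓ' ≤ ℓ

theorem IsMaximal.of_isIsomorphic (hK : 1 ≤ K) (hΔ : 2 ≤ Δ) (h : IsMaximal K m Δ n ℓ c)
    {c' : ℕ → ℕ} (hiso : (starredPath (K + 1) ℓ c).IsIsomorphic (starredPath (K + 1) ℓ c')) :
    IsMaximal K m Δ n ℓ c' where
  admissible := h.admissible.of_isIsomorphic hK hΔ h.admissible.length_pos hiso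
  radius_le ℓ' c'' h' := hiso.distanceSpectralRadius_eq ▸ h.radius_le ℓ' c'' h'
  length_le ℓ' c'' h' hiso' := h.length_le ℓ' c'' h' (hiso.trans hiso')

theorem IsMaximal.reflect (hK : 1 ≤ K) (hΔ : 2 ≤ Δ) (h : IsMaximal K m Δ n ℓ c) :
    IsMaximal K m Δ n ℓ fun x => c (ℓ * K - x) :=
  h.of_isIsomorphic hK hΔ isIsomorphic_starredPath_reflect

/-- A pendant edge attached at an end of the path, or at another vertex of degree one of the end
edge, would allow for a longer path. -/
theorem IsMaximal.eq_zero_of_le (hK : 1 ≤ K) (hΔ : 2 ≤ Δ) (h : IsMaximal K m Δ n ℓ c) {x : ℕ}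
    (hx : x ≤ K) (hx' : 2 ≤ ℓ → x < K) : c x = 0 := by
  by_contra hc
  obtain ⟨j, hj⟩ : ∃ j, c x = j + 1 := ⟨c x - 1, by omega⟩
  have h1 := isIsomorphic_starredPath_swap (c := c) hx hx' h.admissible.length_pos
  have h2 := h1.trans isIsomorphic_starredPath_reflect
  -- move the star to the vertex `0`, reflect, and absorb one of its edges into the path
  have h3 := h2.trans (isIsomorphic_starredPath_extend (j := j) (by
    rw [Nat.sub_self, Equiv.swap_apply_left, hj]))
  have h4 := h.length_le _ _ (h.admissible.of_isIsomorphic hK hΔ (by omega) h3) h3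
  omega

theorem IsMaximal.eq_zero_of_ge (hK : 1 ≤ K) (hΔ : 2 ≤ Δ) (h : IsMaximal K m Δ n ℓ c) {x : ℕ}
    (hxN : x ≤ ℓ * K) (hx : ℓ * K ≤ x + K) (hx' : 2 ≤ ℓ → ℓ * K < x + K) : c x = 0 := by
  have h1 := (h.reflect hK hΔ).eq_zero_of_le hK hΔ (x := ℓ * K - x) (by omega)
    fun h2 => by have := hx' h2; omega
  rwa [Nat.sub_sub_self hxN] at h1

theorem IsMaximal.eq_zero_of_mem (hK : 1 ≤ K) (hΔ : 3 ≤ Δ) (h : IsMaximal K m Δ n ℓ c) {t x : ℕ}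
    (ht : t < ℓ) (hx : t * K < x) (hx' : x < (t + 1) * K) : c x = 0 := by
  have hN : (t + 1) * K ≤ ℓ * K := Nat.mul_le_mul_right _ ht
  by_contra hc
  rcases Nat.eq_zero_or_pos t with rfl | ht0
  · rw [Nat.zero_add, Nat.one_mul] at hx'
    exact hc (h.eq_zero_of_le hK (by omega) hx'.le fun _ => hx')
  rcases Nat.lt_or_ge (t + 1) ℓ with ht1 | ht1
  · exact absurd (h.radius_le _ _ (h.admissible.insertEdge hK hΔ ht1 hx hx' (by omega)))
      (distanceSpectralRadius_lt_insertEdge hK ht0 ht1 hx hx' (by omega)).not_ge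
  · obtain rfl : ℓ = t + 1 := by omega
    have h1 : (t + 1) * K = t * K + K := by ring
    exact hc (h.eq_zero_of_ge hK (by omega) hx'.le (by omega) fun _ => by omega)

theorem IsMaximal.apply_zero (hK : 1 ≤ K) (hΔ : 2 ≤ Δ) (h : IsMaximal K m Δ n ℓ c) : c 0 = 0 :=
  h.eq_zero_of_le hK hΔ (Nat.zero_le _) fun _ => hK

theorem IsMaximal.apply_last (hK : 1 ≤ K) (hΔ : 2 ≤ Δ) (h : IsMaximal K m Δ n ℓ c) :
    c (ℓ * K) = 0 :=
  h.eq_zero_of_ge hK hΔ le_rfl (by omega) fun _ => by omega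

/-- A star at an inner path vertex that is not full could send an edge to one of the ends: by
convexity, the potential increases fast enough towards at least one of them. -/
theorem IsMaximal.eq_zero_or_eq (hK : 1 ≤ K) (hΔ : 3 ≤ Δ) (h : IsMaximal K m Δ n ℓ c) {i : ℕ}
    (hi : 0 < i) (hi' : i < ℓ) : c (i * K) = 0 ∨ c (i * K) = Δ - 2 := by
  have hiN : i * K < ℓ * K := Nat.mul_lt_mul_of_pos_right hi' hK
  have hi0 : 0 < i * K := Nat.mul_pos hi hK
  have hdeg := h.admissible.degree_le _ hiN.le
  rw [starredDegree, pathDegree_mul hK hi hi'] at hdeg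
  by_contra! hc
  have hcpos : 0 < c (i * K) := by omega
  have hdp : starredDegree K ℓ c (i * K) < Δ := by
    rw [starredDegree, pathDegree_mul hK hi hi']
    omega
  obtain ⟨φ, s, hφ⟩ := exists_isPerron (ℓ := ℓ) (c := c) hK h.admissible.length_pos
  have hW : ∀ x ≤ ℓ * K, 0 ≤ mass K c φ s x := fun x hx => (hφ.mass_pos hx).le
  obtain ⟨j, rfl⟩ : ∃ j, i = j + 1 := ⟨i - 1, by omega⟩
  have h1 := slope_add_le hK hW hi'
  set P : ℝ := K * s ((j + 1) * K) with hP
  have hPW : P ≤ mass K c φ s ((j + 1) * K) := by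
    have h2 := hφ.path_pos _ hiN.le
    have h3 := hφ.leaf_pos _ hiN.le
    have h4 : (1 : ℝ) ≤ c ((j + 1) * K) := by exact_mod_cast hcpos
    have h5 : 0 ≤ P := by positivity
    rw [mass, mul_assoc, ← hP]
    nlinarith
  have key : ∀ q ≤ ℓ * K, (j + 1) * K ≠ q → c q = 0 → pathDegree K ℓ q = 1 →
      P * baseDist K ((j + 1) * K) q ≤ potential K ℓ (mass K c φ s) q -
        potential K ℓ (mass K c φ s) ((j + 1) * K) → False := by
    intro q hq hpq hcq hdq hgain
    refine absurd (h.radius_le _ _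
      (h.admissible.transfer_one hΔ hiN.le hq hpq hcpos hcq hdp hdq)) ?_
    refine (distanceSpectralRadius_lt_transfer hK hφ hiN.le hq hpq hcq one_pos hcpos ?_).not_ge
    rwa [Nat.cast_one, one_mul]
  rcases le_total P (slope K ℓ (mass K c φ s) (j + 1)) with hs | hs
  · refine key (ℓ * K) le_rfl hiN.ne (h.apply_last hK (by omega))
      (pathDegree_last hK h.admissible.length_pos) ?_
    rw [baseDist_mul hK hi'.le]
    exact le_potential_sub_of_le_slope hK hW hs hi'.le le_rfl
  · refine key 0 (Nat.zero_le _) hi0.ne' (h.apply_zero hK (by omega))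
      (pathDegree_zero hK h.admissible.length_pos) ?_
    have h2 := le_potential_sub_of_slope_le hK hW (show j < ℓ by omega)
      (show slope K ℓ (mass K c φ s) j ≤ -P by linarith) (le_refl (j + 1))
    have h3 := baseDist_mul hK (Nat.zero_le (j + 1))
    rw [baseDist_comm, Nat.zero_mul] at h3
    rw [Nat.sub_self, Nat.zero_mul] at h2
    rwa [h3, Nat.sub_zero]

/-- Transferring a star to an unstarred neighbor does not pay off, which bounds the potential there. -/
theorem IsMaximal.potential_lt (hK : 1 ≤ K) (h : IsMaximal K m Δ n ℓ c) {φ s : ℕ → ℝ}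
    (hφ : IsPerron K ℓ c (starredPath (K + 1) ℓ c).distanceSpectralRadius φ s) {i j : ℕ}
    (hi : 0 < i) (hi' : i < ℓ) (hj : 0 < j) (hj' : j < ℓ) (hci : 0 < c (i * K))
    (hcj : c (j * K) = 0) (hd : baseDist K (i * K) (j * K) = 1) :
    potential K ℓ (mass K c φ s) (j * K) - potential K ℓ (mass K c φ s) (i * K) <
      mass K c φ s (i * K) := by
  have hiN : i * K < ℓ * K := Nat.mul_lt_mul_of_pos_right hi' hK
  have hjN : j * K < ℓ * K := Nat.mul_lt_mul_of_pos_right hj' hK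
  have hij : i * K ≠ j * K := by
    intro h1
    rw [h1, baseDist_self] at hd
    omega
  by_contra! hle
  refine absurd (h.radius_le _ _ (h.admissible.swap hK hi hi' hj hj')) ?_
  rw [← transfer_eq_swap hij hcj]
  refine (distanceSpectralRadius_lt_transfer hK hφ hiN.le hjN.le hij hcj hci le_rfl ?_).not_ge
  have h2 := hφ.path_pos _ hiN.le
  rw [hd, Nat.cast_one, mul_one]
  rw [mass] at hle
  linarith

/-- Two gaps `u_i` and `u_{j+2}` among the inner path vertices cannot have stars next to them on the
sides facing each other: by convexity, one of these stars could move into its gap. -/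
theorem IsMaximal.not_gap_gap (hK : 1 ≤ K) (h : IsMaximal K m Δ n ℓ c) {i j : ℕ} (hi : 0 < i)
    (hij : i ≤ j) (hj : j + 2 < ℓ) (hi0 : c (i * K) = 0) (hi1 : 0 < c ((i + 1) * K))
    (hj1 : 0 < c ((j + 1) * K)) (hj2 : c ((j + 2) * K) = 0) : False := by
  obtain ⟨φ, s, hφ⟩ := exists_isPerron (ℓ := ℓ) (c := c) hK h.admissible.length_pos
  have hW : ∀ x ≤ ℓ * K, 0 ≤ mass K c φ s x := fun x hx => (hφ.mass_pos hx).le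
  have h1 := h.potential_lt hK hφ (i := i + 1) (j := i) (by omega) (by omega) hi (by omega) hi1 hi0
    (by rw [baseDist_comm, baseDist_mul hK (by omega)]; omega)
  have h2 := h.potential_lt hK hφ (i := j + 1) (j := j + 2) (by omega) (by omega) (by omega) hj hj1
    hj2 (by rw [baseDist_mul hK (by omega)]; omega)
  have h3 := slope_add_add_le hK hW hij (by omega)
  unfold slope at h3
  linarith

/-- The stars fill an initial and a final segment of the inner path vertices. -/
theorem IsMaximal.exists_eq_blockStars (hK : 1 ≤ K) (hΔ : 3 ≤ Δ) (h : IsMaximal K m Δ n ℓ c) :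
    ∃ a b, a + b + 1 ≤ ℓ ∧ ∀ x ≤ ℓ * K, c x = blockStars K ℓ Δ a b x := by
  have hℓ := h.admissible.length_pos
  suffices hab : ∃ a b, a + b + 1 ≤ ℓ ∧
      ∀ t, 0 < t → t < ℓ → (0 < c (t * K) ↔ t ≤ a ∨ ℓ ≤ t + b) by
    obtain ⟨a, b, h1, h2⟩ := hab
    refine ⟨a, b, h1, fun x hx => ?_⟩
    rcases pathVertex_cases hK hx with rfl | rfl | ⟨t, ht, ht', rfl⟩ | ⟨t, ht, hx1, hx2⟩
    · rw [h.apply_zero hK (by omega), blockStars_of_forall_ne]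
      intro t ht _
      exact (Nat.mul_pos ht hK).ne
    · rw [h.apply_last hK (by omega), blockStars_of_forall_ne]
      intro t _ ht
      exact (Nat.mul_lt_mul_of_pos_right ht hK).ne'
    · rw [blockStars_mul hK ht ht']
      have h3 := h2 t ht ht'
      have h4 := h.eq_zero_or_eq hK hΔ ht ht'
      split_ifs <;> omega
    · rw [h.eq_zero_of_mem hK hΔ ht hx1 hx2, blockStars_of_forall_ne]
      exact fun i _ _ => ne_mul_of_mem hx1 hx2
  classical
  have hlast := h.apply_last hK (by omega)
  have hex : ∃ a, c ((a + 1) * K) = 0 := ⟨ℓ - 1, by rwa [Nat.sub_add_cancel hℓ]⟩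
  obtain ⟨a, ha, hamin⟩ : ∃ a, c ((a + 1) * K) = 0 ∧ ∀ t < a, c ((t + 1) * K) ≠ 0 :=
    ⟨Nat.find hex, Nat.find_spec hex, fun t ht => Nat.find_min hex ht⟩
  have haℓ : a + 1 ≤ ℓ := by
    by_contra! hlt
    refine hamin (ℓ - 1) (by omega) ?_
    rwa [Nat.sub_add_cancel hℓ]
  have hleft : ∀ t, 0 < t → t ≤ a → 0 < c (t * K) := by
    intro t ht hta
    have h1 := hamin (t - 1) (by omega)
    rw [Nat.sub_add_cancel ht] at h1
    omega
  have hex' : ∃ i, a < i ∧ (ℓ ≤ i ∨ 0 < c (i * K)) := ⟨ℓ, haℓ, Or.inl le_rfl⟩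
  obtain ⟨i, ⟨hai, hi⟩, himin⟩ : ∃ i, (a < i ∧ (ℓ ≤ i ∨ 0 < c (i * K))) ∧
      ∀ t < i, ¬ (a < t ∧ (ℓ ≤ t ∨ 0 < c (t * K))) :=
    ⟨Nat.find hex', Nat.find_spec hex', fun t ht => Nat.find_min hex' ht⟩
  have hiℓ : i ≤ ℓ := by
    by_contra! hlt
    exact himin ℓ hlt ⟨haℓ, Or.inl le_rfl⟩
  have hright : ∀ t, i ≤ t → t < ℓ → 0 < c (t * K) := by
    intro t hit
    induction t, hit using Nat.le_induction with
    | base => omega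
    | succ t hit ih =>
      intro ht
      by_contra h0
      have hia : i ≠ a + 1 := by
        rintro rfl
        omega
      obtain ⟨i', rfl⟩ : ∃ i', i = i' + 1 := ⟨i - 1, by omega⟩
      obtain ⟨t', rfl⟩ : ∃ t', t = t' + 1 := ⟨t - 1, by omega⟩
      have h1 := himin i' (by omega)
      exact h.not_gap_gap hK (i := i') (j := t') (by omega) (by omega) (by omega) (by omega)
        (by omega) (ih (by omega)) (Nat.eq_zero_of_not_pos h0)
  refine ⟨a, ℓ - i, by omega, fun t ht ht' => ⟨fun hc => ?_, ?_⟩⟩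
  · by_contra! hlt
    exact himin t (by omega) ⟨hlt.1, Or.inr hc⟩
  · rintro (hta | hti)
    · exact hleft t ht hta
    · exact hright t (by omega) ht'

/-- The numbers of full vertices and of edges determine `a + b` and the length of the path. -/
theorem IsAdmissible.blockStars_length (hK : 1 ≤ K) (hΔ : 3 ≤ Δ) {a b : ℕ} (hab : a + b + 1 ≤ ℓ)
    (h : IsAdmissible K m Δ n ℓ (blockStars K ℓ Δ a b)) :
    a + b = n ∧ ℓ = m - n * (Δ - 2) := by
  set F : Finset ℕ := (Icc 1 a ∪ Ico (ℓ - b) ℓ).image (· * K) with hF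
  have hmemF : ∀ x, x ∈ F ↔ ∃ i, 0 < i ∧ i < ℓ ∧ (i ≤ a ∨ ℓ ≤ i + b) ∧ x = i * K := by
    intro x
    simp only [hF, mem_image, mem_union, mem_Icc, mem_Ico]
    constructor
    · rintro ⟨i, hi, rfl⟩
      exact ⟨i, by omega, by omega, by omega, rfl⟩
    · rintro ⟨i, h1, h2, h3, rfl⟩
      exact ⟨i, by omega, rfl⟩
  have hcardF : #F = a + b := by
    rw [hF, card_image_of_injective _ fun i j hij => Nat.eq_of_mul_eq_mul_right hK hij,
      card_union_of_disjoint, Nat.card_Icc, Nat.card_Ico]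
    · omega
    · rw [disjoint_left]
      intro i hi hi'
      rw [mem_Icc] at hi
      rw [mem_Ico] at hi'
      omega
  have hc : ∀ x, blockStars K ℓ Δ a b x = if x ∈ F then Δ - 2 else 0 := by
    intro x
    classical
    unfold blockStars
    exact if_congr (hmemF x).symm rfl rfl
  have hFN : ∀ x ∈ F, x ∈ range (ℓ * K + 1) := by
    intro x hx
    obtain ⟨i, -, hi, -, rfl⟩ := (hmemF x).1 hx
    rw [mem_range, Nat.lt_succ_iff]
    exact Nat.mul_le_mul_right _ hi.le
  have hdeg : ∀ x ∈ range (ℓ * K + 1), starredDegree K ℓ (blockStars K ℓ Δ a b) x = Δ ↔ x ∈ F := by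
    intro x hx
    have hx : x ≤ ℓ * K := Nat.lt_succ_iff.1 (mem_range.1 hx)
    rw [starredDegree, hc]
    by_cases hxF : x ∈ F
    · obtain ⟨i, h1, h2, -, rfl⟩ := (hmemF x).1 hxF
      rw [if_pos hxF, pathDegree_mul hK h1 h2]
      exact iff_of_true (by omega) hxF
    · have h2 : pathDegree K ℓ x ≤ 2 := by
        rcases pathVertex_cases hK hx with rfl | rfl | ⟨t, ht, ht', rfl⟩ | ⟨t, ht, hx1, hx2⟩
        · rw [pathDegree_zero hK h.length_pos]
          omega
        · rw [pathDegree_last hK h.length_pos]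
          omega
        · rw [pathDegree_mul hK ht ht']
        · rw [pathDegree_of_mem ht hx1 hx2]
          omega
      rw [if_neg hxF]
      exact iff_of_false (by omega) hxF
  have hn : a + b = n := by
    rw [← h.count, filter_congr hdeg, filter_mem_eq_inter, inter_eq_right.2 hFN, hcardF]
  refine ⟨hn, ?_⟩
  have hm := h.size
  rw [sum_congr rfl fun x _ => hc x, sum_ite_mem, inter_eq_right.2 hFN, sum_const, hcardF, hn,
    smul_eq_mul] at hm
  omega

theorem blockStars_reflect {a b x : ℕ} (hx : x ≤ ℓ * K) :
    blockStars K ℓ Δ a b (ℓ * K - x) = blockStars K ℓ Δ b a x := by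
  classical
  unfold blockStars
  refine if_congr ⟨?_, ?_⟩ rfl rfl
  · rintro ⟨i, h1, h2, h3, h4⟩
    refine ⟨ℓ - i, by omega, by omega, by omega, ?_⟩
    rw [Nat.sub_mul]
    omega
  · rintro ⟨i, h1, h2, h3, rfl⟩
    refine ⟨ℓ - i, by omega, by omega, by omega, ?_⟩
    rw [Nat.sub_mul]

/-- The reflection move shows that the two segments of stars have almost the same length. -/
theorem IsMaximal.le_add_one (hK : 1 ≤ K) (hΔ : 3 ≤ Δ) {a b : ℕ} (hab : a + b + 2 ≤ ℓ)
    (h : IsMaximal K m Δ n ℓ (blockStars K ℓ Δ a b)) : b ≤ a + 1 := by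
  by_contra! hlt
  have hval := fun t ht ht' => blockStars_mul (ℓ := ℓ) (Δ := Δ) (a := a) (b := b) (t := t) hK ht ht'
  have hm : ℓ - b + a + 1 - (a + 1) = ℓ - b := by omega
  have hq : blockStars K ℓ Δ a b ((a + 1) * K) = 0 := by
    rw [hval _ (by omega) (by omega), if_neg (by omega)]
  have hp : blockStars K ℓ Δ a b ((ℓ - b) * K) = Δ - 2 := by
    rw [hval _ (by omega) (by omega), if_pos (by omega)]
  -- the first gap is at `a + 1`, and its mirror image in the segment is to be the first star of the
  -- final block, so that the segment has `a + 1 + (ℓ - b)` edges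
  have h1 := distanceSpectralRadius_lt_transfer_reflect (ℓ := ℓ) (c := blockStars K ℓ Δ a b) hK
    (m := ℓ - b + a + 1) (i := a + 1) (by omega) (by omega) (by omega)
    (fun t _ x hx hx' => blockStars_of_forall_ne fun i _ _ => ne_mul_of_mem hx hx')
    (blockStars_of_forall_ne fun i hi _ => (Nat.mul_pos hi hK).ne) hq (by rw [hm, hp]; omega) ?_
  · rw [hm, transfer_eq_swap _ hq] at h1
    · exact absurd (h.radius_le _ _
        (h.admissible.swap hK (by omega) (by omega) (by omega) (by omega))) h1.not_ge
    · exact (Nat.mul_lt_mul_of_pos_right (show a + 1 < ℓ - b by omega) hK).ne'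
  · rw [hm]
    intro x hx0 hxm hxq hxp
    by_cases hx : ∃ t, x = t * K
    · obtain ⟨t, rfl⟩ := hx
      have ht0 : 0 < t := Nat.pos_of_mul_pos_right hx0
      have htm : t < ℓ - b + a + 1 := lt_of_mul_lt_mul_right hxm (Nat.zero_le _)
      have htq : t ≠ a + 1 := fun h => hxq (by rw [h])
      have htp : t ≠ ℓ - b := fun h => hxp (by rw [h])
      rw [← Nat.sub_mul, hval _ (by omega) (by omega), hval _ ht0 (by omega)]
      exact if_congr (by omega) rfl rfl
    · rw [blockStars_of_forall_ne, blockStars_of_forall_ne]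
      · exact fun i _ _ h => hx ⟨i, h⟩
      · intro i _ _ h
        refine hx ⟨ℓ - b + a + 1 - i, ?_⟩
        rw [Nat.sub_mul]
        omega

theorem blockStars_eq_of_add_eq {a b a' b' x : ℕ} (h : a + b = a' + b')
    (h' : a = a' ∨ ℓ ≤ a + b + 1) : blockStars K ℓ Δ a b x = blockStars K ℓ Δ a' b' x := by
  classical
  unfold blockStars
  refine if_congr (exists_congr fun i => ?_) rfl rfl
  constructor <;> rintro ⟨h1, h2, h3, h4⟩ <;> exact ⟨h1, h2, by omega, h4⟩

theorem IsMaximal.isIsomorphic_extremalCaterpillar (hK : 1 ≤ K) (hΔ : 3 ≤ Δ)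
    (h : IsMaximal K m Δ n ℓ c) :
    (starredPath (K + 1) ℓ c).IsIsomorphic
      (extremalCaterpillar (K + 1) (m - n * (Δ - 2)) Δ (n / 2) ((n + 1) / 2)) := by
  have key : ∀ a b c, a ≤ b → a + b + 1 ≤ ℓ → IsMaximal K m Δ n ℓ c →
      (∀ x ≤ ℓ * K, c x = blockStars K ℓ Δ a b x) → (starredPath (K + 1) ℓ c).IsIsomorphic
        (extremalCaterpillar (K + 1) (m - n * (Δ - 2)) Δ (n / 2) ((n + 1) / 2)) := by
    intro a b c hab hℓ h hc
    rw [starredPath_congr hc]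
    have h' := h.of_isIsomorphic hK (by omega) (c' := blockStars K ℓ Δ a b)
      (by rw [starredPath_congr hc]; exact .refl _)
    obtain ⟨h1, h2⟩ := h'.admissible.blockStars_length hK hΔ hℓ
    have h3 : a = n / 2 ∨ ℓ ≤ a + b + 1 := by
      by_contra! h4
      have := h'.le_add_one hK hΔ (by omega)
      omega
    rw [extremalCaterpillar_eq, ← h2, starredPath_congr fun x _ =>
      blockStars_eq_of_add_eq (a' := n / 2) (b' := (n + 1) / 2) (by omega) h3]
    exact .refl _
  obtain ⟨a, b, hℓ, hc⟩ := h.exists_eq_blockStars hK hΔ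
  rcases le_total a b with hab | hab
  · exact key a b c hab hℓ h hc
  · refine isIsomorphic_starredPath_reflect.trans
      (key b a _ hab (by omega) (h.reflect hK (by omega)) fun x hx => ?_)
    rw [hc _ (Nat.sub_le _ _), blockStars_reflect hx]

theorem IsAdmissible.isIsomorphic_of_forall_le (hK : 1 ≤ K) (hΔ : 3 ≤ Δ)
    (h : IsAdmissible K m Δ n ℓ c)
    (hmax : ∀ ℓ' c', IsAdmissible K m Δ n ℓ' c' →
      (starredPath (K + 1) ℓ' c').distanceSpectralRadius ≤
        (starredPath (K + 1) ℓ c).distanceSpectralRadius) :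
    (starredPath (K + 1) ℓ c).IsIsomorphic
      (extremalCaterpillar (K + 1) (m - n * (Δ - 2)) Δ (n / 2) ((n + 1) / 2)) := by
  -- the lengths of the paths in all presentations of the given caterpillar
  let S : Set ℕ := {ℓ' | ∃ c', IsAdmissible K m Δ n ℓ' c' ∧
    (starredPath (K + 1) ℓ c).IsIsomorphic (starredPath (K + 1) ℓ' c')}
  have hS : S.Nonempty := ⟨ℓ, c, h, .refl _⟩
  have hbdd : BddAbove S := by
    refine ⟨m, ?_⟩
    rintro ℓ' ⟨c', h', -⟩
    have := h'.size
    omega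
  obtain ⟨c', h', hiso⟩ := Nat.sSup_mem hS hbdd
  refine hiso.trans (IsMaximal.isIsomorphic_extremalCaterpillar hK hΔ ⟨h', ?_, ?_⟩)
  · intro ℓ'' c'' h''
    rw [← hiso.distanceSpectralRadius_eq]
    exact hmax ℓ'' c'' h''
  · intro ℓ'' c'' h'' hiso'
    exact le_csSup hbdd ⟨c'', h'', hiso.trans hiso'⟩

theorem finite_setOf_distanceSpectralRadius (K m Δ n : ℕ) :
    {r | ∃ ℓ c, IsAdmissible K m Δ n ℓ c ∧
      (starredPath (K + 1) ℓ c).distanceSpectralRadius = r}.Finite := by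
  refine (Set.finite_range fun p : Fin (m + 1) × (Fin (m * K + 1) → Fin (Δ + 1)) =>
    (starredPath (K + 1) p.1 fun x =>
      if hx : x < m * K + 1 then (p.2 ⟨x, hx⟩ : ℕ) else 0).distanceSpectralRadius).subset ?_
  rintro r ⟨ℓ, c, h, rfl⟩
  have hℓ : ℓ ≤ m := by
    have := h.size
    omega
  have hN : ℓ * K ≤ m * K := Nat.mul_le_mul_right _ hℓ
  refine ⟨(⟨ℓ, by omega⟩, fun x => ⟨min (c x) Δ, by omega⟩), ?_⟩
  dsimp only
  congr 1
  refine starredPath_congr fun x hx => ?_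
  have hd := h.degree_le x hx
  unfold starredDegree at hd
  rw [dif_pos (by omega)]
  omega

/-- The maximum of the radius is attained, since only finitely many values occur. -/
theorem IsAdmissible.exists_forall_le (h : IsAdmissible K m Δ n ℓ c) :
    ∃ ℓ' c', IsAdmissible K m Δ n ℓ' c' ∧ ∀ ℓ'' c'', IsAdmissible K m Δ n ℓ'' c'' →
      (starredPath (K + 1) ℓ'' c'').distanceSpectralRadius ≤
        (starredPath (K + 1) ℓ' c').distanceSpectralRadius := by
  obtain ⟨_, ⟨ℓ', c', h', rfl⟩, hmax⟩ := Set.exists_max_image _ id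
    (finite_setOf_distanceSpectralRadius K m Δ n) ⟨_, ℓ, c, h, rfl⟩
  exact ⟨ℓ', c', h', fun ℓ'' c'' h'' => hmax _ ⟨ℓ'', c'', h'', rfl⟩⟩

end Hypergraph

theorem mainTheorem2 {α : Type*} (k m Δ n : ℕ) (hk : 2 ≤ k) (hΔ : 3 ≤ Δ) (hn : 2 ≤ n)
    (T : Hypergraph α) [Finite T.vertexSet]
    (hT : T.IsInHypertreeClass k m Δ n) (hcat : T.IsCaterpillar k) :
    T.distanceSpectralRadius ≤
        (Hypergraph.extremalCaterpillar k (m - n * (Δ - 2)) Δ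
          (n / 2) ((n + 1) / 2)).distanceSpectralRadius ∧
      (T.distanceSpectralRadius =
          (Hypergraph.extremalCaterpillar k (m - n * (Δ - 2)) Δ
            (n / 2) ((n + 1) / 2)).distanceSpectralRadius ↔
        T.IsIsomorphic
          (Hypergraph.extremalCaterpillar k (m - n * (Δ - 2)) Δ (n / 2) ((n + 1) / 2))) := by
  obtain ⟨K, rfl⟩ : ∃ K, k = K + 1 := ⟨k - 1, by omega⟩
  have hK : 1 ≤ K := by omega
  obtain ⟨ℓ, hℓ, c, hiso⟩ := hcat
  have hdata : T.HasDegreeData m Δ n :=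
    ⟨hT.size, fun x hx => hT.maxDegree.2 ⟨x, hx, rfl⟩, hT.count⟩
  have h := (Hypergraph.hasDegreeData_starredPath_iff hK (by omega) hℓ).1
    (hdata.of_isIsomorphic hiso)
  obtain ⟨ℓ', c', h', hmax⟩ := h.exists_forall_le
  rw [hiso.distanceSpectralRadius_eq,
    ← (h'.isIsomorphic_of_forall_le hK hΔ hmax).distanceSpectralRadius_eq]
  refine ⟨hmax ℓ c h, fun heq => ?_, fun hT' => ?_⟩
  · refine hiso.trans (h.isIsomorphic_of_forall_le hK hΔ ?_)
    rwa [heq]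
  · rw [← hiso.distanceSpectralRadius_eq, hT'.distanceSpectralRadius_eq,
      (h'.isIsomorphic_of_forall_le hK hΔ hmax).distanceSpectralRadius_eq]
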